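/- Let $d,d',l\ge 1$ and let $\mathcal T_d=\prod_{j=1}^d[T_{j1},T_{j2}]$ with $T_{j1}<T_{j2}$. For $i\in\mathbb Z$ consider the partially linear time series model $$Y_i=Z_i^\top\beta+\mu(X_i)+\sigma(X_i)\epsilon_i,\qquad Z_i=\mathfrak h(X_i)+u_i,$$ $$X_i=H(\ldots,v_{i-1},v_i)\in\mathbb R^d,\qquad u_i=f(\ldots,e_{i-1},e_i)\in\mathbb R^l,\qquad \epsilon_i=\sum_{k\ge0}a_k\eta_{i-k}\in\mathbb R,$$ with fixed $\beta\in\mathbb R^l$, measurable functions $\mu,\sigma:\mathbb R^d\to\mathbb R$, $\mathfrak h:\mathbb R^d\to\mathbb R^l$, $H$, $f$, real coefficients $a_k$, and i.i.d. sequences $(v_i)$ in $\mathbb R^{d'}$, $(e_i)$ in $\mathbb R^l$, $(\eta_i)$ in $\mathbb R$. The process $(\eta_i)$ is independent of the process $(X_i,Z_i)$, and the process $(e_i)$ is independent of the process $(X_i,\epsilon_i)$. Write $\|\xi\|_r=(\mathbb E|\xi|^r)^{1/r}$. An index $\{m\}$ means that the input at time $m$ ($v_m$ or $e_m$) is replaced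 by an independent copy of it. Assume: 1. (Trend and volatility) For some $\delta>0$, $\mu$ and $\sigma$ are Lipschitz continuous on the union $\mathcal T_d^{\delta}$ of $\mathcal T_d$ and the set of those points of the support of the law of $X_i$ that are within distance $\delta$ of $\mathcal T_d$ (if the law of $X_i$ has support $\mathcal T_d$, then $\mathcal T_d^\delta=\mathcal T_d$); and $0<c_\sigma\le\sigma\le c_\sigma'$ on $\mathcal T_d$ for some constants $c_\sigma,c_\sigma'$. 2. (Kernel and bandwidth) $K\ge0$ has support $[-1,1]^d$, is twice continuously differentiable on $[-1,1]^d$, is bounded there together with its first-order derivatives, and $\int_{[-1,1]^d}K=1$. The bandwidths $h=h_n>0$ satisfy $h\to0$ and $h^dn\to\infty$. Moreover $K(0)>0$ or $\log(n)/(h^dn)\to0$. 3. (Moments of the innovations) $\mathbb E\eta_i=0$, $\mathbb E\eta_i^2=1$ and $\|\eta_i\|_q<\infty$ for some $q\ge4$. 4. (Dependence of $\epsilon$) $\sum_k|a_k|<\infty$, $S=|\sum_{k\ge0}a_k|>0$, and for some $\zeta>1$ and $C$, $\sum_{k\ge m}|a_k|/S\le C(1\vee m)^{-\zeta}$ for all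 integers $m\ge0$. 5. (Covariates) $X_i$ has a density $g$, and, given $\mathcal F_{i-1}=(\ldots,v_{i-2},v_{i-1})$, a conditional density $g(\cdot\mid\mathcal F_{i-1})$; for some $s>2$, $\|g(x\mid\mathcal F_{i-1})\|_s<\infty$ for all $x\in\mathcal T_d$, and, with $\theta_{k,s}=\sup_{x\in\mathcal T_d}\|g(x\mid\mathcal F_{i-1})-g(x\mid\mathcal F_{i-1,\{i-k\}})\|_s$, for some $\xi>0$ and $C$, $\sum_{k\ge m}\theta_{k,s}\le Cm^{-\xi}$ for all $m\ge1$. On $\mathcal T_d$ the density satisfies $0<c_g\le g\le c_g'$ for some constants $c_g,c_g'$, and its first-order partial derivatives (within $\mathcal T_d$) exist and are bounded. 6. (Random design) $\mathfrak h$ is bounded, and Lipschitz continuous on $\mathcal T_d^\delta$; $\mathbb Eu_i=0$; the smallest eigenvalue of $\Sigma_u=\mathbb E(u_iu_i^\top)$ is positive; and for some $p\ge4$, $0<\|u_{ij}\|_p<\infty$ for $1\le j\le l$ and $\sum_{k\ge0}\big\|\max_{1\le j\le l}|u_{ij}-u_{ij,\{i-k\}}|\big\|_p<\infty$. From the observations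 $(Z_i,X_i,Y_i)$, $1\le i\le n$, form the weights $w_h(x,X_t)=K_h(x-X_t)/\sum_{s=1}^nK_h(x-X_s)$, where $K_h(\cdot)=K(\cdot/h)/h^d$, the kernel estimators $\tilde Y_i=\sum_{t=1}^nw_h(X_i,X_t)Y_t$ and $\tilde Z_i=\sum_{t=1}^nw_h(X_i,X_t)Z_t$, and Robinson's estimator $$\hat\beta=\Big(\sum_{i=1}^n(Z_i-\tilde Z_i)(Z_i-\tilde Z_i)^\top\mathbf 1_{X_i\in\mathcal T_d}\Big)^{-1}\Big(\sum_{i=1}^n(Y_i-\tilde Y_i)(Z_i-\tilde Z_i)\mathbf 1_{X_i\in\mathcal T_d}\Big).$$ If $h^4n\to0$, then $|\hat\beta-\beta|_\infty=O_{\mathbb P}(n^{-1/2})$; that is, for every $\varepsilon>0$ there is $C>0$ such that $\mathbb P(\sqrt n\,|\hat\beta-\beta|_\infty\le C)>1-\varepsilon$ for all large $n$. -/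

import Mathlib

open MeasureTheory ProbabilityTheory Filter Topology Set
open scoped ENNReal NNReal

noncomputable section

/-- The sequence of all inputs up to time `m`, listed backwards:
`(w m, w (m - 1), w (m - 2), …)`. -/
def past {Ω E : Type*} (w : ℤ → Ω → E) (m : ℤ) (ω : Ω) : ℕ → E :=
  fun j => w (m - j) ω

/-- The inputs up to time `m` in which the input at time `m - j` has been replaced by that of an
independent copy of the input process. The copy lives on the second factor of `Ω × Ω`, which
carries the product measure. -/
def coupledPast {Ω E : Type*} (w : ℤ → Ω → E) (m : ℤ) (j : ℕ) (p : Ω × Ω) : ℕ → E :=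
  Function.update (past w m p.1) j (w (m - j) p.2)

/-- Independent and identically distributed random elements indexed by `ℤ`. -/
structure IsIID {Ω E : Type*} [MeasurableSpace Ω] [MeasurableSpace E] (P : Measure Ω)
    (w : ℤ → Ω → E) : Prop where
  measurable : ∀ i, Measurable (w i)
  indep : iIndepFun w P
  identDistrib : ∀ i, IdentDistrib (w i) (w 0) P P

/-- `X n = O_P(r n)` as `n → ∞`, for a deterministic sequence `r`. -/
def IsBigOP {Ω : Type*} [MeasurableSpace Ω] (P : Measure Ω) (X : ℕ → Ω → ℝ) (r : ℕ → ℝ) : Prop :=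
  ∀ ε > 0, ∃ C > 0, ∀ᶠ n : ℕ in atTop, 1 - ε < P.real {ω | |X n ω / r n| ≤ C}

/-- The ingredients of the partially linear time series model, with covariates in `ℝ^d` (driven by
inputs in `ℝ^d'`) and in `ℝ^l`. Vectors `Fin d → ℝ` carry the maximum norm. This is a bundle of
data only. -/
structure PLModel (Ω : Type*) (d d' l : ℕ) where
  /-- inputs of the covariate process -/
  v : ℤ → Ω → (Fin d' → ℝ)
  /-- inputs of the process `u` -/
  e : ℤ → Ω → (Fin l → ℝ)
  /-- innovations of the errors -/
  η : ℤ → Ω → ℝ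
  /-- the covariate is `H (v i, v (i - 1), …)` -/
  H : (ℕ → (Fin d' → ℝ)) → (Fin d → ℝ)
  /-- `u i = f (e i, e (i - 1), …)` -/
  f : (ℕ → (Fin l → ℝ)) → (Fin l → ℝ)
  /-- moving average coefficients of the errors -/
  a : ℕ → ℝ
  /-- the parametric part -/
  β : Fin l → ℝ
  /-- trend function -/
  μ : (Fin d → ℝ) → ℝ
  /-- volatility function -/
  σ : (Fin d → ℝ) → ℝ
  /-- regression function of `Z` on `X` -/
  hfun : (Fin d → ℝ) → (Fin l → ℝ)

namespace PLModel

variable {Ω : Type*} {d d' l : ℕ}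

/-- The covariates of the nonparametric part. -/
def X (M : PLModel Ω d d' l) (i : ℤ) (ω : Ω) : Fin d → ℝ := M.H (past M.v i ω)

/-- The noise of the random design. -/
def u (M : PLModel Ω d d' l) (i : ℤ) (ω : Ω) : Fin l → ℝ := M.f (past M.e i ω)

/-- The errors, a moving average of infinite order. -/
def ε (M : PLModel Ω d d' l) (i : ℤ) (ω : Ω) : ℝ := ∑' k : ℕ, M.a k * M.η (i - k) ω

/-- The covariates of the parametric part. -/
def Z (M : PLModel Ω d d' l) (i : ℤ) (ω : Ω) : Fin l → ℝ := M.hfun (M.X i ω) + M.u i ω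

/-- The responses. -/
def Y (M : PLModel Ω d d' l) (i : ℤ) (ω : Ω) : ℝ :=
  M.Z i ω ⬝ᵥ M.β + M.μ (M.X i ω) + M.σ (M.X i ω) * M.ε i ω

/-- The weight `K_h(x - X_t) / ∑_{s=1}^n K_h(x - X_s)`, where `K_h = K(· / h) / h ^ d`. -/
def weight (M : PLModel Ω d d' l) (K : (Fin d → ℝ) → ℝ) (h : ℝ) (n : ℕ) (x : Fin d → ℝ)
    (t : ℤ) (ω : Ω) : ℝ :=
  (K (h⁻¹ • (x - M.X t ω)) / h ^ d) /
    ∑ s ∈ Finset.Icc (1 : ℤ) n, K (h⁻¹ • (x - M.X s ω)) / h ^ d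

/-- Kernel estimator of `Y i` given `X i`. -/
def Ytilde (M : PLModel Ω d d' l) (K : (Fin d → ℝ) → ℝ) (h : ℝ) (n : ℕ) (i : ℤ) (ω : Ω) : ℝ :=
  ∑ t ∈ Finset.Icc (1 : ℤ) n, M.weight K h n (M.X i ω) t ω * M.Y t ω

/-- Kernel estimator of `Z i` given `X i`. -/
def Ztilde (M : PLModel Ω d d' l) (K : (Fin d → ℝ) → ℝ) (h : ℝ) (n : ℕ) (i : ℤ) (ω : Ω) :
    Fin l → ℝ :=
  ∑ t ∈ Finset.Icc (1 : ℤ) n, M.weight K h n (M.X i ω) t ω • M.Z t ω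

open Classical in
/-- Robinson's estimator of `β`, computed from the observations `1, …, n` with kernel `K`,
bandwidth `h` and trimming region `T`. -/
def betaHat (M : PLModel Ω d d' l) (K : (Fin d → ℝ) → ℝ) (h : ℝ) (T : Set (Fin d → ℝ)) (n : ℕ)
    (ω : Ω) : Fin l → ℝ :=
  (∑ i ∈ Finset.Icc (1 : ℤ) n, if M.X i ω ∈ T then
      Matrix.vecMulVec (M.Z i ω - M.Ztilde K h n i ω) (M.Z i ω - M.Ztilde K h n i ω) else 0)⁻¹.mulVec
    (∑ i ∈ Finset.Icc (1 : ℤ) n, if M.X i ω ∈ T then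
      (M.Y i ω - M.Ytilde K h n i ω) • (M.Z i ω - M.Ztilde K h n i ω) else 0)

variable [MeasurableSpace Ω]

/-- Standing conditions of the model: measurability of the functions, i.i.d. inputs, errors
independent of the covariates `(X, Z)` and inputs `e` independent of `X` and of the errors. -/
structure Standing (M : PLModel Ω d d' l) (P : Measure Ω) : Prop where
  measurable_H : Measurable M.H
  measurable_f : Measurable M.f
  measurable_μ : Measurable M.μ
  measurable_σ : Measurable M.σ
  measurable_hfun : Measurable M.hfun
  iid_v : IsIID P M.v
  iid_e : IsIID P M.e
  iid_η : IsIID P M.η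
  indep_η : IndepFun (fun ω i => M.η i ω) (fun ω => (fun i => M.X i ω, fun i => M.Z i ω)) P
  indep_e : IndepFun (fun ω i => M.e i ω) (fun ω => (fun i => M.X i ω, fun i => M.ε i ω)) P

/-- The region `T`, together with the part of the support of the covariates that lies within
distance `δ` of `T`. If `T` is the support of the covariates, this is `T` itself. -/
def smoothRegion (M : PLModel Ω d d' l) (P : Measure Ω) (T : Set (Fin d → ℝ)) (δ : ℝ) :
    Set (Fin d → ℝ) :=
  T ∪ (Metric.cthickening δ T ∩ (P.map (M.X 0)).support)

/-- Trend and volatility: Lipschitz continuity, and bounds of the volatility on `T`. -/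
structure TrendVolatility (M : PLModel Ω d d' l) (P : Measure Ω) (T : Set (Fin d → ℝ)) (δ : ℝ) :
    Prop where
  lipschitz_μ : ∃ C : ℝ≥0, LipschitzOnWith C M.μ (M.smoothRegion P T δ)
  lipschitz_σ : ∃ C : ℝ≥0, LipschitzOnWith C M.σ (M.smoothRegion P T δ)
  bounds_σ : ∃ c c' : ℝ, 0 < c ∧ ∀ x ∈ T, c ≤ M.σ x ∧ M.σ x ≤ c'

/-- The innovations of the errors are centered with unit variance and have a finite `q`-th
moment. -/
structure ErrorMoment (M : PLModel Ω d d' l) (P : Measure Ω) (q : ℝ) : Prop where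
  four_le : 4 ≤ q
  memLp : ∀ i, MemLp (M.η i) (ENNReal.ofReal q) P
  mean : ∀ i, ∫ ω, M.η i ω ∂P = 0
  variance : ∀ i, ∫ ω, (M.η i ω) ^ 2 ∂P = 1

/-- Polynomial decay of the moving average coefficients, relative to the long-run standard
deviation `S = |∑ a k|` of the errors. -/
structure ErrorDependence (M : PLModel Ω d d' l) (ζ : ℝ) : Prop where
  one_lt : 1 < ζ
  summable : Summable fun k => |M.a k|
  longRun_pos : 0 < |∑' k, M.a k|
  decay : ∃ C : ℝ, ∀ m : ℕ,
    (∑' k : ℕ, |M.a (m + k)|) / |∑' k, M.a k| ≤ C * (max 1 (m : ℝ)) ^ (-ζ)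

/-- `g` is a (Lebesgue) density of the covariates `X i`. -/
structure IsDensity (M : PLModel Ω d d' l) (P : Measure Ω) (g : (Fin d → ℝ) → ℝ) : Prop where
  measurable : Measurable g
  nonneg : ∀ x, 0 ≤ g x
  law : ∀ i, P.map (M.X i) = volume.withDensity fun x => ENNReal.ofReal (g x)

/-- `G` is a conditional (Lebesgue) density of `X i` given the inputs `v (i - 1), v (i - 2), …`:
`G x (past M.v (i - 1) ω)` is the conditional density at `x`. -/
structure IsCondDensity (M : PLModel Ω d d' l) (P : Measure Ω) [IsFiniteMeasure P]
    (G : (Fin d → ℝ) → (ℕ → (Fin d' → ℝ)) → ℝ) : Prop where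
  measurable : Measurable (Function.uncurry G)
  nonneg : ∀ x y, 0 ≤ G x y
  law : ∀ i, ∀ᵐ ω ∂P, condDistrib (M.X i) (past M.v (i - 1)) P (past M.v (i - 1) ω) =
    volume.withDensity fun x => ENNReal.ofReal (G x (past M.v (i - 1) ω))

/-- The physical dependence measure of the conditional density: the supremum over `x ∈ T` of the
`L^s` distance between the conditional density at `x` of `X i` given `v (i - 1), v (i - 2), …` and
its coupled version, with `v (i - k)` replaced by an independent copy, `k ≥ 1`. -/
def theta (M : PLModel Ω d d' l) (P : Measure Ω) (G : (Fin d → ℝ) → (ℕ → (Fin d' → ℝ)) → ℝ)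
    (T : Set (Fin d → ℝ)) (s : ℝ) (i : ℤ) (k : ℕ) : ℝ≥0∞ :=
  ⨆ x ∈ T, eLpNorm
    (fun p : Ω × Ω => G x (past M.v (i - 1) p.1) - G x (coupledPast M.v (i - 1) (k - 1) p))
    (ENNReal.ofReal s) (P.prod P)

/-- Moments and dependence of the covariates `X`. -/
structure CovariateDependence (M : PLModel Ω d d' l) (P : Measure Ω)
    (G : (Fin d → ℝ) → (ℕ → (Fin d' → ℝ)) → ℝ) (T : Set (Fin d → ℝ)) (s ξ : ℝ) : Prop where
  two_lt : 2 < s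
  pos : 0 < ξ
  memLp : ∀ i, ∀ x ∈ T, MemLp (fun ω => G x (past M.v (i - 1) ω)) (ENNReal.ofReal s) P
  decay : ∃ C : ℝ, ∀ i : ℤ, ∀ m : ℕ, 1 ≤ m →
    ∑' k : ℕ, M.theta P G T s i (m + k) ≤ ENNReal.ofReal (C * (m : ℝ) ^ (-ξ))

/-- The covariance matrix of `u i` (at time `0`; the process is stationary). -/
def covU (M : PLModel Ω d d' l) (P : Measure Ω) : Matrix (Fin l) (Fin l) ℝ :=
  Matrix.of fun j j' => ∫ ω, M.u 0 ω j * M.u 0 ω j' ∂P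

/-- Random design: boundedness and smoothness of the regression of `Z` on `X`; moments,
nondegeneracy and weak dependence of `u`. -/
structure RandomDesign (M : PLModel Ω d d' l) (P : Measure Ω) (T : Set (Fin d → ℝ)) (δ p : ℝ) :
    Prop where
  bounded : ∃ C : ℝ, ∀ x, ‖M.hfun x‖ ≤ C
  lipschitz : ∃ C : ℝ≥0, LipschitzOnWith C M.hfun (M.smoothRegion P T δ)
  mean : ∀ i j, ∫ ω, M.u i ω j ∂P = 0
  eigenvalue : ∃ c : ℝ, 0 < c ∧
    ∀ r : ℝ, Module.End.HasEigenvalue (Matrix.toLin' (M.covU P)) r → c ≤ r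
  four_le : 4 ≤ p
  memLp : ∀ i j, MemLp (fun ω => M.u i ω j) (ENNReal.ofReal p) P
  moment_pos : ∀ i j, 0 < eLpNorm (fun ω => M.u i ω j) (ENNReal.ofReal p) P
  dependence : ∀ i : ℤ, ∑' k : ℕ, eLpNorm
    (fun z : Ω × Ω => ‖M.f (past M.e i z.1) - M.f (coupledPast M.e i k z)‖)
    (ENNReal.ofReal p) (P.prod P) < ∞

end PLModel

/-- The kernel: nonnegative with support `[-1,1]^d`, twice continuously differentiable on the
(closed) cube, bounded together with its first derivatives, and with integral one. -/
structure IsKernel {d : ℕ} (K : (Fin d → ℝ) → ℝ) : Prop where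
  nonneg : ∀ x, 0 ≤ K x
  tsupport_eq : tsupport K = Icc (fun _ => -1) (fun _ => 1)
  contDiffOn : ContDiffOn ℝ 2 K (Icc (fun _ => -1) (fun _ => 1))
  bounded : ∃ C : ℝ, ∀ x ∈ Icc (fun _ : Fin d => (-1 : ℝ)) (fun _ => 1), |K x| ≤ C
  bounded_deriv : ∃ C : ℝ, ∀ x ∈ Icc (fun _ : Fin d => (-1 : ℝ)) (fun _ => 1), ∀ j,
    |fderivWithin ℝ K (Icc (fun _ => -1) (fun _ => 1)) x (Pi.single j 1)| ≤ C
  integral_eq_one : ∫ x in Icc (fun _ : Fin d => (-1 : ℝ)) (fun _ => 1), K x = 1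

/-- The bandwidths: positive, `h → 0` and `h ^ d * n → ∞`. -/
structure IsBandwidth (d : ℕ) (h : ℕ → ℝ) : Prop where
  pos : ∀ n, 0 < h n
  tendsto_zero : Tendsto h atTop (𝓝 0)
  tendsto_atTop : Tendsto (fun n : ℕ => h n ^ d * n) atTop atTop

/-- Bounds and smoothness of the density on the box `[lo, hi]`: it is bounded away from zero and
infinity, and its partial derivatives (within the box) exist and are bounded. -/
structure DensityRegular {d : ℕ} (g : (Fin d → ℝ) → ℝ) (lo hi : Fin d → ℝ) : Prop where
  bounds : ∃ c c' : ℝ, 0 < c ∧ ∀ x ∈ Icc lo hi, c ≤ g x ∧ g x ≤ c'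
  differentiable : ∀ x ∈ Icc lo hi, ∀ j, DifferentiableWithinAt ℝ
    (fun t : ℝ => g (Function.update x j t)) (Icc (lo j) (hi j)) (x j)
  bounded_deriv : ∃ C : ℝ, ∀ x ∈ Icc lo hi, ∀ j,
    |derivWithin (fun t : ℝ => g (Function.update x j t)) (Icc (lo j) (hi j)) (x j)| ≤ C

end

/-!
The residuals `Y - Ỹ` and `Z - Z̃` are linear in the regressed sequence. Since
`Y = Zᵀβ + μ(X) + σ(X)ε`, the error `β̂ - β` solves a linear system: its matrix is the second moment
matrix of the residuals of `Z`, and its right-hand side pairs the residuals of `Z` with those of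
`μ(X) + σ(X)ε` (`PLModel.norm_betaHat_sub_le_of_quadraticForm`). So it is enough that the matrix is
bounded below by a multiple of `n` and that the right-hand side is of order `√n`.

*The covariates.* Everything the weights have to satisfy is collected in a property `GoodDesign` of
a single path of covariates: positive denominators, bounded column sums, Frobenius norm of order
`h ^ (-d)`, and a positive proportion of covariates in the box. It holds with probability tending
to one (`PLModel.exists_goodDesign`). Column sums and Frobenius norm reduce to comparing each
denominator with the number of covariates in the same cell of a grid of mesh proportional to `h`
(`goodDesign_of_cellCount`). If `K 0 > 0` this comparison is deterministic. Otherwise it follows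
from the concentration of the numbers of covariates in `O(h ^ (-d))` sets: conditionally on the
past these numbers are dominated by Poisson variables (`PLModel.lintegral_exp_count_le`), their
compensators have a small variance by the short memory of the conditional densities
(`PLModel.lintegral_sq_compensator_le`), and `log n / (h ^ d * n) → 0` pays for the union bound.

*Short memory.* All that is used of the dependence assumptions is that linear forms `∑ c t * W t`
have second moments at most a constant times `∑ c t ^ 2` (`BoundedLinearForms`). A causal function
of an i.i.d. sequence is a sum over `k` of differences obtained by averaging out the inputs that
are older than `t - k`; for fixed `k` these are orthogonal in `t`, and their size is bounded by the
physical dependence measure (`IsIID.boundedLinearForms`). This applies to the noise `u`, to its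
centered products, and to the conditional densities; the errors `ε` are a linear process
(`boundedLinearForms_linear_process`).

*The random forms.* As `u` is independent of `X`, and `ε` of `(X, u)`, the bound on linear forms
may be applied conditionally on the coefficients (`BoundedLinearForms.random_coefficients`).
Passing to the adjoint of the residual operator, which is bounded in the Euclidean norm on a good
design, shows that the pairing of the bias of `μ` with the residuals of `u`, and that of the
residuals of `Z` with those of `σ(X)ε`, have second moments of order `n`; neither undersmoothing
nor a rate for the kernel estimator enters here. The condition `h ^ 4 * n → 0` serves only for the
product of the biases of `μ` and of the conditional mean of `Z`, which is at most
`n * (L * h) ^ 2`. In the matrix, the second moments of `u` dominate: they fluctuate by order `√n`,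
while the kernel smoother of `u` contributes its squared norm, of order `h ^ (-d)`, which is of
smaller order than `n`. Markov's inequality concludes.
-/

noncomputable section

/-! ### Resampling coordinates of an i.i.d. family -/

section Resampling

open Classical in
/-- The configuration `y` in which the coordinates in `A` are replaced by those of `y'`. -/
def resample {ι E : Type*} (A : Set ι) (y y' : ι → E) : ι → E :=
  fun i => if i ∈ A then y' i else y i

variable {ι E : Type*}

theorem resample_apply_mem {A : Set ι} {i : ι} (h : i ∈ A) (y y' : ι → E) :
    resample A y y' i = y' i := by simp [resample, h]

theorem resample_apply_notMem {A : Set ι} {i : ι} (h : i ∉ A) (y y' : ι → E) :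
    resample A y y' i = y i := by simp [resample, h]

/-- Taking coordinate `i` back from the other copy before resampling `A` amounts to resampling
`insert i A`. -/
theorem resample_exchange_singleton {A : Set ι} {i : ι} (hi : i ∉ A) (y y' : ι → E) :
    resample A (resample {i} y y') (resample {i} y' y) = resample (insert i A) y y' := by
  funext j
  by_cases hj : j = i
  · subst hj
    simp [resample, hi]
  · by_cases hA : j ∈ A
    · rw [resample_apply_mem hA, resample_apply_notMem (by simpa using hj),
        resample_apply_mem (mem_insert_of_mem i hA)]
    · rw [resample_apply_notMem hA, resample_apply_notMem (by simpa using hj),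
        resample_apply_notMem (by simp [hj, hA])]

theorem resample_singleton_exchange {A : Set ι} {i : ι} (hi : i ∉ A) (y y' : ι → E) :
    resample {i} (resample A y y') (resample A y' y) = resample (insert i A) y y' := by
  funext j
  by_cases hj : j = i
  · subst hj
    simp [resample, hi]
  · by_cases hA : j ∈ A
    · rw [resample_apply_notMem (by simpa using hj), resample_apply_mem hA,
        resample_apply_mem (mem_insert_of_mem i hA)]
    · rw [resample_apply_notMem (by simpa using hj), resample_apply_notMem hA,
        resample_apply_notMem (by simp [hj, hA])]

variable [MeasurableSpace E]

theorem measurable_resample (A : Set ι) :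
    Measurable fun p : (ι → E) × (ι → E) => resample A p.1 p.2 := by
  refine measurable_pi_lambda _ fun i => ?_
  by_cases h : i ∈ A
  · simp only [resample_apply_mem h]; fun_prop
  · simp only [resample_apply_notMem h]; fun_prop

variable (ν₀ : Measure E)

/-- The average of `Φ` over independent copies of the coordinates in `A`. -/
def resampleMean (A : Set ι) (Φ : (ι → E) → ℝ) (y : ι → E) : ℝ :=
  ∫ y', Φ (resample A y y') ∂(Measure.infinitePi fun _ : ι => ν₀)

variable {ν₀} in
theorem resampleMean_congr (A : Set ι) (Φ : (ι → E) → ℝ) {y z : ι → E} (h : ∀ i ∉ A, y i = z i) :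
    resampleMean ν₀ A Φ y = resampleMean ν₀ A Φ z := by
  have : ∀ y', resample A y y' = resample A z y' := fun y' => funext fun i => by
    by_cases hi : i ∈ A
    · simp [resample_apply_mem hi]
    · simp [resample_apply_notMem hi, h i hi]
  simp [resampleMean, this]

variable [IsProbabilityMeasure ν₀]

/-- Two independent i.i.d. families are one i.i.d. family indexed by `Fin 2 × ι`. -/
theorem measurePreserving_fin_two_curry :
    MeasurePreserving (fun (x : Fin 2 × ι → E) => (fun i => x (0, i), fun i => x (1, i)))
      (Measure.infinitePi fun _ => ν₀)
      ((Measure.infinitePi fun _ : ι => ν₀).prod (Measure.infinitePi fun _ : ι => ν₀)) := by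
  have h1 : MeasurePreserving (MeasurableEquiv.curry (Fin 2) ι E)
      (Measure.infinitePi fun _ => ν₀)
      (Measure.pi fun _ : Fin 2 => Measure.infinitePi fun _ : ι => ν₀) := by
    refine ⟨MeasurableEquiv.measurable _, ?_⟩
    rw [← Measure.infinitePi_eq_pi]
    exact Measure.infinitePi_map_curry (fun _ _ => ν₀)
  exact (measurePreserving_finTwoArrow (Measure.infinitePi fun _ : ι => ν₀)).comp h1

/-- Exchanging the coordinates in `A` of two independent copies preserves their joint law. -/
theorem measurePreserving_resample_swap (A : Set ι) :
    MeasurePreserving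
      (fun p : (ι → E) × (ι → E) => (resample A p.1 p.2, resample A p.2 p.1))
      ((Measure.infinitePi fun _ : ι => ν₀).prod (Measure.infinitePi fun _ : ι => ν₀))
      ((Measure.infinitePi fun _ : ι => ν₀).prod (Measure.infinitePi fun _ : ι => ν₀)) := by
  classical
  have hm : Measurable
      (fun p : (ι → E) × (ι → E) => (resample A p.1 p.2, resample A p.2 p.1)) :=
    (measurable_resample A).prodMk ((measurable_resample A).comp measurable_swap)
  refine ⟨hm, ?_⟩
  have hΨ := measurePreserving_fin_two_curry (ι := ι) ν₀
  let e : Fin 2 × ι → Fin 2 × ι := fun p => if p.2 ∈ A then (1 - p.1, p.2) else p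
  have he : Function.Involutive e := by
    rintro ⟨b, i⟩
    by_cases h : i ∈ A <;> simp [e, h]
  have hE : MeasurePreserving (fun (x : Fin 2 × ι → E) p => x (e p))
      (Measure.infinitePi fun _ => ν₀) (Measure.infinitePi fun _ => ν₀) :=
    ⟨by fun_prop, Measure.map_infinitePi_infinitePi_of_inj (P := fun _ => ν₀) he.injective⟩
  conv_lhs => rw [← hΨ.map_eq]
  rw [Measure.map_map hm hΨ.measurable]
  conv_rhs => rw [← (hΨ.comp hE).map_eq]
  congr 1
  funext x
  refine Prod.ext (funext fun i => ?_) (funext fun i => ?_) <;>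
  · by_cases h : i ∈ A <;> simp [e, h, resample]

theorem measurePreserving_resample (A : Set ι) :
    MeasurePreserving (fun p : (ι → E) × (ι → E) => resample A p.1 p.2)
      ((Measure.infinitePi fun _ : ι => ν₀).prod (Measure.infinitePi fun _ : ι => ν₀))
      (Measure.infinitePi fun _ : ι => ν₀) :=
  measurePreserving_fst.comp (measurePreserving_resample_swap ν₀ A)

variable {ν₀}

theorem stronglyMeasurable_resampleMean (A : Set ι) {Φ : (ι → E) → ℝ} (hΦ : Measurable Φ) :
    StronglyMeasurable (resampleMean ν₀ A Φ) := by
  have : StronglyMeasurable (fun p : (ι → E) × (ι → E) => Φ (resample A p.1 p.2)) :=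
    (hΦ.comp (measurable_resample A)).stronglyMeasurable
  exact this.integral_prod_right'

/-- The square of an average is at most the average of the square. -/
theorem sq_integral_le {α : Type*} [MeasurableSpace α] {μ : Measure α} [IsProbabilityMeasure μ]
    {f : α → ℝ} (hf : Measurable f) :
    ENNReal.ofReal ((∫ a, f a ∂μ) ^ 2) ≤ ∫⁻ a, ENNReal.ofReal (f a ^ 2) ∂μ := by
  by_cases h : ∫⁻ a, ENNReal.ofReal (f a ^ 2) ∂μ = ∞
  · simp [h]
  have hsq : Integrable (fun a => f a ^ 2) μ := by
    refine ⟨by fun_prop, ?_⟩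
    rw [hasFiniteIntegral_iff_ofReal (Eventually.of_forall fun a => sq_nonneg _)]
    exact lt_top_iff_ne_top.2 h
  have hL : MemLp f 2 μ := (memLp_two_iff_integrable_sq hf.aestronglyMeasurable).2 hsq
  rw [← ofReal_integral_eq_lintegral_ofReal hsq (Eventually.of_forall fun a => sq_nonneg _)]
  refine ENNReal.ofReal_le_ofReal ?_
  have := variance_eq_sub hL
  have h0 := variance_nonneg f μ
  simp only [Pi.pow_apply] at this
  linarith

/-- Resampling a further coordinate changes the average by at most the effect, in mean square, of
resampling that coordinate alone. -/
theorem lintegral_sq_resampleMean_sub_le (A : Set ι) (i : ι) (hi : i ∉ A) {Φ : (ι → E) → ℝ}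
    (hΦ : Measurable Φ) (hint : Integrable Φ (Measure.infinitePi fun _ : ι => ν₀)) :
    ∫⁻ y, ENNReal.ofReal ((resampleMean ν₀ A Φ y - resampleMean ν₀ (insert i A) Φ y) ^ 2)
        ∂(Measure.infinitePi fun _ : ι => ν₀) ≤
      ∫⁻ p, ENNReal.ofReal ((Φ p.1 - Φ (resample {i} p.1 p.2)) ^ 2)
        ∂((Measure.infinitePi fun _ : ι => ν₀).prod (Measure.infinitePi fun _ : ι => ν₀)) := by
  set ν := Measure.infinitePi fun _ : ι => ν₀
  have hI : ∀ B : Set ι, ∀ᵐ y ∂ν, Integrable (fun y' => Φ (resample B y y')) ν := fun B =>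
    (((measurePreserving_resample ν₀ B).integrable_comp hΦ.aestronglyMeasurable).2 hint).prod_right_ae
  have h1 : ∫⁻ y, ENNReal.ofReal ((resampleMean ν₀ A Φ y - resampleMean ν₀ (insert i A) Φ y) ^ 2) ∂ν ≤
      ∫⁻ y, ∫⁻ y', ENNReal.ofReal
        ((Φ (resample A y y') - Φ (resample (insert i A) y y')) ^ 2) ∂ν ∂ν := by
    refine lintegral_mono_ae ?_
    filter_upwards [hI A, hI (insert i A)] with y hy1 hy2
    rw [resampleMean, resampleMean, ← integral_sub hy1 hy2]
    refine sq_integral_le ?_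
    exact ((hΦ.comp ((measurable_resample A).comp measurable_prodMk_left)).sub
      (hΦ.comp ((measurable_resample _).comp measurable_prodMk_left)))
  have hm : Measurable fun p : (ι → E) × (ι → E) =>
      ENNReal.ofReal ((Φ p.1 - Φ (resample {i} p.1 p.2)) ^ 2) := by
    have := hΦ.comp (measurable_resample (E := E) {i})
    have h2 : Measurable fun p : (ι → E) × (ι → E) => Φ p.1 := hΦ.comp measurable_fst
    exact ((h2.sub this).pow_const 2).ennreal_ofReal
  refine h1.trans_eq ?_
  rw [← (measurePreserving_resample_swap ν₀ A).lintegral_comp hm, ← lintegral_prod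
    (fun p : (ι → E) × (ι → E) => ENNReal.ofReal
      ((Φ (resample A p.1 p.2) - Φ (resample (insert i A) p.1 p.2)) ^ 2))]
  · refine lintegral_congr fun p => ?_
    have : resample {i} (resample A p.1 p.2) (resample A p.2 p.1) =
        resample (insert i A) p.1 p.2 := resample_singleton_exchange hi _ _
    simp only [this]
  · refine Measurable.aemeasurable ?_
    exact (((hΦ.comp (measurable_resample A)).sub
      (hΦ.comp (measurable_resample _))).pow_const 2).ennreal_ofReal

/-- The difference of two averages over `A` and `insert i A` is orthogonal to every function that
does not depend on the coordinate `i`. -/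
theorem integral_resampleMean_sub_mul (A : Set ι) (i : ι) (hi : i ∉ A) {Φ V : (ι → E) → ℝ}
    (hΦ : MemLp Φ 2 (Measure.infinitePi fun _ : ι => ν₀)) (hmΦ : Measurable Φ)
    (hV : MemLp V 2 (Measure.infinitePi fun _ : ι => ν₀)) (hmV : Measurable V)
    (hVi : ∀ y z : ι → E, (∀ j, j ≠ i → y j = z j) → V y = V z) :
    ∫ y, (resampleMean ν₀ A Φ y - resampleMean ν₀ (insert i A) Φ y) * V y
      ∂(Measure.infinitePi fun _ : ι => ν₀) = 0 := by
  set ν := Measure.infinitePi fun _ : ι => ν₀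
  have hVfst : MemLp (fun p : (ι → E) × (ι → E) => V p.1) 2 (ν.prod ν) :=
    hV.comp_measurePreserving measurePreserving_fst
  have hI : ∀ B : Set ι, Integrable (fun p : (ι → E) × (ι → E) =>
      Φ (resample B p.1 p.2) * V p.1) (ν.prod ν) := fun B =>
    (hΦ.comp_measurePreserving (measurePreserving_resample ν₀ B)).integrable_mul hVfst
  have hE : ∀ B : Set ι, ∫ y, resampleMean ν₀ B Φ y * V y ∂ν =
      ∫ p, Φ (resample B p.1 p.2) * V p.1 ∂(ν.prod ν) := fun B => by
    rw [integral_prod _ (hI B)]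
    simp only [resampleMean, integral_mul_const, ν]
  have hJ : ∀ B : Set ι, Integrable (fun y => resampleMean ν₀ B Φ y * V y) ν := fun B => by
    refine (hI B).integral_prod_left.congr (Eventually.of_forall fun y => ?_)
    simp only [resampleMean, integral_mul_const, ν]
  simp only [sub_mul]
  rw [integral_sub (hJ _) (hJ _), hE, hE, sub_eq_zero]
  have hs : MeasurePreserving (fun p : (ι → E) × (ι → E) =>
      (resample {i} p.1 p.2, resample {i} p.2 p.1)) (ν.prod ν) (ν.prod ν) :=
    measurePreserving_resample_swap ν₀ {i}
  conv_lhs => rw [← hs.map_eq]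
  rw [integral_map hs.measurable.aemeasurable]
  · refine integral_congr_ae (Eventually.of_forall fun p => ?_)
    have h1 : resample A (resample {i} p.1 p.2) (resample {i} p.2 p.1) =
        resample (insert i A) p.1 p.2 := resample_exchange_singleton hi _ _
    have h2 : V (resample {i} p.1 p.2) = V p.1 := hVi _ _ fun j hj => by simp [resample, hj]
    simp only [h1, h2]
  · exact ((hmΦ.comp (measurable_resample A)).mul (hmV.comp measurable_fst)).aestronglyMeasurable

theorem memLp_resampleMean (A : Set ι) {Φ : (ι → E) → ℝ} (hmΦ : Measurable Φ)
    (hΦ : MemLp Φ 2 (Measure.infinitePi fun _ : ι => ν₀)) :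
    MemLp (resampleMean ν₀ A Φ) 2 (Measure.infinitePi fun _ : ι => ν₀) := by
  set ν := Measure.infinitePi fun _ : ι => ν₀
  have hm := (stronglyMeasurable_resampleMean (ν₀ := ν₀) A hmΦ)
  rw [memLp_two_iff_integrable_sq hm.aestronglyMeasurable]
  refine ⟨(hm.measurable.pow_const 2).aestronglyMeasurable, ?_⟩
  rw [hasFiniteIntegral_iff_ofReal (Eventually.of_forall fun a => sq_nonneg _)]
  have h1 : ∫⁻ y, ENNReal.ofReal (resampleMean ν₀ A Φ y ^ 2) ∂ν ≤
      ∫⁻ y, ∫⁻ y', ENNReal.ofReal (Φ (resample A y y') ^ 2) ∂ν ∂ν :=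
    lintegral_mono fun y => sq_integral_le
      (hmΦ.comp ((measurable_resample A).comp measurable_prodMk_left))
  refine h1.trans_lt ?_
  rw [← lintegral_prod (fun p : (ι → E) × (ι → E) => ENNReal.ofReal (Φ (resample A p.1 p.2) ^ 2))
    (((hmΦ.comp (measurable_resample A)).pow_const 2).ennreal_ofReal.aemeasurable)]
  rw [(measurePreserving_resample ν₀ A).lintegral_comp
    (f := fun y => ENNReal.ofReal (Φ y ^ 2)) (by fun_prop)]
  have := hΦ.integrable_sq
  exact (hasFiniteIntegral_iff_ofReal (Eventually.of_forall fun a => sq_nonneg _)).1 this.2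

/-- Averaging over the coordinates in `A` is conditioning on the other coordinates. -/
theorem resampleMean_ae_eq_condExp (A : Set ι) {Φ : (ι → E) → ℝ} (hmΦ : Measurable Φ)
    (hΦ : Integrable Φ (Measure.infinitePi fun _ : ι => ν₀)) :
    resampleMean ν₀ A Φ =ᵐ[Measure.infinitePi fun _ : ι => ν₀]
      (Measure.infinitePi fun _ : ι => ν₀)[Φ |
        MeasurableSpace.comap (fun (y : ι → E) (i : (Aᶜ : Set ι)) => y i) inferInstance] := by
  set ν := Measure.infinitePi fun _ : ι => ν₀
  have hr : Measurable (fun (y : ι → E) (i : (Aᶜ : Set ι)) => y i) := by fun_prop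
  have hI := ((measurePreserving_resample ν₀ A).integrable_comp hmΦ.aestronglyMeasurable).2 hΦ
  have hIa : Integrable (resampleMean ν₀ A Φ) ν := hI.integral_prod_left
  refine ae_eq_condExp_of_forall_setIntegral_eq hr.comap_le hΦ (fun s _ _ => hIa.integrableOn) ?_ ?_
  · rintro _ ⟨s, hs, rfl⟩ -
    have hs' := hr hs
    set S := (fun (y : ι → E) (i : (Aᶜ : Set ι)) => y i) ⁻¹' s
    have key : ∀ y y', resample A y y' ∈ S ↔ y ∈ S := fun y y' => by
      have : (fun i : (Aᶜ : Set ι) => resample A y y' i) = fun i : (Aᶜ : Set ι) => y i :=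
        funext fun i => resample_apply_notMem i.2 _ _
      simp only [S, mem_preimage, this]
    rw [← integral_indicator hs', ← integral_indicator hs']
    have h2 : ∀ y, S.indicator (resampleMean ν₀ A Φ) y =
        ∫ y', S.indicator Φ (resample A y y') ∂ν := fun y => by
      by_cases hy : y ∈ S
      · simp [hy, key, resampleMean, ν, indicator]
      · simp [hy, key, indicator]
    simp only [h2]
    have hI2 : Integrable (fun p : (ι → E) × (ι → E) => S.indicator Φ (resample A p.1 p.2))
        (ν.prod ν) :=
      ((measurePreserving_resample ν₀ A).integrable_comp
        (hmΦ.indicator hs').aestronglyMeasurable).2 (hΦ.indicator hs')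
    rw [← integral_prod _ hI2]
    have hmp : MeasurePreserving (fun p : (ι → E) × (ι → E) => resample A p.1 p.2) (ν.prod ν) ν :=
      measurePreserving_resample ν₀ A
    conv_rhs => rw [← hmp.map_eq]
    rw [integral_map hmp.measurable.aemeasurable (hmΦ.indicator hs').aestronglyMeasurable]
  · -- an average over `A` factors through the coordinates outside `A`
    refine Measurable.aestronglyMeasurable ?_
    obtain ⟨e₀⟩ := nonempty_of_isProbabilityMeasure ν₀
    classical
    let emb : ((Aᶜ : Set ι) → E) → (ι → E) := fun z i => if h : i ∈ Aᶜ then z ⟨i, h⟩ else e₀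
    have hemb : Measurable emb := measurable_pi_lambda _ fun i => by
      by_cases h : i ∈ Aᶜ
      · simp only [emb, h, dite_true]; fun_prop
      · simp only [emb, h, dite_false]; fun_prop
    have : resampleMean ν₀ A Φ = (resampleMean ν₀ A Φ ∘ emb) ∘ fun (y : ι → E) (i : (Aᶜ : Set ι)) => y i := by
      funext y
      refine resampleMean_congr A Φ fun i hi => ?_
      simp [emb, hi]
    rw [this]
    exact ((stronglyMeasurable_resampleMean A hmΦ).measurable.comp hemb).comp (comap_measurable _)

end Resampling

/-! ### Families with bounded linear forms -/

section LinearForms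

theorem eLpNorm_two_sq {α : Type*} [MeasurableSpace α] (μ : Measure α) (f : α → ℝ) :
    eLpNorm f 2 μ ^ 2 = ∫⁻ a, ENNReal.ofReal (f a ^ 2) ∂μ := by
  have h : eLpNorm f 2 μ = (∫⁻ a, ‖f a‖ₑ ^ (2 : ℝ) ∂μ) ^ (1 / 2 : ℝ) := by
    have := eLpNorm_eq_lintegral_rpow_enorm_toReal (μ := μ) (f := f) (p := 2) (by simp) (by simp)
    simpa using this
  rw [h, ← ENNReal.rpow_natCast, ← ENNReal.rpow_mul]
  norm_num
  refine lintegral_congr fun a => ?_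
  rw [← enorm_pow, Real.enorm_eq_ofReal (sq_nonneg _)]

/-- The family `W` has linear forms bounded in mean square by `Γ` times the squared Euclidean norm
of the coefficients; this expresses short memory of a centered process. -/
def BoundedLinearForms {Ω : Type*} [MeasurableSpace Ω] (P : Measure Ω) (W : ℤ → Ω → ℝ)
    (Γ : ℝ≥0∞) : Prop :=
  ∀ (I : Finset ℤ) (c : ℤ → ℝ),
    ∫⁻ ω, ENNReal.ofReal ((∑ t ∈ I, c t * W t ω) ^ 2) ∂P ≤ Γ * ENNReal.ofReal (∑ t ∈ I, c t ^ 2)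

variable {Ω : Type*} [MeasurableSpace Ω] {P : Measure Ω}

/-- For pairwise orthogonal variables the second moment of a linear form is the sum of the second
moments of its terms. -/
theorem lintegral_sq_sum_orthogonal_le (I : Finset ℤ) (c : ℤ → ℝ) {ξ : ℤ → Ω → ℝ} {δ : ℝ≥0∞}
    (hξ : ∀ t, MemLp (ξ t) 2 P) (horth : ∀ t t', t < t' → ∫ ω, ξ t ω * ξ t' ω ∂P = 0)
    (hδ : ∀ t, ∫⁻ ω, ENNReal.ofReal (ξ t ω ^ 2) ∂P ≤ δ) :
    ∫⁻ ω, ENNReal.ofReal ((∑ t ∈ I, c t * ξ t ω) ^ 2) ∂P ≤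
      δ * ENNReal.ofReal (∑ t ∈ I, c t ^ 2) := by
  have hm : ∀ t t', Integrable (fun ω => c t * c t' * (ξ t ω * ξ t' ω)) P := fun t t' =>
    ((hξ t).integrable_mul (hξ t')).const_mul _
  have hexp : ∀ ω, (∑ t ∈ I, c t * ξ t ω) ^ 2 =
      ∑ t ∈ I, ∑ t' ∈ I, c t * c t' * (ξ t ω * ξ t' ω) := fun ω => by
    rw [sq, Finset.sum_mul_sum]
    exact Finset.sum_congr rfl fun t _ => Finset.sum_congr rfl fun t' _ => by ring
  have hint : Integrable (fun ω => (∑ t ∈ I, c t * ξ t ω) ^ 2) P := by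
    simp only [hexp]
    exact integrable_finsetSum _ fun t _ => integrable_finsetSum _ fun t' _ => hm t t'
  have horth' : ∀ t t', t ≠ t' → ∫ ω, ξ t ω * ξ t' ω ∂P = 0 := fun t t' h => by
    rcases lt_or_gt_of_ne h with h | h
    · exact horth t t' h
    · simpa [mul_comm] using horth t' t h
  rw [← ofReal_integral_eq_lintegral_ofReal hint (Eventually.of_forall fun _ => sq_nonneg _)]
  have hval : ∫ ω, (∑ t ∈ I, c t * ξ t ω) ^ 2 ∂P = ∑ t ∈ I, c t ^ 2 * ∫ ω, ξ t ω ^ 2 ∂P := by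
    simp only [hexp]
    rw [integral_finsetSum _ fun t _ => integrable_finsetSum _ fun t' _ => hm t t']
    refine Finset.sum_congr rfl fun t ht => ?_
    rw [integral_finsetSum _ fun t' _ => hm t t', Finset.sum_eq_single t]
    · rw [integral_const_mul]; simp only [sq]
    · intro t' _ h
      rw [integral_const_mul, horth' t t' h.symm, mul_zero]
    · exact fun h => absurd ht h
  rw [hval, ENNReal.ofReal_sum_of_nonneg fun t _ => mul_nonneg (sq_nonneg _)
      (integral_nonneg fun _ => sq_nonneg _),
    ENNReal.ofReal_sum_of_nonneg fun t _ => sq_nonneg _, Finset.mul_sum]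
  refine Finset.sum_le_sum fun t _ => ?_
  rw [ENNReal.ofReal_mul (sq_nonneg _), mul_comm]
  gcongr
  rw [ofReal_integral_eq_lintegral_ofReal (hξ t).integrable_sq
    (Eventually.of_forall fun _ => sq_nonneg _)]
  exact hδ t

/-- If `W t = ∑ k, ξ t k` almost surely, where for each fixed `k` the variables `ξ t k` are
orthogonal with norm at most `δ k`, then by Minkowski's inequality the linear forms in `W` are
bounded by `(∑ k, δ k) ^ 2`. -/
theorem boundedLinearForms_of_orthogonal_series {W : ℤ → Ω → ℝ} {ξ : ℤ → ℕ → Ω → ℝ} {δ : ℕ → ℝ≥0∞}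
    (hξ : ∀ t k, MemLp (ξ t k) 2 P)
    (horth : ∀ k t t', t < t' → ∫ ω, ξ t k ω * ξ t' k ω ∂P = 0)
    (hδ : ∀ t k, eLpNorm (ξ t k) 2 P ≤ δ k)
    (hW : ∀ t, ∀ᵐ ω ∂P, Tendsto (fun m => ∑ k ∈ Finset.range m, ξ t k ω) atTop (𝓝 (W t ω))) :
    BoundedLinearForms P W ((∑' k, δ k) ^ 2) := by
  intro I c
  set s : ℝ≥0∞ := ENNReal.ofReal (Real.sqrt (∑ t ∈ I, c t ^ 2)) with hs
  have hc0 : 0 ≤ ∑ t ∈ I, c t ^ 2 := Finset.sum_nonneg fun _ _ => sq_nonneg _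
  have hs2 : s ^ 2 = ENNReal.ofReal (∑ t ∈ I, c t ^ 2) := by
    rw [hs, ← ENNReal.ofReal_pow (Real.sqrt_nonneg _), Real.sq_sqrt hc0]
  have h1 : ∀ k, eLpNorm (fun ω => ∑ t ∈ I, c t * ξ t k ω) 2 P ≤ δ k * s := fun k => by
    have := lintegral_sq_sum_orthogonal_le (δ := δ k ^ 2) I c (fun t => hξ t k) (horth k) fun t => by
      rw [← eLpNorm_two_sq]
      gcongr
      exact hδ t k
    rw [← eLpNorm_two_sq, ← hs2, ← mul_pow] at this
    exact (ENNReal.pow_le_pow_left_iff two_ne_zero).1 this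
  have hm1 : ∀ k, AEStronglyMeasurable (fun ω => ∑ t ∈ I, c t * ξ t k ω) P := fun k =>
    Finset.aestronglyMeasurable_fun_sum _ fun t _ => (hξ t k).1.const_mul _
  have h2 : ∀ m, eLpNorm (fun ω => ∑ k ∈ Finset.range m, ∑ t ∈ I, c t * ξ t k ω) 2 P ≤
      (∑' k, δ k) * s := fun m => by
    have := eLpNorm_sum_le (μ := P) (p := 2) (s := Finset.range m)
      (f := fun k ω => ∑ t ∈ I, c t * ξ t k ω) (fun k _ => hm1 k) (by norm_num)
    have he : (∑ k ∈ Finset.range m, fun ω => ∑ t ∈ I, c t * ξ t k ω) =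
        fun ω => ∑ k ∈ Finset.range m, ∑ t ∈ I, c t * ξ t k ω := by
      funext ω; simp
    rw [he] at this
    refine this.trans ((Finset.sum_le_sum fun k _ => h1 k).trans ?_)
    rw [← Finset.sum_mul]
    gcongr
    exact ENNReal.sum_le_tsum _
  have h3 : eLpNorm (fun ω => ∑ t ∈ I, c t * W t ω) 2 P ≤ (∑' k, δ k) * s := by
    refine (Lp.eLpNorm_lim_le_liminf_eLpNorm
      (f := fun m ω => ∑ k ∈ Finset.range m, ∑ t ∈ I, c t * ξ t k ω)
      (fun m => Finset.aestronglyMeasurable_fun_sum _ fun k _ => hm1 k) _ ?_).trans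
      (liminf_le_of_le (by isBoundedDefault) fun b hb => ?_)
    · filter_upwards [ae_all_iff.2 hW] with ω hω
      have : ∀ m, ∑ k ∈ Finset.range m, ∑ t ∈ I, c t * ξ t k ω =
          ∑ t ∈ I, c t * ∑ k ∈ Finset.range m, ξ t k ω := fun m => by
        rw [Finset.sum_comm]
        exact Finset.sum_congr rfl fun t _ => by rw [Finset.mul_sum]
      simp only [this]
      exact tendsto_finsetSum _ fun t _ => (hω t).const_mul _
    · obtain ⟨m, hm⟩ := hb.exists
      exact hm.trans (h2 m)
  rw [← eLpNorm_two_sq, ← hs2, ← mul_pow]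
  gcongr

end LinearForms

/-! ### Causal functions of i.i.d. inputs -/

section CausalProcesses

variable {E : Type*} [MeasurableSpace E] {ν₀ : Measure E} [IsProbabilityMeasure ν₀]

theorem insert_Iic_sub (t : ℤ) (k : ℕ) :
    insert (t - k) (Iic (t - (k + 1 : ℕ))) = Iic (t - k) := by
  ext i
  simp only [mem_insert_iff, mem_Iic]
  push_cast
  omega

theorem sub_notMem_Iic_sub (t : ℤ) (k : ℕ) : t - (k : ℤ) ∉ Iic (t - ((k + 1 : ℕ) : ℤ)) := by
  simp only [mem_Iic]
  push_cast
  omega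

/-- Averaging out ever more remote inputs of a causal function recovers the function. -/
theorem tendsto_resampleMean {t : ℤ} {Φ : (ℤ → E) → ℝ}
    (hΦ : Integrable Φ (Measure.infinitePi fun _ : ℤ => ν₀)) {φ : (ℕ → E) → ℝ} (hφ : Measurable φ)
    (hΦφ : ∀ y, Φ y = φ fun j => y (t - j)) :
    ∀ᵐ y ∂(Measure.infinitePi fun _ : ℤ => ν₀),
      Tendsto (fun m : ℕ => resampleMean ν₀ (Iic (t - m)) Φ y) atTop (𝓝 (Φ y)) := by
  obtain rfl : Φ = fun y => φ fun j => y (t - j) := funext hΦφ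
  have hm : Measurable fun y : ℤ → E => φ fun j => y (t - j) := hφ.comp (by fun_prop)
  -- the inputs at times later than `t - m` form a filtration, increasing in `m`
  let F : ℕ → MeasurableSpace (ℤ → E) := fun m =>
    MeasurableSpace.comap (fun (y : ℤ → E) (i : ((Iic (t - (m : ℤ)))ᶜ : Set ℤ)) => y i) inferInstance
  have hFm : ∀ (m : ℕ) (i : ℤ), t - (m : ℤ) < i → Measurable[F m] fun y : ℤ → E => y i := fun m i hi => by
    have h1 : Measurable[F m] fun (y : ℤ → E) (i : ((Iic (t - (m : ℤ)))ᶜ : Set ℤ)) => y i :=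
      comap_measurable _
    exact (measurable_pi_apply (⟨i, by simpa using hi⟩ : ((Iic (t - (m : ℤ)))ᶜ : Set ℤ))).comp h1
  have hFle : ∀ m : ℕ, F m ≤ MeasurableSpace.pi := fun m =>
    Measurable.comap_le (by fun_prop)
  let ℱ : Filtration ℕ (MeasurableSpace.pi : MeasurableSpace (ℤ → E)) :=
    { seq := F
      mono' := by
        intro m m' hmm'
        refine Measurable.comap_le ?_
        refine @measurable_pi_lambda _ _ _ (F m') _ _ fun i => hFm m' _ ?_
        have := i.2
        simp only [mem_compl_iff, mem_Iic, not_le] at this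
        have h2 : (m : ℤ) ≤ m' := by exact_mod_cast hmm'
        omega
      le' := hFle }
  have hWF : Measurable[⨆ m, ℱ m] fun y : ℤ → E => φ fun j => y (t - j) := by
    refine hφ.comp (@measurable_pi_lambda _ _ _ (⨆ m, ℱ m) _ _ fun j => ?_)
    refine (hFm (j + 1) (t - j) ?_).mono (le_iSup (fun m => ℱ m) (j + 1)) le_rfl
    push_cast
    omega
  have hWs : StronglyMeasurable[⨆ m, ℱ m] fun y : ℤ → E => φ fun j => y (t - j) :=
    Measurable.stronglyMeasurable hWF
  have hlim := hΦ.tendsto_ae_condExp (ℱ := ℱ) hWs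
  have hall : ∀ m : ℕ, resampleMean ν₀ (Iic (t - (m : ℤ))) (fun y : ℤ → E => φ fun j => y (t - j))
      =ᵐ[Measure.infinitePi fun _ : ℤ => ν₀] (Measure.infinitePi fun _ : ℤ => ν₀)[
        fun y : ℤ → E => φ fun j => y (t - j) | ℱ m] := fun m =>
    resampleMean_ae_eq_condExp (ν₀ := ν₀) (Iic (t - (m : ℤ))) hm hΦ
  filter_upwards [hlim, ae_all_iff.2 hall] with y hy hy'
  exact hy.congr fun m => (hy' m).symm

/-- A causal function of an i.i.d. sequence whose physical dependence measures are summable has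
bounded linear forms. The orthogonal series is `∑ k, (E[W t | y i, i > t - k - 1] -
E[W t | y i, i > t - k])`; it converges by Lévy's upward theorem. -/
theorem boundedLinearForms_infinitePi {φ : (ℕ → E) → ℝ} (hφ : Measurable φ) {δ : ℕ → ℝ≥0∞}
    (hL : ∀ t : ℤ, MemLp (fun y : ℤ → E => φ fun j => y (t - j)) 2
      (Measure.infinitePi fun _ : ℤ => ν₀))
    (hδ : ∀ (t : ℤ) (k : ℕ), eLpNorm (fun p : (ℤ → E) × (ℤ → E) => φ (fun j => p.1 (t - j)) -
        φ (fun j => resample {t - (k : ℤ)} p.1 p.2 (t - j))) 2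
      ((Measure.infinitePi fun _ : ℤ => ν₀).prod (Measure.infinitePi fun _ : ℤ => ν₀)) ≤ δ k) :
    BoundedLinearForms (Measure.infinitePi fun _ : ℤ => ν₀)
      (fun t y => φ (fun j => y (t - j)) -
        ∫ y, φ (fun j => y (t - j)) ∂(Measure.infinitePi fun _ : ℤ => ν₀)) ((∑' k, δ k) ^ 2) := by
  set ν := Measure.infinitePi fun _ : ℤ => ν₀
  set W : ℤ → (ℤ → E) → ℝ := fun t y => φ fun j => y (t - j) with hWdef
  have hWm : ∀ t, Measurable (W t) := fun t => hφ.comp (by fun_prop)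
  set S : ℤ → ℕ → (ℤ → E) → ℝ := fun t k => resampleMean ν₀ (Iic (t - k)) (W t) with hS
  have hSm : ∀ t k, Measurable (S t k) := fun t k =>
    (stronglyMeasurable_resampleMean _ (hWm t)).measurable
  have hSL : ∀ t k, MemLp (S t k) 2 ν := fun t k => memLp_resampleMean _ (hWm t) (hL t)
  refine boundedLinearForms_of_orthogonal_series (ξ := fun t k y => S t (k + 1) y - S t k y)
    (fun t k => (hSL t _).sub (hSL t _)) ?_ ?_ ?_
  · intro k t t' htt'
    have := integral_resampleMean_sub_mul (Iic (t - (k + 1 : ℕ))) (t - k)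
      (sub_notMem_Iic_sub t k) (hL t) (hWm t) (V := fun y => S t' (k + 1) y - S t' k y)
      ((hSL t' _).sub (hSL t' _)) ((hSm t' _).sub (hSm t' _)) ?_
    · rw [insert_Iic_sub] at this
      exact this
    · intro y z hyz
      simp only [hS]
      congr 1 <;> refine resampleMean_congr _ _ fun i hi => hyz i ?_ <;>
      · simp only [mem_Iic] at hi
        push_cast at hi
        omega
  · intro t k
    refine le_trans ?_ (hδ t k)
    rw [← ENNReal.pow_le_pow_left_iff two_ne_zero, eLpNorm_two_sq, eLpNorm_two_sq]
    have := lintegral_sq_resampleMean_sub_le (Iic (t - (k + 1 : ℕ))) (t - k)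
      (sub_notMem_Iic_sub t k) (hWm t)
      ((hL t).integrable (by norm_num))
    rw [insert_Iic_sub] at this
    exact this
  · intro t
    have htel : ∀ m y, ∑ k ∈ Finset.range m, (S t (k + 1) y - S t k y) = S t m y - S t 0 y :=
      fun m y => Finset.sum_range_sub (fun k => S t k y) m
    have hS0 : ∀ y, S t 0 y = ∫ y, W t y ∂ν := fun y => by
      simp only [hS, resampleMean, hWdef]
      refine integral_congr_ae (Eventually.of_forall fun y' => ?_)
      simp [resample]
    simp only [htel, hS0]
    filter_upwards [tendsto_resampleMean ((hL t).integrable (by norm_num)) hφ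
      fun y => rfl] with y hy
    exact hy.sub_const _

end CausalProcesses

/-! ### Stationary processes driven by an i.i.d. sequence -/

section IIDInputs

theorem BoundedLinearForms.comp_measurePreserving {Ω Ω' : Type*} [MeasurableSpace Ω]
    [MeasurableSpace Ω'] {P : Measure Ω} {Q : Measure Ω'} {T : Ω → Ω'} (hT : MeasurePreserving T P Q)
    {W : ℤ → Ω' → ℝ} (hWm : ∀ t, Measurable (W t)) {Γ : ℝ≥0∞} (hW : BoundedLinearForms Q W Γ) :
    BoundedLinearForms P (fun t ω => W t (T ω)) Γ := by
  intro I c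
  refine le_of_eq_of_le ?_ (hW I c)
  exact hT.lintegral_comp (f := fun y => ENNReal.ofReal ((∑ t ∈ I, c t * W t y) ^ 2)) (by fun_prop)

variable {Ω E : Type*} [MeasurableSpace Ω] [MeasurableSpace E] {P : Measure Ω}
  [IsProbabilityMeasure P] {w : ℤ → Ω → E}

theorem IsIID.measurePreserving_process (hw : IsIID P w) :
    MeasurePreserving (fun ω i => w i ω) P (Measure.infinitePi fun _ : ℤ => P.map (w 0)) := by
  refine ⟨measurable_pi_lambda _ hw.measurable, ?_⟩
  rw [hw.indep.map_fun_eq_infinitePi_map hw.measurable]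
  congr 1
  funext i
  exact (hw.identDistrib i).map_eq

theorem measurable_past (hw : ∀ i, Measurable (w i)) (t : ℤ) : Measurable (past w t) :=
  measurable_pi_lambda _ fun j => hw (t - j)

theorem IsIID.measurePreserving_past (hw : IsIID P w) (t : ℤ) :
    MeasurePreserving (past w t) P (Measure.infinitePi fun _ : ℕ => P.map (w 0)) := by
  have : IsProbabilityMeasure (P.map (w 0)) :=
    Measure.isProbabilityMeasure_map (hw.measurable 0).aemeasurable
  have h1 : MeasurePreserving (fun (y : ℤ → E) (j : ℕ) => y (t - j))
      (Measure.infinitePi fun _ : ℤ => P.map (w 0)) (Measure.infinitePi fun _ : ℕ => P.map (w 0)) :=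
    ⟨by fun_prop, Measure.map_infinitePi_infinitePi_of_inj (P := fun _ => P.map (w 0))
      (f := fun j : ℕ => t - (j : ℤ)) fun i j h => by simpa using h⟩
  exact h1.comp hw.measurePreserving_process

theorem IsIID.measurePreserving_past_prod (hw : IsIID P w) (t : ℤ) :
    MeasurePreserving (fun p : Ω × Ω => (past w t p.1, past w t p.2)) (P.prod P)
      ((Measure.infinitePi fun _ : ℕ => P.map (w 0)).prod
        (Measure.infinitePi fun _ : ℕ => P.map (w 0))) := by
  have : IsProbabilityMeasure (P.map (w 0)) :=
    Measure.isProbabilityMeasure_map (hw.measurable 0).aemeasurable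
  exact (hw.measurePreserving_past t).prod (hw.measurePreserving_past t)

theorem measurable_update_swap (k : ℕ) :
    Measurable fun p : (ℕ → E) × (ℕ → E) => Function.update p.1 k (p.2 k) := by
  refine measurable_pi_lambda _ fun j => ?_
  by_cases h : j = k
  · subst h
    simp only [Function.update_self]
    fun_prop
  · simp only [Function.update_of_ne h]
    fun_prop

theorem coupledPast_eq (w : ℤ → Ω → E) (t : ℤ) (k : ℕ) (p : Ω × Ω) :
    coupledPast w t k p = Function.update (past w t p.1) k (past w t p.2 k) := rfl

/-- Physical dependence measures do not depend on time. -/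
theorem IsIID.eLpNorm_coupling_eq (hw : IsIID P w) {φ : (ℕ → E) → ℝ} (hφ : Measurable φ)
    (q : ℝ≥0∞) (k : ℕ) (t t' : ℤ) :
    eLpNorm (fun p : Ω × Ω => φ (past w t p.1) - φ (coupledPast w t k p)) q (P.prod P) =
      eLpNorm (fun p : Ω × Ω => φ (past w t' p.1) - φ (coupledPast w t' k p)) q (P.prod P) := by
  have hm : Measurable fun p : (ℕ → E) × (ℕ → E) =>
      φ p.1 - φ (Function.update p.1 k (p.2 k)) :=
    (hφ.comp measurable_fst).sub (hφ.comp (measurable_update_swap k))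
  have h : ∀ t, eLpNorm (fun p : Ω × Ω => φ (past w t p.1) - φ (coupledPast w t k p)) q (P.prod P) =
      eLpNorm (fun p : (ℕ → E) × (ℕ → E) => φ p.1 - φ (Function.update p.1 k (p.2 k))) q
        ((Measure.infinitePi fun _ : ℕ => P.map (w 0)).prod
        (Measure.infinitePi fun _ : ℕ => P.map (w 0))) := fun t => by
    rw [← eLpNorm_comp_measurePreserving (p := q) hm.aestronglyMeasurable
      (hw.measurePreserving_past_prod t)]
    simp only [coupledPast_eq, Function.comp_def]
  rw [h, h]

/-- A stationary causal process whose physical dependence measures are summable has bounded linear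
forms. -/
theorem IsIID.boundedLinearForms (hw : IsIID P w) {φ : (ℕ → E) → ℝ} (hφ : Measurable φ)
    (hL : MemLp (fun ω => φ (past w 0 ω)) 2 P) {δ : ℕ → ℝ≥0∞}
    (hδ : ∀ k, eLpNorm (fun p : Ω × Ω => φ (past w 0 p.1) - φ (coupledPast w 0 k p)) 2
      (P.prod P) ≤ δ k) :
    BoundedLinearForms P (fun t ω => φ (past w t ω) - ∫ ω, φ (past w 0 ω) ∂P) ((∑' k, δ k) ^ 2) := by
  have : IsProbabilityMeasure (P.map (w 0)) :=
    Measure.isProbabilityMeasure_map (hw.measurable 0).aemeasurable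
  have hproc := hw.measurePreserving_process
  have hshift : ∀ t : ℤ, Measurable fun y : ℤ → E => φ fun j => y (t - j) := fun t =>
    hφ.comp (by fun_prop)
  have hpair : MeasurePreserving (fun p : Ω × Ω => ((fun i => w i p.1), fun i => w i p.2))
      (P.prod P) ((Measure.infinitePi fun _ : ℤ => P.map (w 0)).prod
        (Measure.infinitePi fun _ : ℤ => P.map (w 0))) := hproc.prod hproc
  have hLam : ∀ t, MemLp (fun y : ℤ → E => φ fun j => y (t - j)) 2
      (Measure.infinitePi fun _ : ℤ => P.map (w 0)) := fun t => by
    have h1 : MemLp (fun ω => φ (past w t ω)) 2 P := by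
      have h0 : MemLp φ 2 (Measure.infinitePi fun _ : ℕ => P.map (w 0)) := by
        rw [← (hw.measurePreserving_past 0).map_eq,
          memLp_map_measure_iff hφ.aestronglyMeasurable
            (hw.measurePreserving_past 0).measurable.aemeasurable]
        exact hL
      exact h0.comp_measurePreserving (hw.measurePreserving_past t)
    rw [← hproc.map_eq, memLp_map_measure_iff (hshift t).aestronglyMeasurable
      hproc.measurable.aemeasurable]
    exact h1
  have key := boundedLinearForms_infinitePi hφ (δ := δ) hLam fun t k => by
    have hm : Measurable fun p : (ℤ → E) × (ℤ → E) => φ (fun j => p.1 (t - j)) -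
        φ (fun j => resample {t - (k : ℤ)} p.1 p.2 (t - j)) :=
      ((hshift t).comp measurable_fst).sub ((hshift t).comp (measurable_resample _))
    rw [← eLpNorm_comp_measurePreserving hm.aestronglyMeasurable hpair]
    refine le_trans (le_of_eq ?_) (hδ k)
    rw [← hw.eLpNorm_coupling_eq hφ 2 k t 0]
    congr 1
    funext p
    simp only [Function.comp]
    congr 2
    funext j
    by_cases h : j = k
    · subst h; simp [resample, coupledPast]
    · have : ¬ (t - (j : ℤ) = t - k) := by omega
      simp [resample, coupledPast, h, past]
  have := key.comp_measurePreserving hproc fun t => (hshift t).sub_const _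
  intro I c
  refine le_of_eq_of_le ?_ (this I c)
  refine lintegral_congr fun ω => ?_
  congr 3
  funext t
  congr 2
  have h0 := hw.measurePreserving_past t
  have e1 : ∫ y, φ (fun j => y (t - j)) ∂(Measure.infinitePi fun _ : ℤ => P.map (w 0)) =
      ∫ ω, φ (past w t ω) ∂P := by
    rw [← hproc.map_eq, integral_map hproc.measurable.aemeasurable (hshift t).aestronglyMeasurable]
    rfl
  have e2 : ∀ t, ∫ ω, φ (past w t ω) ∂P =
      ∫ y, φ y ∂(Measure.infinitePi fun _ : ℕ => P.map (w 0)) := fun t => by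
    rw [← (hw.measurePreserving_past t).map_eq,
      integral_map (hw.measurePreserving_past t).measurable.aemeasurable hφ.aestronglyMeasurable]
  change φ (past w t ω) - _ = φ (past w t ω) - _
  rw [e1, e2, e2]

/-- A linear process with absolutely summable coefficients converges almost surely. -/
theorem ae_summable_linear_process {a : ℕ → ℝ} (ha : Summable fun k => |a k|) {η : ℤ → Ω → ℝ}
    (hη : ∀ i, MemLp (η i) 2 P) (h1 : ∀ i, eLpNorm (η i) 2 P ≤ 1) (t : ℤ) :
    ∀ᵐ ω ∂P, Summable fun k : ℕ => a k * η (t - k) ω := by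
  have hfin : ∫⁻ ω, ∑' k : ℕ, ‖a k * η (t - k) ω‖ₑ ∂P < ∞ := by
    rw [lintegral_tsum fun k => ((hη _).1.const_mul _).enorm]
    have : ∀ k : ℕ, ∫⁻ ω, ‖a k * η (t - k) ω‖ₑ ∂P ≤ ENNReal.ofReal |a k| := fun k => by
      simp only [enorm_mul]
      rw [lintegral_const_mul' _ _ enorm_ne_top, Real.enorm_eq_ofReal_abs]
      have h2 : ∫⁻ ω, ‖η (t - k) ω‖ₑ ∂P ≤ 1 := by
        rw [← eLpNorm_one_eq_lintegral_enorm]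
        exact (eLpNorm_le_eLpNorm_of_exponent_le (by norm_num) (hη _).1).trans (h1 _)
      calc _ ≤ ENNReal.ofReal |a k| * 1 := by gcongr
        _ = _ := mul_one _
    refine (ENNReal.tsum_le_tsum this).trans_lt ?_
    rw [← ENNReal.ofReal_tsum_of_nonneg (fun _ => abs_nonneg _) ha]
    exact ENNReal.ofReal_lt_top
  filter_upwards [ae_lt_top' (AEMeasurable.tsum fun k : ℕ => ((hη (t - k)).1.const_mul (a k)).enorm) hfin.ne]
    with ω hω
  have : Summable fun k : ℕ => ‖a k * η (t - k) ω‖₊ := by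
    rw [← ENNReal.tsum_coe_ne_top_iff_summable]
    exact hω.ne
  exact Summable.of_nnnorm this

/-- A linear process with absolutely summable coefficients is a sum over the lags of orthogonal
sequences, so that its linear forms are bounded without passing to dependence measures. -/
theorem boundedLinearForms_linear_process {a : ℕ → ℝ} (ha : Summable fun k => |a k|)
    {η : ℤ → Ω → ℝ} (hη : IsIID P η) (hL : ∀ i, MemLp (η i) 2 P) (hmean : ∀ i, ∫ ω, η i ω ∂P = 0)
    (hvar : ∀ i, ∫ ω, η i ω ^ 2 ∂P = 1) :
    BoundedLinearForms P (fun t ω => ∑' k : ℕ, a k * η (t - k) ω)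
      ((∑' k, ENNReal.ofReal |a k|) ^ 2) := by
  have hnorm : ∀ i, eLpNorm (η i) 2 P ≤ 1 := fun i => by
    rw [← ENNReal.pow_le_pow_left_iff two_ne_zero, eLpNorm_two_sq,
      ← ofReal_integral_eq_lintegral_ofReal (hL i).integrable_sq
        (Eventually.of_forall fun _ => sq_nonneg _), hvar]
    simp
  refine boundedLinearForms_of_orthogonal_series (ξ := fun t k ω => a k * η (t - k) ω)
    (fun t k => (hL _).const_mul _) ?_ ?_ ?_
  · intro k t t' htt'
    have hind : IndepFun (η (t - k)) (η (t' - k)) P := hη.indep.indepFun (by omega)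
    have := hind.integral_fun_mul_eq_mul_integral (hL _).1 (hL _).1
    calc _ = ∫ ω, (a k * a k) * (η (t - k) ω * η (t' - k) ω) ∂P := by
          congr 1; funext ω; ring
      _ = 0 := by rw [integral_const_mul, this, hmean, zero_mul, mul_zero]
  · intro t k
    have := eLpNorm_const_smul (a k) (η (t - k)) 2 P
    have h2 : (fun ω => a k * η (t - k) ω) = a k • η (t - k) := rfl
    rw [h2, this, Real.enorm_eq_ofReal_abs]
    calc _ ≤ ENNReal.ofReal |a k| * 1 := by gcongr; exact hnorm _
      _ = _ := mul_one _
  · intro t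
    filter_upwards [ae_summable_linear_process ha hL hnorm t] with ω hω
    exact hω.hasSum.tendsto_sum_nat

end IIDInputs

/-! ### Counts of covariates and their compensators -/

/-- Cauchy-Schwarz on a finite measure space. -/
theorem ofReal_sq_integral_le {α : Type*} [MeasurableSpace α] {μ : Measure α}
    {f : α → ℝ} (hf : AEStronglyMeasurable f μ) :
    ENNReal.ofReal ((∫ a, f a ∂μ) ^ 2) ≤ μ univ * ∫⁻ a, ENNReal.ofReal (f a ^ 2) ∂μ := by
  have h1 : ‖∫ a, f a ∂μ‖ₑ ≤ eLpNorm f 1 μ := by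
    rw [eLpNorm_one_eq_lintegral_enorm]
    exact enorm_integral_le_lintegral_enorm f
  have h2 := eLpNorm_le_eLpNorm_mul_rpow_measure_univ (p := 1) (q := 2) (by norm_num) hf
  have h3 : ENNReal.ofReal ((∫ a, f a ∂μ) ^ 2) = ‖∫ a, f a ∂μ‖ₑ ^ 2 := by
    rw [← enorm_pow, Real.enorm_eq_ofReal (sq_nonneg _)]
  rw [h3, ← eLpNorm_two_sq]
  refine (ENNReal.pow_le_pow_left (h1.trans h2) (n := 2)).trans_eq ?_
  rw [mul_pow, ← ENNReal.rpow_natCast (_ ^ _), ← ENNReal.rpow_mul, mul_comm]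
  norm_num

section Counts

variable {Ω : Type*} [MeasurableSpace Ω] {P : Measure Ω} [IsProbabilityMeasure P] {d d' l : ℕ}
  {M : PLModel Ω d d' l}

namespace PLModel

theorem Standing.measurable_X (hM : M.Standing P) (i : ℤ) : Measurable (M.X i) :=
  hM.measurable_H.comp (measurable_past hM.iid_v.measurable i)

variable {G : (Fin d → ℝ) → (ℕ → (Fin d' → ℝ)) → ℝ} {g : (Fin d → ℝ) → ℝ}

/-- The conditional probability, computed from the conditional density `G`, that the next
covariate falls into `R`. -/
def condProb (G : (Fin d → ℝ) → (ℕ → (Fin d' → ℝ)) → ℝ) (R : Set (Fin d → ℝ))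
    (y : ℕ → (Fin d' → ℝ)) : ℝ :=
  (∫⁻ x in R, ENNReal.ofReal (G x y)).toReal

theorem measurable_lintegral_density (hGm : Measurable (Function.uncurry G))
    (R : Set (Fin d → ℝ)) : Measurable fun y => ∫⁻ x in R, ENNReal.ofReal (G x y) := by
  have : Measurable fun p : (Fin d → ℝ) × (ℕ → (Fin d' → ℝ)) => ENNReal.ofReal (G p.1 p.2) :=
    hGm.ennreal_ofReal
  exact this.lintegral_prod_left'

theorem measurable_condProb (hGm : Measurable (Function.uncurry G)) (R : Set (Fin d → ℝ)) :
    Measurable (condProb G R) := (measurable_lintegral_density hGm R).ennreal_toReal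

theorem condDistrib_eq (hG : M.IsCondDensity P G) {R : Set (Fin d → ℝ)} (hR : MeasurableSet R)
    (i : ℤ) : ∀ᵐ ω ∂P, condDistrib (M.X i) (past M.v (i - 1)) P (past M.v (i - 1) ω) R =
      ∫⁻ x in R, ENNReal.ofReal (G x (past M.v (i - 1) ω)) := by
  filter_upwards [hG.law i] with ω hω
  rw [hω, withDensity_apply _ hR]

theorem condDistrib_eq_condProb (hG : M.IsCondDensity P G) {R : Set (Fin d → ℝ)}
    (hR : MeasurableSet R) (i : ℤ) :
    ∀ᵐ ω ∂P, (condDistrib (M.X i) (past M.v (i - 1)) P (past M.v (i - 1) ω)).real R =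
      condProb G R (past M.v (i - 1) ω) := by
  filter_upwards [condDistrib_eq hG hR i] with ω hω
  rw [Measure.real, hω, condProb]

/-- Integrating a function of the past and of the present covariate. -/
theorem lintegral_past_present (hM : M.Standing P) (i : ℤ)
    {f : (ℕ → (Fin d' → ℝ)) × (Fin d → ℝ) → ℝ≥0∞} (hf : Measurable f) :
    ∫⁻ ω, f (past M.v (i - 1) ω, M.X i ω) ∂P =
      ∫⁻ ω, ∫⁻ x, f (past M.v (i - 1) ω, x)
        ∂(condDistrib (M.X i) (past M.v (i - 1)) P (past M.v (i - 1) ω)) ∂P := by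
  have hp := measurable_past hM.iid_v.measurable (i - 1)
  have hX := hM.measurable_X i
  rw [← lintegral_map (f := f) hf (hp.prodMk hX),
    ← compProd_map_condDistrib hX.aemeasurable, Measure.lintegral_compProd hf,
    lintegral_map (Measurable.lintegral_kernel_prod_right' hf) hp]

/-- The probability generating function of a Bernoulli variable is at most that of the Poisson
variable with the same mean. -/
theorem lintegral_exp_indicator_le {κ : Measure (Fin d → ℝ)} [IsProbabilityMeasure κ]
    {R : Set (Fin d → ℝ)} (hR : MeasurableSet R) (c : ℝ) :
    ∫⁻ x, ENNReal.ofReal (Real.exp (c * R.indicator (fun _ => 1) x)) ∂κ ≤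
      ENNReal.ofReal (Real.exp ((Real.exp c - 1) * κ.real R)) := by
  have h1 : ∀ x, Real.exp (c * R.indicator (fun _ => 1) x) =
      1 + (Real.exp c - 1) * R.indicator (fun _ => (1 : ℝ)) x := fun x => by
    by_cases hx : x ∈ R <;> simp [hx]
  have hi : Integrable (R.indicator fun _ => (1 : ℝ)) κ := (integrable_const _).indicator hR
  have hint : Integrable (fun x => Real.exp (c * R.indicator (fun _ => 1) x)) κ := by
    simp only [h1]
    exact (integrable_const _).add (hi.const_mul _)
  rw [← ofReal_integral_eq_lintegral_ofReal hint (Eventually.of_forall fun _ => (Real.exp_pos _).le)]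
  refine ENNReal.ofReal_le_ofReal ?_
  simp only [h1]
  rw [integral_add (integrable_const _) (hi.const_mul _), integral_const_mul,
    integral_indicator_const _ hR]
  simp only [integral_const, probReal_univ, smul_eq_mul, mul_one]
  linarith [Real.add_one_le_exp ((Real.exp c - 1) * κ.real R)]

/-- The number of covariates among the first `n` that fall into `R`. -/
def count (M : PLModel Ω d d' l) (R : Set (Fin d → ℝ)) (n : ℕ) (ω : Ω) : ℝ :=
  ∑ s ∈ Finset.range n, R.indicator (fun _ => (1 : ℝ)) (M.X (s + 1) ω)

/-- The compensator of `count`: the sum of the conditional probabilities given the past. -/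
def compensator (M : PLModel Ω d d' l) (G : (Fin d → ℝ) → (ℕ → (Fin d' → ℝ)) → ℝ)
    (R : Set (Fin d → ℝ)) (n : ℕ) (ω : Ω) : ℝ :=
  ∑ s ∈ Finset.range n, condProb G R (past M.v s ω)

theorem past_eq_shift (w : ℤ → Ω → (Fin d' → ℝ)) {s n : ℕ} (hs : s ≤ n) (ω : Ω) :
    past w s ω = fun j => past w n ω (n - s + j) := by
  funext j
  simp only [past]
  congr 1
  push_cast [Nat.cast_sub hs]
  ring

/-- The exponential process built from the counts is a supermartingale. -/
theorem lintegral_exp_count_le (hM : M.Standing P) (hG : M.IsCondDensity P G)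
    {R : Set (Fin d → ℝ)} (hR : MeasurableSet R) (c : ℝ) (n : ℕ) :
    ∫⁻ ω, ENNReal.ofReal
      (Real.exp (c * M.count R n ω - (Real.exp c - 1) * M.compensator G R n ω)) ∂P ≤ 1 := by
  induction n with
  | zero => simp [count, compensator]
  | succ n ih =>
    have hcp := measurable_condProb hG.measurable R
    have hind : Measurable (R.indicator fun _ => (1 : ℝ)) := measurable_const.indicator hR
    have hexp : Measurable fun x => ENNReal.ofReal
        (Real.exp (c * R.indicator (fun _ => (1 : ℝ)) x)) := by
      exact (hind.const_mul c).exp.ennreal_ofReal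
    -- the exponent at time `n` together with the next compensator is a function of the past
    let ψ : (ℕ → (Fin d' → ℝ)) → ℝ := fun y =>
      c * ∑ s ∈ Finset.range n, R.indicator (fun _ => (1 : ℝ))
          (M.H fun j => y (n - (s + 1) + j)) -
        (Real.exp c - 1) * ∑ s ∈ Finset.range (n + 1), condProb G R fun j => y (n - s + j)
    have hψ : Measurable ψ := by
      refine Measurable.sub ?_ ?_
      · refine Measurable.const_mul (Finset.measurable_fun_sum _ fun s _ => ?_) _
        exact hind.comp (hM.measurable_H.comp (by fun_prop))
      · refine Measurable.const_mul (Finset.measurable_fun_sum _ fun s _ => ?_) _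
        exact hcp.comp (by fun_prop)
    have hψeq : ∀ ω, ψ (past M.v n ω) = c * M.count R n ω -
        (Real.exp c - 1) * M.compensator G R (n + 1) ω := fun ω => by
      simp only [ψ, count, compensator]
      congr 2
      · refine Finset.sum_congr rfl fun s hs => ?_
        have h1 := past_eq_shift M.v (Nat.succ_le_of_lt (Finset.mem_range.1 hs)) ω
        rw [Nat.succ_eq_add_one] at h1
        rw [← h1]
        simp [X]
      · refine Finset.sum_congr rfl fun s hs => ?_
        rw [← past_eq_shift M.v (Nat.le_of_lt_succ (Finset.mem_range.1 hs)) ω]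
    have hstep : ∀ ω, Real.exp (c * M.count R (n + 1) ω -
        (Real.exp c - 1) * M.compensator G R (n + 1) ω) =
        Real.exp (ψ (past M.v n ω)) *
          Real.exp (c * R.indicator (fun _ => (1 : ℝ)) (M.X (n + 1) ω)) := fun ω => by
      rw [← Real.exp_add, hψeq]
      congr 1
      simp only [count, Finset.sum_range_succ]
      ring
    have hmf : Measurable fun p : (ℕ → (Fin d' → ℝ)) × (Fin d → ℝ) =>
        ENNReal.ofReal (Real.exp (ψ p.1)) *
          ENNReal.ofReal (Real.exp (c * R.indicator (fun _ => (1 : ℝ)) p.2)) := by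
      have h1 : Measurable fun p : (ℕ → (Fin d' → ℝ)) × (Fin d → ℝ) => ψ p.1 :=
        hψ.comp measurable_fst
      exact h1.exp.ennreal_ofReal.mul (hexp.comp measurable_snd)
    have e1 : ∀ ω, past M.v ((n + 1 : ℤ) - 1) ω = past M.v n ω := fun ω => by
      rw [add_sub_cancel_right]
    calc _ = ∫⁻ ω, ENNReal.ofReal (Real.exp (ψ (past M.v n ω))) *
          ENNReal.ofReal (Real.exp (c * R.indicator (fun _ => (1 : ℝ)) (M.X (n + 1) ω))) ∂P := by
          refine lintegral_congr fun ω => ?_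
          rw [hstep, ENNReal.ofReal_mul (Real.exp_pos _).le]
      _ ≤ ∫⁻ ω, ENNReal.ofReal (Real.exp (ψ (past M.v n ω))) *
          ENNReal.ofReal (Real.exp ((Real.exp c - 1) * condProb G R (past M.v n ω))) ∂P := by
          have := lintegral_past_present hM (n + 1) hmf
          simp only [e1] at this
          rw [this]
          refine lintegral_mono_ae ?_
          have h2 := condDistrib_eq_condProb hG hR (n + 1)
          simp only [e1] at h2
          filter_upwards [h2] with ω hω
          rw [lintegral_const_mul _ hexp, ← hω]
          gcongr
          exact lintegral_exp_indicator_le hR c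
      _ = _ := by
          refine lintegral_congr fun ω => ?_
          rw [← ENNReal.ofReal_mul (Real.exp_pos _).le, ← Real.exp_add, hψeq]
          simp only [compensator, Finset.sum_range_succ]
          congr 2
          ring
      _ ≤ 1 := ih

end PLModel
end Counts

/-! ### Concentration of the counts -/

section CountConcentration

variable {Ω : Type*} [MeasurableSpace Ω] {P : Measure Ω} [IsProbabilityMeasure P] {d d' l : ℕ}
  {M : PLModel Ω d d' l}

namespace PLModel
variable {G : (Fin d → ℝ) → (ℕ → (Fin d' → ℝ)) → ℝ} {g : (Fin d → ℝ) → ℝ}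

theorem measurable_compensator (hM : M.Standing P) (hG : M.IsCondDensity P G)
    (R : Set (Fin d → ℝ)) (n : ℕ) : Measurable (M.compensator G R n) :=
  Finset.measurable_fun_sum _ fun s _ =>
    (measurable_condProb hG.measurable R).comp (measurable_past hM.iid_v.measurable s)

theorem measurable_count (hM : M.Standing P) {R : Set (Fin d → ℝ)} (hR : MeasurableSet R) (n : ℕ) :
    Measurable (M.count R n) :=
  Finset.measurable_fun_sum _ fun s _ =>
    (measurable_const.indicator hR).comp (hM.measurable_X (s + 1))

/-- The expected conditional probability is the probability. -/
theorem lintegral_condDensity (hM : M.Standing P) (hG : M.IsCondDensity P G)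
    (hg : M.IsDensity P g) {R : Set (Fin d → ℝ)} (hR : MeasurableSet R) (s : ℤ) :
    ∫⁻ ω, (∫⁻ x in R, ENNReal.ofReal (G x (past M.v s ω))) ∂P =
      ∫⁻ x in R, ENNReal.ofReal (g x) := by
  have hf : Measurable fun p : (ℕ → (Fin d' → ℝ)) × (Fin d → ℝ) =>
      R.indicator (fun _ => (1 : ℝ≥0∞)) p.2 :=
    (measurable_const.indicator hR).comp measurable_snd
  have h1 := lintegral_past_present hM (s + 1) hf
  have h2 := condDistrib_eq hG hR (s + 1)
  simp only [add_sub_cancel_right] at h1 h2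
  have h3 : ∫⁻ ω, R.indicator (fun _ => (1 : ℝ≥0∞)) (M.X (s + 1) ω) ∂P =
      ∫⁻ x in R, ENNReal.ofReal (g x) := by
    rw [← withDensity_apply _ hR, ← hg.law (s + 1), Measure.map_apply (hM.measurable_X _) hR,
      ← lintegral_indicator_one (hM.measurable_X _ hR)]
    rfl
  rw [← h3, h1]
  refine lintegral_congr_ae ?_
  filter_upwards [h2] with ω hω
  rw [← hω, ← lintegral_indicator_one hR]
  rfl

/-- The mean of the conditional density is the density, almost everywhere. -/
theorem ae_lintegral_condDensity_eq (hM : M.Standing P) (hG : M.IsCondDensity P G)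
    (hg : M.IsDensity P g) :
    ∀ᵐ x, ∫⁻ ω, ENNReal.ofReal (G x (past M.v 0 ω)) ∂P = ENNReal.ofReal (g x) := by
  have hm : Measurable fun p : (Fin d → ℝ) × Ω => ENNReal.ofReal (G p.1 (past M.v 0 p.2)) :=
    (hG.measurable.comp (measurable_fst.prodMk
      ((measurable_past hM.iid_v.measurable 0).comp measurable_snd))).ennreal_ofReal
  refine ae_eq_of_forall_setLIntegral_eq_of_sigmaFinite hm.lintegral_prod_right'
    hg.measurable.ennreal_ofReal fun R hR _ => ?_
  rw [← lintegral_condDensity hM hG hg hR 0, lintegral_lintegral_swap]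
  exact hm.aemeasurable

theorem ae_integral_condDensity_eq (hM : M.Standing P) (hG : M.IsCondDensity P G)
    (hg : M.IsDensity P g) :
    ∀ᵐ x, ∫ ω, G x (past M.v 0 ω) ∂P = g x := by
  filter_upwards [ae_lintegral_condDensity_eq hM hG hg] with x hx
  rw [integral_eq_lintegral_of_nonneg_ae (Eventually.of_forall fun _ => hG.nonneg _ _), hx,
    ENNReal.toReal_ofReal (hg.nonneg x)]
  exact (hG.measurable.comp (measurable_const.prodMk
    (measurable_past hM.iid_v.measurable 0))).aestronglyMeasurable

/-- The conditional densities at a point of `T` have bounded linear forms, uniformly in the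
point. -/
theorem exists_boundedLinearForms_condDensity (hM : M.Standing P) (hG : M.IsCondDensity P G)
    {T : Set (Fin d → ℝ)} {s ξ : ℝ} (hcov : M.CovariateDependence P G T s ξ) :
    ∃ Θ : ℝ, 0 ≤ Θ ∧ ∀ x ∈ T, BoundedLinearForms P
      (fun t ω => G x (past M.v t ω) - ∫ ω, G x (past M.v 0 ω) ∂P) (ENNReal.ofReal Θ) := by
  obtain ⟨C, hC⟩ := hcov.decay
  refine ⟨(max (C * ((1 : ℕ) : ℝ) ^ (-ξ)) 0) ^ 2, sq_nonneg _, fun x hx => ?_⟩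
  have hmx : Measurable (G x) := hG.measurable.comp (measurable_const.prodMk measurable_id)
  have hs : (2 : ℝ≥0∞) ≤ ENNReal.ofReal s := by
    have : ENNReal.ofReal 2 ≤ ENNReal.ofReal s := ENNReal.ofReal_le_ofReal hcov.two_lt.le
    simpa using this
  have h1 := hM.iid_v.boundedLinearForms (φ := G x) hmx
    (δ := fun k => M.theta P G T s 1 (1 + k)) ?_ ?_
  · intro I c
    refine (h1 I c).trans ?_
    gcongr
    rw [ENNReal.ofReal_pow (le_max_right _ _)]
    gcongr
    exact (hC 1 1 le_rfl).trans (ENNReal.ofReal_le_ofReal (le_max_left _ _))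
  · have := (hcov.memLp 1 x hx).mono_exponent hs
    simpa using this
  · intro k
    have hmc : Measurable fun p : Ω × Ω =>
        G x (past M.v 0 p.1) - G x (coupledPast M.v 0 k p) := by
      have hp := measurable_past hM.iid_v.measurable 0
      refine (hmx.comp (hp.comp measurable_fst)).sub (hmx.comp ?_)
      exact (measurable_update_swap k).comp
        ((hp.comp measurable_fst).prodMk (hp.comp measurable_snd))
    refine (eLpNorm_le_eLpNorm_of_exponent_le hs hmc.aestronglyMeasurable).trans ?_
    have : M.theta P G T s 1 (1 + k) = ⨆ x ∈ T, eLpNorm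
        (fun p : Ω × Ω => G x (past M.v 0 p.1) - G x (coupledPast M.v 0 k p))
        (ENNReal.ofReal s) (P.prod P) := by
      simp [theta]
    rw [this]
    exact le_iSup₂ (f := fun x (_ : x ∈ T) => eLpNorm
        (fun p : Ω × Ω => G x (past M.v 0 p.1) - G x (coupledPast M.v 0 k p))
        (ENNReal.ofReal s) (P.prod P)) x hx

/-- The compensator of the counts in `R` deviates from its mean by the order of
`vol R * √n` in mean square. -/
theorem lintegral_sq_compensator_le (hM : M.Standing P) (hG : M.IsCondDensity P G)
    (hg : M.IsDensity P g) {R : Set (Fin d → ℝ)} (hR : MeasurableSet R)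
    {Θ : ℝ} (hΘ : ∀ x ∈ R, BoundedLinearForms P
      (fun t ω => G x (past M.v t ω) - ∫ ω, G x (past M.v 0 ω) ∂P) (ENNReal.ofReal Θ)) (n : ℕ) :
    ∫⁻ ω, ENNReal.ofReal ((M.compensator G R n ω - n * ∫ x in R, g x) ^ 2) ∂P ≤
      volume R * (volume R * (ENNReal.ofReal Θ * n)) := by
  have hpm : ∀ t, Measurable (past M.v t) := measurable_past hM.iid_v.measurable
  have hmG : Measurable fun p : Ω × (Fin d → ℝ) =>
      ∑ s ∈ Finset.range n, (G p.2 (past M.v s p.1) - g p.2) := by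
    refine Finset.measurable_fun_sum _ fun s _ => Measurable.sub ?_ (hg.measurable.comp measurable_snd)
    exact hG.measurable.comp (measurable_snd.prodMk ((hpm s).comp measurable_fst))
  have hgi : Integrable g := by
    refine ⟨hg.measurable.aestronglyMeasurable, ?_⟩
    rw [hasFiniteIntegral_iff_ofReal (Eventually.of_forall hg.nonneg)]
    have := lintegral_condDensity hM hG hg MeasurableSet.univ 0
    have h2 : (volume.withDensity fun x => ENNReal.ofReal (g x)) univ < ∞ := by
      rw [← hg.law 0]; exact measure_lt_top (P.map (M.X 0)) _
    rwa [withDensity_apply _ MeasurableSet.univ, Measure.restrict_univ] at h2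
  have hGi : ∀ᵐ ω ∂P, ∀ s : ℕ, Integrable (fun x => G x (past M.v s ω)) (volume.restrict R) := by
    rw [ae_all_iff]
    intro s
    have hfin : ∫⁻ ω, (∫⁻ x in R, ENNReal.ofReal (G x (past M.v s ω))) ∂P ≠ ∞ := by
      rw [lintegral_condDensity hM hG hg hR]
      exact ((hasFiniteIntegral_iff_ofReal (Eventually.of_forall hg.nonneg)).1
        (hgi.integrableOn (s := R)).2).ne
    filter_upwards [ae_lt_top ((measurable_lintegral_density hG.measurable R).comp (hpm s)) hfin]
      with ω hω
    refine ⟨(hG.measurable.comp (measurable_id.prodMk measurable_const)).aestronglyMeasurable, ?_⟩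
    rw [hasFiniteIntegral_iff_ofReal (Eventually.of_forall fun _ => hG.nonneg _ _)]
    exact hω
  have hdiff : ∀ᵐ ω ∂P, M.compensator G R n ω - n * ∫ x in R, g x =
      ∫ x in R, ∑ s ∈ Finset.range n, (G x (past M.v s ω) - g x) := by
    filter_upwards [hGi] with ω hω
    have hi : ∀ s : ℕ, Integrable (fun x => G x (past M.v s ω) - g x) (volume.restrict R) :=
      fun s => (hω s).sub hgi.integrableOn
    rw [integral_finsetSum _ fun s _ => hi s]
    have : ∀ s : ℕ, ∫ x in R, (G x (past M.v s ω) - g x) =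
        condProb G R (past M.v s ω) - ∫ x in R, g x := fun s => by
      rw [integral_sub (hω s) hgi.integrableOn, condProb,
        integral_eq_lintegral_of_nonneg_ae (Eventually.of_forall fun _ => hG.nonneg _ _) (hω s).1]
    simp only [this, Finset.sum_sub_distrib, Finset.sum_const, Finset.card_range, nsmul_eq_mul,
      compensator]
  calc _ ≤ ∫⁻ ω, (volume R * ∫⁻ x in R, ENNReal.ofReal
          ((∑ s ∈ Finset.range n, (G x (past M.v s ω) - g x)) ^ 2)) ∂P := by
        refine lintegral_mono_ae ?_
        filter_upwards [hdiff] with ω hω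
        rw [hω]
        refine (ofReal_sq_integral_le ?_).trans_eq (by rw [Measure.restrict_apply_univ])
        exact (hmG.comp measurable_prodMk_left).aestronglyMeasurable
    _ = volume R * ∫⁻ x in R, (∫⁻ ω, ENNReal.ofReal
          ((∑ s ∈ Finset.range n, (G x (past M.v s ω) - g x)) ^ 2) ∂P) := by
        rw [lintegral_const_mul, lintegral_lintegral_swap]
        · exact (hmG.pow_const 2).ennreal_ofReal.aemeasurable
        · exact (hmG.pow_const 2).ennreal_ofReal.lintegral_prod_right'
    _ ≤ volume R * ∫⁻ x in R, ENNReal.ofReal Θ * n := by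
        refine mul_le_mul' le_rfl (lintegral_mono_ae ?_)
        filter_upwards [ae_restrict_of_ae (ae_integral_condDensity_eq hM hG hg),
          ae_restrict_mem hR] with x hx hxR
        have := hΘ x hxR ((Finset.range n).map Nat.castEmbedding) fun _ => 1
        rw [hx] at this
        simpa using this
    _ = _ := by rw [lintegral_const, Measure.restrict_apply_univ]; ring

/-- Markov's inequality, for a function bounded below by `c` on the event. -/
theorem measureReal_le_of_lintegral_le {f : Ω → ℝ} (hf : Measurable f) {c C : ℝ} (hc : 0 < c)
    (hC : 0 ≤ C) (h : ∫⁻ ω, ENNReal.ofReal (f ω) ∂P ≤ ENNReal.ofReal C) {S : Set Ω}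
    (hS : ∀ ω ∈ S, c ≤ f ω) : P.real S ≤ C / c := by
  have h1 := meas_ge_le_lintegral_div (μ := P) (f := fun ω => ENNReal.ofReal (f ω))
    hf.ennreal_ofReal.aemeasurable (ε := ENNReal.ofReal c) (by simpa using hc) ENNReal.ofReal_ne_top
  have h2 : P S ≤ ENNReal.ofReal (C / c) := by
    rw [ENNReal.ofReal_div_of_pos hc]
    refine (measure_mono fun ω hω => ?_).trans (h1.trans (ENNReal.div_le_div_right h _))
    exact ENNReal.ofReal_le_ofReal (hS ω hω)
  exact ENNReal.toReal_le_of_le_ofReal (div_nonneg hC hc.le) h2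

/-- Concentration of the number of covariates in a set `R` on which the density is bounded above
and below: with high probability it is of the order `n * vol R`. -/
theorem exists_count_concentration (hM : M.Standing P) (hG : M.IsCondDensity P G)
    (hg : M.IsDensity P g) {T : Set (Fin d → ℝ)} {s ξ : ℝ} (hcov : M.CovariateDependence P G T s ξ)
    {c c' : ℝ} (hc : 0 < c) (hcc' : c ≤ c') (hgT : ∀ x ∈ T, c ≤ g x ∧ g x ≤ c') :
    ∃ B : ℝ, 0 ≤ B ∧ ∀ R ⊆ T, MeasurableSet R → volume R ≠ ∞ → ∀ V : ℝ, 0 < V →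
      volume.real R ≤ V → ∀ n : ℕ, 1 ≤ n →
      (volume.real R = V → P.real {ω | M.count R n ω ≤ c / 8 * (n * V)} ≤
        B / n + Real.exp (-(c / 8 * (n * V)))) ∧
      P.real {ω | 6 * c' * (n * V) ≤ M.count R n ω} ≤
        B / n + Real.exp (-(c / 8 * (n * V))) := by
  obtain ⟨Θ, hΘ0, hΘ⟩ := exists_boundedLinearForms_condDensity hM hG hcov
  refine ⟨4 * Θ / c ^ 2, by positivity, fun R hRT hR hRfin V hV hRV n hn => ?_⟩
  have hn0 : (0 : ℝ) < n := by exact_mod_cast hn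
  set I := ∫ x in R, g x
  have hgR : IntegrableOn g R := by
    refine Measure.integrableOn_of_bounded (M := c') hRfin hg.measurable.aestronglyMeasurable ?_
    filter_upwards [ae_restrict_mem hR] with x hx
    rw [Real.norm_of_nonneg (hg.nonneg x)]
    exact (hgT x (hRT hx)).2
  have hIl : c * volume.real R ≤ I := by
    have := setIntegral_mono_on (μ := volume) (integrableOn_const (C := c) hRfin) hgR hR
      fun x hx => (hgT x (hRT hx)).1
    simpa [I, mul_comm] using this
  have hIu : I ≤ c' * V := by
    have := setIntegral_mono_on (μ := volume) hgR (integrableOn_const (C := c') hRfin) hR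
      fun x hx => (hgT x (hRT hx)).2
    have h2 : I ≤ c' * volume.real R := by simpa [I, mul_comm] using this
    have : 0 < c' := hc.trans_le hcc'
    exact h2.trans (by gcongr)
  have hm : Measurable (M.compensator G R n) := measurable_compensator hM hG R n
  have hcm : Measurable (M.count R n) := measurable_count hM hR n
  -- Chebyshev's inequality for the compensator
  have hA : P.real {ω | c * (n * V) / 2 ≤ |M.compensator G R n ω - n * I|} ≤
      4 * Θ / c ^ 2 / n := by
    have h1 := lintegral_sq_compensator_le hM hG hg hR (fun x hx => hΘ x (hRT hx)) n
    have hvol : volume R ≤ ENNReal.ofReal V := by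
      rw [← ofReal_measureReal hRfin]
      exact ENNReal.ofReal_le_ofReal hRV
    have h2 : volume R * (volume R * (ENNReal.ofReal Θ * n)) ≤
        ENNReal.ofReal (V * (V * (Θ * n))) := by
      rw [ENNReal.ofReal_mul hV.le, ENNReal.ofReal_mul hV.le, ENNReal.ofReal_mul hΘ0,
        ENNReal.ofReal_natCast]
      gcongr
    have h3 := measureReal_le_of_lintegral_le (P := P) ((hm.sub_const (n * I)).pow_const 2)
      (c := (c * (n * V) / 2) ^ 2) (by positivity) (by positivity) (h1.trans h2)
      (S := {ω | c * (n * V) / 2 ≤ |M.compensator G R n ω - n * I|}) fun ω hω => by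
        rw [← sq_abs (M.compensator G R n ω - n * I)]
        exact pow_le_pow_left₀ (by positivity) hω 2
    refine h3.trans_eq ?_
    field_simp
    ring
  have hnV : 0 < n * V := by positivity
  have he1 : Real.exp (-1) ≤ 0.4 := by
    have := Real.exp_neg_one_lt_d9
    linarith
  constructor
  · intro hReq
    rw [hReq] at hIl
    have h1 := lintegral_exp_count_le hM hG hR (-1) n
    have h2 := measureReal_le_of_lintegral_le (P := P)
      (f := fun ω => Real.exp (-1 * M.count R n ω - (Real.exp (-1) - 1) * M.compensator G R n ω))
      (by fun_prop) (c := Real.exp (c / 8 * (n * V))) (Real.exp_pos _) zero_le_one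
      (by simpa using h1) (S := {ω | M.count R n ω ≤ c / 8 * (n * V) ∧
        c * (n * V) / 2 ≤ M.compensator G R n ω}) fun ω hω => by
        obtain ⟨ha, hb⟩ := hω
        refine Real.exp_le_exp.2 ?_
        have : 0 < c * (n * V) := by positivity
        nlinarith
    rw [one_div, ← Real.exp_neg] at h2
    refine (measureReal_mono ?_).trans ((measureReal_union_le _ _).trans (add_le_add hA h2))
    intro ω hω
    by_cases hb : c * (n * V) / 2 ≤ M.compensator G R n ω
    · exact Or.inr ⟨hω, hb⟩
    · left
      simp only [mem_ofPred_eq]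
      push Not at hb
      have : n * (c * V) ≤ n * I := by gcongr
      rw [abs_sub_comm]
      refine le_trans ?_ (le_abs_self _)
      linarith
  · have h1 := lintegral_exp_count_le hM hG hR 1 n
    have h2 := measureReal_le_of_lintegral_le (P := P)
      (f := fun ω => Real.exp (1 * M.count R n ω - (Real.exp 1 - 1) * M.compensator G R n ω))
      (by fun_prop) (c := Real.exp (c / 8 * (n * V))) (Real.exp_pos _) zero_le_one
      (by simpa using h1) (S := {ω | 6 * c' * (n * V) ≤ M.count R n ω ∧
        M.compensator G R n ω ≤ 2 * c' * (n * V)}) fun ω hω => by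
        obtain ⟨ha, hb⟩ := hω
        refine Real.exp_le_exp.2 ?_
        have h3 : c * (n * V) ≤ c' * (n * V) := by gcongr
        have h4 : 0 < c * (n * V) := by positivity
        have h5 := Real.exp_one_lt_three
        have h6 := Real.exp_one_gt_two
        have h7 : (Real.exp 1 - 1) * M.compensator G R n ω ≤
            (Real.exp 1 - 1) * (2 * c' * (n * V)) := by
          gcongr
          linarith
        have h8 : (Real.exp 1 - 1) * (2 * c' * (n * V)) ≤ 2 * (2 * c' * (n * V)) := by
          have : 0 ≤ 2 * c' * (n * V) := by linarith
          gcongr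
          linarith
        linarith
    rw [one_div, ← Real.exp_neg] at h2
    refine (measureReal_mono ?_).trans ((measureReal_union_le _ _).trans (add_le_add hA h2))
    intro ω hω
    by_cases hb : M.compensator G R n ω ≤ 2 * c' * (n * V)
    · exact Or.inr ⟨hω, hb⟩
    · left
      simp only [mem_ofPred_eq]
      push Not at hb
      have h3 : n * I ≤ n * (c' * V) := by gcongr
      have h4 : c * (n * V) ≤ c' * (n * V) := by gcongr
      refine le_trans ?_ (le_abs_self _)
      have h5 : 0 < c * (n * V) := by positivity
      linarith

end PLModel
end CountConcentration

/-! ### The kernel -/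

section Kernel

variable {d : ℕ} {K : (Fin d → ℝ) → ℝ}

theorem IsKernel.eq_zero (hK : IsKernel K) {z : Fin d → ℝ}
    (hz : z ∉ Icc (fun _ : Fin d => (-1 : ℝ)) fun _ => 1) : K z = 0 := by
  rw [← hK.tsupport_eq] at hz
  exact image_eq_zero_of_notMem_tsupport hz

/-- The support `[-1, 1]^d` of the kernel is the unit ball of the maximum norm. -/
theorem IsKernel.norm_le_one (hK : IsKernel K) {z : Fin d → ℝ} (hz : K z ≠ 0) : ‖z‖ ≤ 1 := by
  by_contra h
  refine hz (hK.eq_zero fun hmem => h ?_)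
  rw [pi_norm_le_iff_of_nonneg zero_le_one]
  intro j
  rw [Real.norm_eq_abs, abs_le]
  exact ⟨hmem.1 j, hmem.2 j⟩

theorem IsKernel.exists_bound (hK : IsKernel K) : ∃ C : ℝ, 0 < C ∧ ∀ z, K z ≤ C := by
  obtain ⟨C, hC⟩ := hK.bounded
  refine ⟨max C 1, by positivity, fun z => ?_⟩
  by_cases hz : z ∈ Icc (fun _ : Fin d => (-1 : ℝ)) fun _ => 1
  · exact (le_abs_self _).trans ((hC z hz).trans (le_max_left _ _))
  · rw [hK.eq_zero hz]
    positivity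

theorem IsKernel.measurable (hK : IsKernel K) : Measurable K := by
  classical
  have h1 : K = (Icc (fun _ : Fin d => (-1 : ℝ)) fun _ => 1).piecewise K 0 := by
    funext z
    by_cases hz : z ∈ Icc (fun _ : Fin d => (-1 : ℝ)) fun _ => 1
    · simp [hz]
    · simp [hz, hK.eq_zero hz]
  rw [h1]
  exact hK.contDiffOn.continuousOn.measurable_piecewise continuousOn_const measurableSet_Icc

/-- A point of the interior of the cube at which the kernel is positive is the centre of a ball, in
a given open set, on which the kernel is bounded away from zero. -/
theorem IsKernel.exists_ball (hK : IsKernel K) {z : Fin d → ℝ} (hz : 0 < K z)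
    {O : Set (Fin d → ℝ)} (hO : IsOpen O) (hzO : z ∈ O)
    (hOI : O ⊆ Icc (fun _ : Fin d => (-1 : ℝ)) fun _ => 1) :
    ∃ r : ℝ, 0 < r ∧ ∀ w, ‖w - z‖ ≤ r → w ∈ O ∧ K z / 2 ≤ K w := by
  have hcont : ContinuousAt K z :=
    (hK.contDiffOn.continuousOn.mono hOI).continuousAt (hO.mem_nhds hzO)
  have h1 : ∀ᶠ w in 𝓝 z, w ∈ O ∧ K z / 2 ≤ K w :=
    (show ∀ᶠ w in 𝓝 z, w ∈ O from hO.mem_nhds hzO).and ((hcont.eventually (lt_mem_nhds (half_lt_self hz))).mono fun w hw => hw.le)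
  obtain ⟨r, hr, hball⟩ := Metric.eventually_nhds_iff_ball.1 h1
  refine ⟨r / 2, by positivity, fun w hw => hball w ?_⟩
  rw [Metric.mem_ball, dist_eq_norm]
  linarith

theorem IsKernel.exists_ball_zero (hK : IsKernel K) (h0 : 0 < K 0) :
    ∃ r κ : ℝ, 0 < r ∧ 0 < κ ∧ ∀ w, ‖w‖ ≤ r → κ ≤ K w := by
  have hO : IsOpen (Set.pi univ fun _ : Fin d => Ioo (-1 : ℝ) 1) :=
    isOpen_set_pi finite_univ fun _ _ => isOpen_Ioo
  obtain ⟨r, hr, h⟩ := hK.exists_ball h0 hO (by simp) fun w hw =>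
    ⟨fun j => (hw j trivial).1.le, fun j => (hw j trivial).2.le⟩
  exact ⟨r, K 0 / 2, hr, by positivity, fun w hw => (h w (by simpa using hw)).2⟩

/-- In every orthant of the cube there is a ball on which the kernel is bounded away from zero. -/
theorem IsKernel.exists_ball_orthant (hK : IsKernel K) :
    ∃ r κ : ℝ, 0 < r ∧ 0 < κ ∧ ∀ σ : Fin d → Bool, ∃ z : Fin d → ℝ, ∀ w, ‖w - z‖ ≤ 2 * r →
      κ ≤ K w ∧ ∀ j, (σ j = true → 0 ≤ w j ∧ w j ≤ 1) ∧ (σ j = false → -1 ≤ w j ∧ w j ≤ 0) := by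
  have key : ∀ σ : Fin d → Bool, ∃ z : Fin d → ℝ, ∃ r κ : ℝ, 0 < r ∧ 0 < κ ∧ ∀ w, ‖w - z‖ ≤ 2 * r →
      κ ≤ K w ∧ ∀ j, (σ j = true → 0 ≤ w j ∧ w j ≤ 1) ∧ (σ j = false → -1 ≤ w j ∧ w j ≤ 0) := by
    intro σ
    set O : Set (Fin d → ℝ) := Set.pi univ fun j => if σ j then Ioo (0 : ℝ) 1 else Ioo (-1 : ℝ) 0
    have hO : IsOpen O := isOpen_set_pi finite_univ fun j _ => by
      by_cases h : σ j = true <;> simp [h, isOpen_Ioo]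
    have hOj : ∀ w ∈ O, ∀ j, (σ j = true → 0 < w j ∧ w j < 1) ∧
        (σ j = false → -1 < w j ∧ w j < 0) := fun w hw j => by
      have := hw j trivial
      by_cases h : σ j = true
      · simp only [h, if_true, mem_Ioo] at this; simp [h, this]
      · simp only [Bool.not_eq_true] at h
        simp only [h] at this
        simpa [h] using this
    have hOI : O ⊆ Icc (fun _ : Fin d => (-1 : ℝ)) fun _ => 1 := fun w hw => by
      refine ⟨fun j => ?_, fun j => ?_⟩ <;>
      · have := hOj w hw j
        rcases hσ : σ j with _ | _
        · have := this.2 hσ; dsimp only; linarith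
        · have := this.1 hσ; dsimp only; linarith
    have hne : (fun j => if σ j then (1 / 2 : ℝ) else -1 / 2) ∈ O := fun j _ => by
      by_cases h : σ j = true
      · simp only [h, if_true, mem_Ioo]; norm_num
      · simp only [h]; norm_num
    have hcl : (fun j => if σ j then (1 / 2 : ℝ) else -1 / 2) ∈ closure (Function.support K) := by
      change _ ∈ tsupport K
      rw [hK.tsupport_eq]
      exact hOI hne
    obtain ⟨z, hzO, hzK⟩ := mem_closure_iff.1 hcl O hO hne
    have hz : 0 < K z := lt_of_le_of_ne (hK.nonneg z) (Ne.symm hzK)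
    obtain ⟨r, hr, h⟩ := hK.exists_ball hz hO hzO hOI
    refine ⟨z, r / 2, K z / 2, by positivity, by positivity, fun w hw => ?_⟩
    have h2 := h w (by linarith)
    refine ⟨h2.2, fun j => ?_⟩
    have h3 := hOj w h2.1 j
    exact ⟨fun hσ => ⟨(h3.1 hσ).1.le, (h3.1 hσ).2.le⟩, fun hσ => ⟨(h3.2 hσ).1.le, (h3.2 hσ).2.le⟩⟩
  choose z r κ hr hκ h using key
  refine ⟨Finset.univ.inf' Finset.univ_nonempty r, Finset.univ.inf' Finset.univ_nonempty κ,
    by simpa [Finset.lt_inf'_iff] using hr, by simpa [Finset.lt_inf'_iff] using hκ,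
    fun σ => ⟨z σ, fun w hw => ?_⟩⟩
  have h1 : Finset.univ.inf' Finset.univ_nonempty r ≤ r σ := Finset.inf'_le _ (Finset.mem_univ σ)
  have h2 : Finset.univ.inf' Finset.univ_nonempty κ ≤ κ σ := Finset.inf'_le _ (Finset.mem_univ σ)
  have h3 := h σ w (by linarith)
  exact ⟨h2.trans h3.1, h3.2⟩

end Kernel

/-! ### Grid cells -/

section Cells

variable {d : ℕ}

/-- The cell of the grid of mesh `r` that contains `y`. -/
def cell (r : ℝ) (y : Fin d → ℝ) : Fin d → ℤ := fun j => ⌊y j / r⌋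

theorem norm_sub_le_of_cell_eq {r : ℝ} (hr : 0 < r) {y y' : Fin d → ℝ}
    (h : cell r y = cell r y') : ‖y - y'‖ ≤ r := by
  rw [pi_norm_le_iff_of_nonneg hr.le]
  intro j
  have h1 : |y j / r - y' j / r| < 1 := Int.abs_sub_lt_one_of_floor_eq_floor (congrFun h j)
  rw [← sub_div, abs_div, abs_of_pos hr, div_lt_one hr] at h1
  exact h1.le

/-- The cells at distance at most `m` from the cell `q`, in the maximum norm. -/
def nearCells (m : ℕ) (q : Fin d → ℤ) : Finset (Fin d → ℤ) :=
  Fintype.piFinset fun j => Finset.Icc (q j - m) (q j + m)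

theorem card_nearCells (m : ℕ) (q : Fin d → ℤ) : (nearCells m q).card = (2 * m + 1) ^ d := by
  rw [nearCells, Fintype.card_piFinset]
  have : ∀ j, (Finset.Icc (q j - m) (q j + m)).card = 2 * m + 1 := fun j => by
    rw [Int.card_Icc]; omega
  simp [this]

/-- Points within distance `h` lie in cells of mesh `ρ * h` that are a bounded number of steps
apart. -/
theorem cell_mem_nearCells {ρ h : ℝ} (hρ : 0 < ρ) (hh : 0 < h) {m : ℕ} (hm : 1 / ρ + 1 ≤ m)
    {y y' : Fin d → ℝ} (hy : ‖y - y'‖ ≤ h) :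
    cell (ρ * h) y ∈ nearCells m (cell (ρ * h) y') := by
  rw [nearCells, Fintype.mem_piFinset]
  intro j
  have h1 : |y j - y' j| ≤ h := (norm_le_pi_norm (y - y') j).trans hy
  have hr : 0 < ρ * h := by positivity
  have h2 : |y j / (ρ * h) - y' j / (ρ * h)| ≤ 1 / ρ := by
    rw [← sub_div, abs_div, abs_of_pos hr, div_le_div_iff₀ hr hρ]
    nlinarith
  rw [abs_le] at h2
  have f1 := Int.floor_le (y j / (ρ * h))
  have f2 := Int.lt_floor_add_one (y j / (ρ * h))
  have f3 := Int.floor_le (y' j / (ρ * h))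
  have f4 := Int.lt_floor_add_one (y' j / (ρ * h))
  rw [Finset.mem_Icc]
  simp only [cell]
  constructor
  · have : (⌊y' j / (ρ * h)⌋ : ℝ) - m < ⌊y j / (ρ * h)⌋ + 1 := by linarith
    have : ⌊y' j / (ρ * h)⌋ - (m : ℤ) < ⌊y j / (ρ * h)⌋ + 1 := by exact_mod_cast this
    omega
  · have : (⌊y j / (ρ * h)⌋ : ℝ) ≤ ⌊y' j / (ρ * h)⌋ + m := by linarith
    exact_mod_cast this

/-- The cells that may meet the box `[lo, hi]`. -/
def boxCells (r : ℝ) (lo hi : Fin d → ℝ) : Finset (Fin d → ℤ) :=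
  Fintype.piFinset fun j => Finset.Icc ⌊lo j / r⌋ ⌊hi j / r⌋

theorem cell_mem_boxCells {r : ℝ} (hr : 0 < r) {lo hi y : Fin d → ℝ} (hy : y ∈ Icc lo hi) :
    cell r y ∈ boxCells r lo hi := by
  rw [boxCells, Fintype.mem_piFinset]
  intro j
  rw [Finset.mem_Icc]
  have h1 := hy.1 j
  have h2 := hy.2 j
  exact ⟨Int.floor_le_floor (by gcongr), Int.floor_le_floor (by gcongr)⟩

/-- A box is covered by `O(h ^ (-d))` cells of mesh `ρ * h`. -/
theorem card_boxCells_le {ρ : ℝ} (hρ : 0 < ρ) {lo hi : Fin d → ℝ} (hlohi : ∀ j, lo j < hi j)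
    {h : ℝ} (hh : 0 < h) (hh1 : h ≤ 1) :
    ((boxCells (ρ * h) lo hi).card : ℝ) ≤ (∏ j, ((hi j - lo j) / ρ + 2)) / h ^ d := by
  rw [boxCells, Fintype.card_piFinset, Nat.cast_prod]
  have h0 : (∏ j : Fin d, ((hi j - lo j) / ρ + 2)) / h ^ d =
      ∏ j : Fin d, (((hi j - lo j) / ρ + 2) / h) := by
    rw [Finset.prod_div_distrib]; simp
  rw [h0]
  refine Finset.prod_le_prod (fun _ _ => Nat.cast_nonneg _) fun j _ => ?_
  rw [Int.card_Icc]
  have hr : 0 < ρ * h := by positivity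
  have h1 : ⌊lo j / (ρ * h)⌋ ≤ ⌊hi j / (ρ * h)⌋ :=
    Int.floor_le_floor (by have := (hlohi j).le; gcongr)
  have h2 : (((⌊hi j / (ρ * h)⌋ + 1 - ⌊lo j / (ρ * h)⌋).toNat : ℕ) : ℝ) =
      ⌊hi j / (ρ * h)⌋ + 1 - ⌊lo j / (ρ * h)⌋ := by
    have : (((⌊hi j / (ρ * h)⌋ + 1 - ⌊lo j / (ρ * h)⌋).toNat : ℕ) : ℤ) =
      ⌊hi j / (ρ * h)⌋ + 1 - ⌊lo j / (ρ * h)⌋ := Int.toNat_of_nonneg (by omega)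
    exact_mod_cast this
  rw [h2]
  have f1 := Int.floor_le (hi j / (ρ * h))
  have f2 := Int.lt_floor_add_one (lo j / (ρ * h))
  have e1 : ((hi j - lo j) / ρ + 2) / h = hi j / (ρ * h) - lo j / (ρ * h) + 2 / h := by
    field_simp
  have e2 : 2 ≤ 2 / h := by
    rw [le_div_iff₀ hh]; linarith
  rw [e1]
  linarith

/-- Summing the inverse sizes of the classes of a partition counts the classes. -/
theorem sum_inv_card_fiber_le {ι κ : Type*} [DecidableEq κ] (S : Finset ι) (c : ι → κ)
    (B : Finset κ) (hB : ∀ i ∈ S, c i ∈ B) :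
    ∑ i ∈ S, ((S.filter fun s => c s = c i).card : ℝ)⁻¹ ≤ B.card := by
  rw [← Finset.sum_fiberwise_of_maps_to hB]
  calc _ ≤ ∑ q ∈ B, (1 : ℝ) := by
        refine Finset.sum_le_sum fun q _ => ?_
        have : ∑ i ∈ S.filter fun s => c s = q, ((S.filter fun s => c s = c i).card : ℝ)⁻¹ =
            ∑ i ∈ S.filter fun s => c s = q, ((S.filter fun s => c s = q).card : ℝ)⁻¹ := by
          refine Finset.sum_congr rfl fun i hi => ?_
          rw [(Finset.mem_filter.1 hi).2]
        rw [this, Finset.sum_const, nsmul_eq_mul]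
        exact mul_inv_le_one
    _ = _ := by simp

end Cells

/-! ### Good designs -/

section Design

variable {d : ℕ} {K : (Fin d → ℝ) → ℝ} {h : ℝ} {n : ℕ} {x : ℤ → Fin d → ℝ}

/-- The unnormalized density estimator at `x i`. -/
def kernelSum (K : (Fin d → ℝ) → ℝ) (h : ℝ) (n : ℕ) (x : ℤ → Fin d → ℝ) (i : ℤ) : ℝ :=
  ∑ s ∈ Finset.Icc (1 : ℤ) n, K (h⁻¹ • (x i - x s))

/-- The kernel weights along a path `x` of the covariates. -/
def kernelWeight (K : (Fin d → ℝ) → ℝ) (h : ℝ) (n : ℕ) (x : ℤ → Fin d → ℝ) (i t : ℤ) : ℝ :=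
  K (h⁻¹ • (x i - x t)) / kernelSum K h n x i

theorem kernelSum_nonneg (hK : IsKernel K) (i : ℤ) : 0 ≤ kernelSum K h n x i :=
  Finset.sum_nonneg fun _ _ => hK.nonneg _

theorem kernelWeight_nonneg (hK : IsKernel K) (i t : ℤ) : 0 ≤ kernelWeight K h n x i t :=
  div_nonneg (hK.nonneg _) (kernelSum_nonneg hK i)

theorem sum_kernelWeight_eq (i : ℤ) (hpos : 0 < kernelSum K h n x i) :
    ∑ t ∈ Finset.Icc (1 : ℤ) n, kernelWeight K h n x i t = 1 := by
  simp only [kernelWeight]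
  rw [← Finset.sum_div]
  exact div_self hpos.ne'

/-- The row sums of the weights are one, or zero if the denominator vanishes. -/
theorem sum_kernelWeight_le (hK : IsKernel K) (i : ℤ) :
    ∑ t ∈ Finset.Icc (1 : ℤ) n, kernelWeight K h n x i t ≤ 1 := by
  rcases (kernelSum_nonneg (h := h) (n := n) (x := x) hK i).eq_or_lt with h0 | h0
  · simp [kernelWeight, ← h0]
  · exact (sum_kernelWeight_eq i h0).le

theorem norm_sub_le_of_kernelWeight_ne_zero (hK : IsKernel K) (hh : 0 < h) {i t : ℤ}
    (hw : kernelWeight K h n x i t ≠ 0) : ‖x i - x t‖ ≤ h := by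
  have h1 : K (h⁻¹ • (x i - x t)) ≠ 0 := fun h0 => hw (by simp [kernelWeight, h0])
  have h2 := hK.norm_le_one h1
  rw [norm_smul, norm_inv, Real.norm_of_nonneg hh.le, inv_mul_le_iff₀ hh, mul_one] at h2
  exact h2

/-- Whether the covariate `x i` lies in `T`, as a real number. -/
def inside (T : Set (Fin d → ℝ)) (x : ℤ → Fin d → ℝ) (i : ℤ) : ℝ :=
  T.indicator (fun _ => (1 : ℝ)) (x i)

theorem inside_of_mem {T : Set (Fin d → ℝ)} {i : ℤ} (hi : x i ∈ T) : inside T x i = 1 :=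
  indicator_of_mem hi _

theorem inside_of_notMem {T : Set (Fin d → ℝ)} {i : ℤ} (hi : x i ∉ T) : inside T x i = 0 :=
  indicator_of_notMem hi _

theorem inside_nonneg (T : Set (Fin d → ℝ)) (i : ℤ) : 0 ≤ inside T x i := by
  by_cases hi : x i ∈ T
  · simp [inside_of_mem hi]
  · simp [inside_of_notMem hi]

theorem inside_le_one (T : Set (Fin d → ℝ)) (i : ℤ) : inside T x i ≤ 1 := by
  by_cases hi : x i ∈ T
  · simp [inside_of_mem hi]
  · simp [inside_of_notMem hi]

/-- A path of covariates for which the kernel weights behave well on the trimming region `T`: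
all denominators are positive, the column sums of the weight matrix are bounded, its squared
Frobenius norm is at most `C₂ / h ^ d`, and a fixed proportion of covariates lies in `T`.
The set `S` stands for the support of the covariates. -/
structure GoodDesign (K : (Fin d → ℝ) → ℝ) (T S : Set (Fin d → ℝ)) (C₁ C₂ c : ℝ) (h : ℝ) (n : ℕ)
    (x : ℤ → Fin d → ℝ) : Prop where
  mem_support : ∀ i ∈ Finset.Icc (1 : ℤ) n, x i ∈ S
  kernelSum_pos : ∀ i ∈ Finset.Icc (1 : ℤ) n, x i ∈ T → 0 < kernelSum K h n x i
  column_le : ∀ t ∈ Finset.Icc (1 : ℤ) n,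
    ∑ i ∈ Finset.Icc (1 : ℤ) n, inside T x i * kernelWeight K h n x i t ≤ C₁
  frobenius_le : ∑ i ∈ Finset.Icc (1 : ℤ) n,
    inside T x i * ∑ t ∈ Finset.Icc (1 : ℤ) n, kernelWeight K h n x i t ^ 2 ≤ C₂ / h ^ d
  le_count : c * n ≤ ∑ i ∈ Finset.Icc (1 : ℤ) n, inside T x i

open Classical in
/-- The number of covariates in `T` that share the cell of `x i`. -/
def cellCount (T : Set (Fin d → ℝ)) (r : ℝ) (n : ℕ) (x : ℤ → Fin d → ℝ) (i : ℤ) : ℝ :=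
  (((Finset.Icc (1 : ℤ) n).filter fun s => x s ∈ T).filter
    fun s => cell r (x s) = cell r (x i)).card

/-- If each denominator is at least of the order of the number of covariates in the same cell, the
column sums of the weights and their Frobenius norm are controlled by numbers of cells, whatever
the position of the covariates. -/
theorem goodDesign_of_cellCount (hK : IsKernel K) {Kmax : ℝ} (hKmax : 0 < Kmax)
    (hKle : ∀ z, K z ≤ Kmax) {lo hi : Fin d → ℝ} (hlohi : ∀ j, lo j < hi j) (hh : 0 < h)
    (hh1 : h ≤ 1) {ρ κ : ℝ} (hρ : 0 < ρ) (hκ : 0 < κ) {m : ℕ} (hm : 1 / ρ + 1 ≤ m)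
    {S : Set (Fin d → ℝ)} {c : ℝ} (hS : ∀ i ∈ Finset.Icc (1 : ℤ) n, x i ∈ S)
    (hcount : c * n ≤ ∑ i ∈ Finset.Icc (1 : ℤ) n, inside (Icc lo hi) x i)
    (hcell : ∀ i ∈ Finset.Icc (1 : ℤ) n, x i ∈ Icc lo hi →
      κ * cellCount (Icc lo hi) (ρ * h) n x i ≤ kernelSum K h n x i) :
    GoodDesign K (Icc lo hi) S (Kmax / κ * (2 * m + 1) ^ d)
      (Kmax / κ * ∏ j, ((hi j - lo j) / ρ + 2)) c h n x := by
  classical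
  set T := Icc lo hi
  set I := Finset.Icc (1 : ℤ) n
  set J := I.filter fun s => x s ∈ T
  set N : ℤ → ℝ := cellCount T (ρ * h) n x
  have hNeq : ∀ i, N i = ((J.filter fun s => cell (ρ * h) (x s) = cell (ρ * h) (x i)).card : ℝ) :=
    fun i => by simp only [N, cellCount, J, I]; congr!
  have hNpos : ∀ i ∈ J, 0 < N i := fun i hi => by
    rw [hNeq]
    exact Nat.cast_pos.2 (Finset.card_pos.2
      ⟨i, Finset.mem_filter.2 ⟨hi, (rfl : cell (ρ * h) (x i) = _)⟩⟩)
  have hpos : ∀ i ∈ J, 0 < kernelSum K h n x i := fun i hi =>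
    (mul_pos hκ (hNpos i hi)).trans_le
      (hcell i (Finset.mem_filter.1 hi).1 (Finset.mem_filter.1 hi).2)
  have hinv : ∀ i ∈ J, (kernelSum K h n x i)⁻¹ ≤ κ⁻¹ * (N i)⁻¹ := fun i hi => by
    rw [← mul_inv]
    exact inv_anti₀ (mul_pos hκ (hNpos i hi))
      (hcell i (Finset.mem_filter.1 hi).1 (Finset.mem_filter.1 hi).2)
  have hsum : ∀ F : ℤ → ℝ, ∑ i ∈ I, inside T x i * F i = ∑ i ∈ J, F i := fun F => by
    rw [Finset.sum_filter]
    refine Finset.sum_congr rfl fun i _ => ?_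
    by_cases hi : x i ∈ T
    · simp [inside_of_mem hi, hi]
    · simp [inside_of_notMem hi, hi]
  refine ⟨hS, fun i hi hiT => hpos i (Finset.mem_filter.2 ⟨hi, hiT⟩), fun t ht => ?_, ?_, hcount⟩
  · rw [hsum]
    set J' := J.filter fun i => ‖x i - x t‖ ≤ h
    calc ∑ i ∈ J, kernelWeight K h n x i t = ∑ i ∈ J', kernelWeight K h n x i t := by
          exact (Finset.sum_filter_of_ne fun i _ hne =>
            norm_sub_le_of_kernelWeight_ne_zero hK hh hne).symm
      _ ≤ ∑ i ∈ J', Kmax / κ *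
          ((J'.filter fun s => cell (ρ * h) (x s) = cell (ρ * h) (x i)).card : ℝ)⁻¹ := by
          refine Finset.sum_le_sum fun i hi => ?_
          have hiJ := (Finset.mem_filter.1 hi).1
          have h1 : kernelWeight K h n x i t ≤ Kmax * (κ⁻¹ * (N i)⁻¹) := by
            rw [kernelWeight, div_eq_mul_inv]
            exact mul_le_mul (hKle _) (hinv i hiJ) (inv_nonneg.2 (hpos i hiJ).le) hKmax.le
          refine h1.trans ?_
          rw [div_eq_mul_inv, mul_assoc, hNeq]
          gcongr
          · exact Nat.cast_pos.2 (Finset.card_pos.2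
              ⟨i, Finset.mem_filter.2 ⟨hi, (rfl : cell (ρ * h) (x i) = _)⟩⟩)
          · exact Finset.filter_subset _ _
      _ ≤ Kmax / κ * (nearCells m (cell (ρ * h) (x t))).card := by
          rw [← Finset.mul_sum]
          gcongr
          exact sum_inv_card_fiber_le J' (fun i => cell (ρ * h) (x i)) _ fun i hi =>
            cell_mem_nearCells hρ hh hm (Finset.mem_filter.1 hi).2
      _ = _ := by rw [card_nearCells]; push_cast; ring
  · rw [hsum]
    calc ∑ i ∈ J, ∑ t ∈ I, kernelWeight K h n x i t ^ 2 ≤ ∑ i ∈ J, Kmax / κ * (N i)⁻¹ := by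
          refine Finset.sum_le_sum fun i hi => ?_
          calc ∑ t ∈ I, kernelWeight K h n x i t ^ 2
              ≤ ∑ t ∈ I, (Kmax * (κ⁻¹ * (N i)⁻¹)) * kernelWeight K h n x i t := by
                refine Finset.sum_le_sum fun t _ => ?_
                rw [sq]
                refine mul_le_mul_of_nonneg_right ?_ (kernelWeight_nonneg hK i t)
                rw [kernelWeight, div_eq_mul_inv]
                exact mul_le_mul (hKle _) (hinv i hi) (inv_nonneg.2 (hpos i hi).le) hKmax.le
            _ ≤ (Kmax * (κ⁻¹ * (N i)⁻¹)) * 1 := by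
                rw [← Finset.mul_sum]
                have := (hNpos i hi).le
                gcongr
                exact sum_kernelWeight_le hK i
            _ = _ := by rw [div_eq_mul_inv]; ring
      _ ≤ Kmax / κ * (boxCells (ρ * h) lo hi).card := by
          rw [← Finset.mul_sum]
          gcongr
          simp only [hNeq]
          exact sum_inv_card_fiber_le J (fun i => cell (ρ * h) (x i)) _ fun i hi =>
            cell_mem_boxCells (by positivity) (Finset.mem_filter.1 hi).2
      _ ≤ _ := by
          rw [mul_div_assoc]
          gcongr
          exact card_boxCells_le hρ hlohi hh hh1

/-- If the kernel is positive at the origin, a covariate receives a substantial weight from all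
covariates in its cell. -/
theorem cellCount_le_kernelSum (hK : IsKernel K) (hh : 0 < h) {ρ κ : ℝ} (hρ : 0 < ρ)
    (hball : ∀ w, ‖w‖ ≤ ρ → κ ≤ K w) (T : Set (Fin d → ℝ)) (i : ℤ) :
    κ * cellCount T (ρ * h) n x i ≤ kernelSum K h n x i := by
  classical
  rw [cellCount, kernelSum, mul_comm, ← nsmul_eq_mul, ← Finset.sum_const]
  refine (Finset.sum_le_sum fun s hs => ?_).trans
    (Finset.sum_le_sum_of_subset_of_nonneg
      ((Finset.filter_subset _ _).trans (Finset.filter_subset _ _)) fun s _ _ => hK.nonneg _)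
  refine hball _ ?_
  rw [norm_smul, norm_inv, Real.norm_of_nonneg hh.le, inv_mul_le_iff₀ hh, mul_comm]
  exact norm_sub_le_of_cell_eq (by positivity) (Finset.mem_filter.1 hs).2.symm

theorem measurable_kernelSum (hK : IsKernel K) (i : ℤ) :
    Measurable fun x : ℤ → Fin d → ℝ => kernelSum K h n x i :=
  Finset.measurable_fun_sum _ fun s _ => hK.measurable.comp (by fun_prop)

theorem measurable_kernelWeight (hK : IsKernel K) (i t : ℤ) :
    Measurable fun x : ℤ → Fin d → ℝ => kernelWeight K h n x i t :=
  (hK.measurable.comp (by fun_prop)).div (measurable_kernelSum hK i)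

theorem measurable_inside {T : Set (Fin d → ℝ)} (hT : MeasurableSet T) (i : ℤ) :
    Measurable fun x : ℤ → Fin d → ℝ => inside T x i :=
  (measurable_const.indicator hT).comp (measurable_pi_apply i)

theorem measurableSet_goodDesign (hK : IsKernel K) {T S : Set (Fin d → ℝ)} (hT : MeasurableSet T)
    (hS : MeasurableSet S) (C₁ C₂ c : ℝ) :
    MeasurableSet {x : ℤ → Fin d → ℝ | GoodDesign K T S C₁ C₂ c h n x} := by
  have hin := fun i => measurable_inside hT i
  have hw := fun i t => measurable_kernelWeight (h := h) (n := n) hK i t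
  have : {x : ℤ → Fin d → ℝ | GoodDesign K T S C₁ C₂ c h n x} =
      (⋂ i ∈ Finset.Icc (1 : ℤ) n, {x | x i ∈ S}) ∩
      ((⋂ i ∈ Finset.Icc (1 : ℤ) n, ({x | x i ∈ T}ᶜ ∪ {x | 0 < kernelSum K h n x i})) ∩
      ((⋂ t ∈ Finset.Icc (1 : ℤ) n,
        {x | ∑ i ∈ Finset.Icc (1 : ℤ) n, inside T x i * kernelWeight K h n x i t ≤ C₁}) ∩
      ({x | ∑ i ∈ Finset.Icc (1 : ℤ) n,
        inside T x i * ∑ t ∈ Finset.Icc (1 : ℤ) n, kernelWeight K h n x i t ^ 2 ≤ C₂ / h ^ d} ∩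
      {x | c * n ≤ ∑ i ∈ Finset.Icc (1 : ℤ) n, inside T x i}))) := by
    ext x
    simp only [mem_inter_iff, mem_iInter, mem_ofPred_eq, mem_union, mem_compl_iff]
    constructor
    · intro hx
      exact ⟨hx.1, fun i hi => not_or_of_imp (hx.2 i hi), hx.3, hx.4, hx.5⟩
    · rintro ⟨h1, h2, h3, h4, h5⟩
      exact ⟨h1, fun i hi hT => (h2 i hi).resolve_left fun h => h hT, h3, h4, h5⟩
  rw [this]
  refine .inter (Finset.measurableSet_biInter _ fun i _ => measurable_pi_apply i hS) (.inter
    (Finset.measurableSet_biInter _ fun i _ => (measurable_pi_apply i hT).compl.union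
      (measurableSet_lt measurable_const (measurable_kernelSum hK i))) (.inter
    (Finset.measurableSet_biInter _ fun t _ => measurableSet_le ?_ measurable_const)
    (.inter (measurableSet_le ?_ measurable_const) (measurableSet_le measurable_const ?_))))
  · exact Finset.measurable_fun_sum _ fun i _ => (hin i).mul (hw i t)
  · exact Finset.measurable_fun_sum _ fun i _ => (hin i).mul
      (Finset.measurable_fun_sum _ fun t _ => (hw i t).pow_const 2)
  · exact Finset.measurable_fun_sum _ fun i _ => hin i

end Design

/-! ### Good designs have high probability -/

section DesignProbability

variable {d : ℕ} {K : (Fin d → ℝ) → ℝ}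

theorem sum_Icc_one_eq_sum_range (n : ℕ) (F : ℤ → ℝ) :
    ∑ s ∈ Finset.Icc (1 : ℤ) n, F s = ∑ s ∈ Finset.range n, F (s + 1) := by
  refine (Finset.sum_nbij' (fun s : ℕ => (s : ℤ) + 1) (fun s : ℤ => (s - 1).toNat) ?_ ?_ ?_ ?_ ?_).symm
  · intro s hs
    have := Finset.mem_range.1 hs
    rw [Finset.mem_Icc]; omega
  · intro s hs
    have := Finset.mem_Icc.1 hs
    rw [Finset.mem_range]; omega
  · intro s _; simp
  · intro s hs
    have := Finset.mem_Icc.1 hs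
    omega
  · intro s _; rfl

theorem card_Icc_one (n : ℕ) : (Finset.Icc (1 : ℤ) n).card = n := by
  rw [Int.card_Icc]; omega

/-- Near every point `x₀` of a box there is a ball inside the box whose points receive substantial
weight at the points close to `x₀`, even if the kernel vanishes at the origin. -/
theorem exists_ball_in_box {lo hi : Fin d → ℝ} {r κ : ℝ}
    (horth : ∀ σ : Fin d → Bool, ∃ z : Fin d → ℝ, ∀ w, ‖w - z‖ ≤ 2 * r → κ ≤ K w ∧
      ∀ j, (σ j = true → 0 ≤ w j ∧ w j ≤ 1) ∧ (σ j = false → -1 ≤ w j ∧ w j ≤ 0))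
    (hr : 0 < r) {h : ℝ} (hh : 0 < h) (hsmall : ∀ j, 2 * h ≤ hi j - lo j) {x₀ : Fin d → ℝ}
    (hx₀ : x₀ ∈ Icc lo hi) :
    ∃ y₀ : Fin d → ℝ, Metric.closedBall y₀ (r * h) ⊆ Icc lo hi ∧
      ∀ y, ‖y - x₀‖ ≤ r * h → ∀ y' ∈ Metric.closedBall y₀ (r * h), κ ≤ K (h⁻¹ • (y - y')) := by
  obtain ⟨z, hz⟩ := horth fun j => decide ((lo j + hi j) / 2 ≤ x₀ j)
  have hinv : ∀ y' ∈ Metric.closedBall (x₀ - h • z) (r * h), ‖h⁻¹ • (x₀ - y') - z‖ ≤ r := by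
    intro y' hy'
    rw [mem_closedBall_iff_norm'] at hy'
    have : h⁻¹ • (x₀ - y') - z = h⁻¹ • (x₀ - h • z - y') := by
      rw [sub_right_comm, smul_sub h⁻¹ (x₀ - y'), inv_smul_smul₀ hh.ne']
    rw [this, norm_smul, norm_inv, Real.norm_of_nonneg hh.le, inv_mul_le_iff₀ hh, mul_comm]
    exact hy'
  refine ⟨x₀ - h • z, fun y' hy' => ?_, fun y hy y' hy' => ?_⟩
  · have h1 := (hz _ ((hinv y' hy').trans (by linarith))).2
    have h2 : ∀ j, lo j ≤ y' j ∧ y' j ≤ hi j := fun j => by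
      have h3 := h1 j
      have h4 : y' j = x₀ j - h * (h⁻¹ • (x₀ - y')) j := by
        simp only [Pi.smul_apply, Pi.sub_apply, smul_eq_mul]
        field_simp
        ring
      set w := (h⁻¹ • (x₀ - y')) j
      have hs := hsmall j
      have hl := hx₀.1 j
      have hu := hx₀.2 j
      by_cases hσ : (lo j + hi j) / 2 ≤ x₀ j
      · obtain ⟨h5, h6⟩ := h3.1 (decide_eq_true hσ)
        rw [h4]
        constructor <;> nlinarith
      · obtain ⟨h5, h6⟩ := h3.2 (decide_eq_false hσ)
        rw [h4]
        push Not at hσ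
        constructor <;> nlinarith
    exact ⟨fun j => (h2 j).1, fun j => (h2 j).2⟩
  · refine (hz _ ?_).1
    have h1 : h⁻¹ • (y - y') - z = h⁻¹ • (y - x₀) + (h⁻¹ • (x₀ - y') - z) := by
      rw [← sub_add_sub_cancel y x₀ y', smul_add]; abel
    have h2 : ‖h⁻¹ • (y - x₀)‖ ≤ r := by
      rw [norm_smul, norm_inv, Real.norm_of_nonneg hh.le, inv_mul_le_iff₀ hh, mul_comm]
      exact hy
    rw [h1]
    refine (norm_add_le _ _).trans ?_
    have := hinv y' hy'
    linarith

namespace PLModel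

variable {Ω : Type*} [MeasurableSpace Ω] {P : Measure Ω} [IsProbabilityMeasure P] {d' l : ℕ}
  {M : PLModel Ω d d' l}

theorem count_eq_sum_Icc (R : Set (Fin d → ℝ)) (n : ℕ) (ω : Ω) :
    M.count R n ω = ∑ i ∈ Finset.Icc (1 : ℤ) n, inside R (fun i => M.X i ω) i := by
  rw [sum_Icc_one_eq_sum_range]
  rfl

theorem tendsto_inverse_bandwidth {h : ℕ → ℝ} (hh : IsBandwidth d h) (C : ℝ) :
    Tendsto (fun n : ℕ => C / (h n ^ d * n)) atTop (𝓝 0) :=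
  hh.tendsto_atTop.const_div_atTop C

variable {G : (Fin d → ℝ) → (ℕ → (Fin d' → ℝ)) → ℝ} {g : (Fin d → ℝ) → ℝ}

theorem volume_real_closedBall (y : Fin d → ℝ) {r : ℝ} (hr : 0 ≤ r) :
    volume.real (Metric.closedBall y r) = (2 * r) ^ d := by
  rw [Measure.real, Real.volume_pi_closedBall _ hr, ENNReal.toReal_ofReal (by positivity)]
  simp

/-- With high probability every denominator is at least of the order of the number of covariates
in the same cell. If the kernel vanishes at the origin, this is where the condition
`log n / (h ^ d * n) → 0` is needed: the counts of all cells have to concentrate at once. -/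
theorem exists_cellCount_le (hM : M.Standing P) (hG : M.IsCondDensity P G) (hg : M.IsDensity P g)
    {lo hi : Fin d → ℝ} (hlohi : ∀ j, lo j < hi j) {s ξ : ℝ}
    (hcov : M.CovariateDependence P G (Icc lo hi) s ξ) (hdens : DensityRegular g lo hi)
    (hK : IsKernel K) {h : ℕ → ℝ} (hh : IsBandwidth d h)
    (hdef : 0 < K 0 ∨ Tendsto (fun n : ℕ => Real.log n / (h n ^ d * n)) atTop (𝓝 0)) :
    ∃ ρ κ : ℝ, 0 < ρ ∧ 0 < κ ∧ ∀ ε > 0, ∀ᶠ n : ℕ in atTop,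
      P.real {ω | ∃ i ∈ Finset.Icc (1 : ℤ) n, M.X i ω ∈ Icc lo hi ∧
        kernelSum K (h n) n (fun i => M.X i ω) i <
          κ * cellCount (Icc lo hi) (ρ * h n) n (fun i => M.X i ω) i} ≤ ε := by
  rcases hdef with h0 | hlog
  · obtain ⟨ρ, κ, hρ, hκ, hball⟩ := hK.exists_ball_zero h0
    refine ⟨ρ, κ, hρ, hκ, fun ε hε => Eventually.of_forall fun n => ?_⟩
    have : {ω | ∃ i ∈ Finset.Icc (1 : ℤ) n, M.X i ω ∈ Icc lo hi ∧
        kernelSum K (h n) n (fun i => M.X i ω) i <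
          κ * cellCount (Icc lo hi) (ρ * h n) n (fun i => M.X i ω) i} = ∅ := by
      rw [eq_empty_iff_forall_notMem]
      rintro ω ⟨i, _, _, hlt⟩
      exact absurd (cellCount_le_kernelSum hK (hh.pos n) hρ hball _ i) (not_le.2 hlt)
    rw [this]
    simpa using hε.le
  classical
  obtain ⟨c, c', hc, hgT⟩ := hdens.bounds
  have hlo : lo ∈ Icc lo hi := ⟨le_rfl, fun j => (hlohi j).le⟩
  have hcc' : c ≤ c' := (hgT lo hlo).1.trans (hgT lo hlo).2
  have hc' : 0 < c' := hc.trans_le hcc'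
  obtain ⟨B, hB, hconc⟩ := exists_count_concentration hM hG hg hcov hc hcc' hgT
  obtain ⟨r, κ, hr, hκ, horth⟩ := hK.exists_ball_orthant
  refine ⟨r, κ * c / (48 * c'), hr, by positivity, fun ε hε => ?_⟩
  set γ : ℝ := c / 8 * (2 * r) ^ d
  have hγ : 0 < γ := by positivity
  set D : ℝ := ∏ j, ((hi j - lo j) / r + 2)
  have hD : 0 ≤ D := Finset.prod_nonneg fun j _ => by
    have := (hlohi j).le
    have : 0 ≤ (hi j - lo j) / r := div_nonneg (by linarith) hr.le
    linarith
  have hsmall : ∀ᶠ n in atTop, ∀ j, 2 * h n ≤ hi j - lo j := by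
    rw [eventually_all]
    intro j
    have : Tendsto (fun n => 2 * h n) atTop (𝓝 (2 * 0)) := hh.tendsto_zero.const_mul 2
    rw [mul_zero] at this
    exact this.eventually_le_const (sub_pos.2 (hlohi j))
  filter_upwards [hsmall, hh.tendsto_zero.eventually_le_const one_pos, eventually_ge_atTop 1,
    hlog.eventually_le_const hγ,
    (tendsto_inverse_bandwidth hh (D * (2 * (B + 1)))).eventually_le_const hε]
    with n hn1 hn2 hn3 hn4 hn5
  have hhn := hh.pos n
  have hn0 : (0 : ℝ) < n := by exact_mod_cast hn3
  have ha : 0 < h n ^ d * n := by positivity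
  set V : ℝ := (2 * (r * h n)) ^ d
  have hV : 0 < V := by positivity
  have hγV : c / 8 * (n * V) = γ * (h n ^ d * n) := by
    simp only [V, γ, mul_pow]; ring
  -- a base point in every cell that meets the box
  have hbase : ∀ q : Fin d → ℤ, ∃ x₀ ∈ Icc lo hi,
      (∃ y ∈ Icc lo hi, cell (r * h n) y = q) → cell (r * h n) x₀ = q := fun q => by
    by_cases hq : ∃ y ∈ Icc lo hi, cell (r * h n) y = q
    · obtain ⟨y, hy, hyq⟩ := hq
      exact ⟨y, hy, fun _ => hyq⟩
    · exact ⟨lo, hlo, fun h => absurd h hq⟩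
  choose x₀ hx₀ hx₀cell using hbase
  choose y₀ hy₀ hKy₀ using fun q => exists_ball_in_box horth hr hhn hn1 (hx₀ q)
  -- the covariates in `R q` contribute to the denominators at all points of the cell `q`, while
  -- `Q q` contains the part of that cell in the box
  set R : (Fin d → ℤ) → Set (Fin d → ℝ) := fun q => Metric.closedBall (y₀ q) (r * h n)
  set Q : (Fin d → ℤ) → Set (Fin d → ℝ) := fun q => Icc lo hi ∩ Metric.closedBall (x₀ q) (r * h n)
  have hRm : ∀ q, MeasurableSet (R q) := fun q => Metric.isClosed_closedBall.measurableSet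
  have hQm : ∀ q, MeasurableSet (Q q) := fun q =>
    measurableSet_Icc.inter Metric.isClosed_closedBall.measurableSet
  have hRV : ∀ q, volume.real (R q) = V := fun q => volume_real_closedBall _ (by positivity)
  have hfin : ∀ y : Fin d → ℝ, volume (Metric.closedBall y (r * h n)) ≠ ∞ := fun y =>
    measure_closedBall_lt_top.ne
  have hQV : ∀ q, volume.real (Q q) ≤ V := fun q =>
    (measureReal_mono inter_subset_right (hfin _)).trans_eq
      (volume_real_closedBall _ (by positivity))
  set bad : (Fin d → ℤ) → Set Ω := fun q => {ω | M.count (R q) n ω ≤ c / 8 * (n * V)} ∪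
    {ω | 6 * c' * (n * V) ≤ M.count (Q q) n ω}
  have hexp : Real.exp (-(c / 8 * (n * V))) ≤ 1 / n := by
    rw [hγV, one_div, ← Real.exp_log hn0, ← Real.exp_neg, Real.exp_le_exp, Real.exp_log hn0]
    rw [div_le_iff₀ ha] at hn4
    linarith
  have hbad : ∀ q, P.real (bad q) ≤ 2 * (B + 1) / n := fun q => by
    have h1 := (hconc (R q) (hy₀ q) (hRm q) (hfin _) V hV (hRV q).le n hn3).1 (hRV q)
    have h2 := (hconc (Q q) inter_subset_left (hQm q)
      (measure_ne_top_of_subset inter_subset_right (hfin _)) V hV (hQV q) n hn3).2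
    refine (measureReal_union_le _ _).trans ((add_le_add h1 h2).trans ?_)
    have e : 2 * (B + 1) / n = (B / n + 1 / n) + (B / n + 1 / n) := by ring
    rw [e]
    gcongr
  have hsub : {ω | ∃ i ∈ Finset.Icc (1 : ℤ) n, M.X i ω ∈ Icc lo hi ∧
        kernelSum K (h n) n (fun i => M.X i ω) i <
          κ * c / (48 * c') * cellCount (Icc lo hi) (r * h n) n (fun i => M.X i ω) i} ⊆
      ⋃ q ∈ boxCells (r * h n) lo hi, bad q := by
    rintro ω ⟨i, -, hiT, hlt⟩
    rw [mem_iUnion₂]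
    refine ⟨cell (r * h n) (M.X i ω), cell_mem_boxCells (by positivity) hiT, ?_⟩
    set q := cell (r * h n) (M.X i ω) with hq
    by_contra hnot
    simp only [bad, mem_union, mem_ofPred_eq, not_or, not_le] at hnot
    obtain ⟨hn6, hn7⟩ := hnot
    have hcellq : cell (r * h n) (x₀ q) = q := hx₀cell q ⟨_, hiT, hq.symm⟩
    have hclose : ∀ y, cell (r * h n) y = q → ‖y - x₀ q‖ ≤ r * h n := fun y hy =>
      norm_sub_le_of_cell_eq (by positivity) (hy.trans hcellq.symm)
    have hlow : κ * M.count (R q) n ω ≤ kernelSum K (h n) n (fun i => M.X i ω) i := by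
      rw [count_eq_sum_Icc, kernelSum, Finset.mul_sum]
      refine Finset.sum_le_sum fun t _ => ?_
      by_cases ht : M.X t ω ∈ R q
      · rw [inside_of_mem (x := fun i => M.X i ω) ht, mul_one]
        exact hKy₀ q _ (hclose _ hq.symm) _ ht
      · rw [inside_of_notMem (x := fun i => M.X i ω) ht, mul_zero]
        exact hK.nonneg _
    have hup : cellCount (Icc lo hi) (r * h n) n (fun i => M.X i ω) i ≤ M.count (Q q) n ω := by
      rw [count_eq_sum_Icc, cellCount, Finset.filter_filter, Finset.card_filter, Nat.cast_sum]
      refine Finset.sum_le_sum fun t _ => ?_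
      split_ifs with ht
      · have : M.X t ω ∈ Q q := ⟨ht.1, by
          rw [mem_closedBall_iff_norm]
          exact hclose _ ht.2⟩
        rw [inside_of_mem (x := fun i => M.X i ω) this, Nat.cast_one]
      · rw [Nat.cast_zero]
        exact inside_nonneg _ _
    have h1 : κ * c / (48 * c') * cellCount (Icc lo hi) (r * h n) n (fun i => M.X i ω) i ≤
        κ * c / (48 * c') * (6 * c' * (n * V)) := by
      gcongr
      exact hup.trans hn7.le
    have h2 : κ * c / (48 * c') * (6 * c' * (n * V)) = κ * (c / 8 * (n * V)) := by
      field_simp; ring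
    have h3 : κ * (c / 8 * (n * V)) ≤ κ * M.count (R q) n ω := by gcongr
    linarith
  calc _ ≤ P.real (⋃ q ∈ boxCells (r * h n) lo hi, bad q) :=
        measureReal_mono hsub (measure_ne_top _ _)
    _ ≤ ∑ q ∈ boxCells (r * h n) lo hi, P.real (bad q) := measureReal_biUnion_finset_le _ _
    _ ≤ (boxCells (r * h n) lo hi).card * (2 * (B + 1) / n) := by
        rw [← nsmul_eq_mul]
        exact Finset.sum_le_card_nsmul _ _ _ fun q _ => hbad q
    _ ≤ D / h n ^ d * (2 * (B + 1) / n) := by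
        gcongr
        exact card_boxCells_le hr hlohi hhn hn2
    _ = D * (2 * (B + 1)) / (h n ^ d * n) := by field_simp
    _ ≤ ε := hn5

/-- With probability tending to one, the covariates form a good design. -/
theorem exists_goodDesign (hM : M.Standing P) (hG : M.IsCondDensity P G) (hg : M.IsDensity P g)
    {lo hi : Fin d → ℝ} (hlohi : ∀ j, lo j < hi j) {s ξ : ℝ}
    (hcov : M.CovariateDependence P G (Icc lo hi) s ξ) (hdens : DensityRegular g lo hi)
    (hK : IsKernel K) {h : ℕ → ℝ} (hh : IsBandwidth d h)
    (hdef : 0 < K 0 ∨ Tendsto (fun n : ℕ => Real.log n / (h n ^ d * n)) atTop (𝓝 0)) :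
    ∃ C₁ C₂ c : ℝ, 0 ≤ C₁ ∧ 0 ≤ C₂ ∧ 0 < c ∧ ∀ ε > 0, ∀ᶠ n : ℕ in atTop,
      P.real {ω | ¬ GoodDesign K (Icc lo hi) (P.map (M.X 0)).support C₁ C₂ c (h n) n
        (fun i => M.X i ω)} ≤ ε := by
  obtain ⟨ρ, κ, hρ, hκ, hcell⟩ := exists_cellCount_le hM hG hg hlohi hcov hdens hK hh hdef
  obtain ⟨Kmax, hKmax, hKle⟩ := hK.exists_bound
  obtain ⟨m, hm⟩ := exists_nat_ge (1 / ρ + 1)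
  obtain ⟨c, c', hc, hgT⟩ := hdens.bounds
  have hlo : lo ∈ Icc lo hi := ⟨le_rfl, fun j => (hlohi j).le⟩
  have hcc' : c ≤ c' := (hgT lo hlo).1.trans (hgT lo hlo).2
  obtain ⟨B, hB, hconc⟩ := exists_count_concentration hM hG hg hcov hc hcc' hgT
  set V := volume.real (Icc lo hi)
  have hfin : volume (Icc lo hi) ≠ ∞ := isCompact_Icc.measure_lt_top.ne
  have hV : 0 < V := by
    simp only [V, Measure.real, Real.volume_Icc_pi]
    rw [ENNReal.toReal_prod]
    refine Finset.prod_pos fun j _ => ?_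
    rw [ENNReal.toReal_ofReal (sub_nonneg.2 (hlohi j).le)]
    exact sub_pos.2 (hlohi j)
  refine ⟨Kmax / κ * (2 * m + 1) ^ d, Kmax / κ * ∏ j, ((hi j - lo j) / ρ + 2), c / 8 * V,
    by positivity, ?_, by positivity, fun ε hε => ?_⟩
  · refine mul_nonneg (by positivity) (Finset.prod_nonneg fun j _ => ?_)
    have := (hlohi j).le
    have : 0 ≤ (hi j - lo j) / ρ := div_nonneg (by linarith) hρ.le
    linarith
  have hsupp : P.real {ω | ∃ i : ℤ, M.X i ω ∉ (P.map (M.X 0)).support} = 0 := by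
    have h1 : ∀ i : ℤ, ∀ᵐ ω ∂P, M.X i ω ∈ (P.map (M.X 0)).support := fun i => by
      have h2 : (P.map (M.X 0)).support ∈ ae (P.map (M.X i)) := by
        rw [hg.law i, ← hg.law 0]
        exact Measure.support_mem_ae
      exact ae_of_ae_map (hM.measurable_X i).aemeasurable h2
    have h3 := ae_all_iff.2 h1
    rw [ae_iff] at h3
    rw [Measure.real]
    simp only [not_forall] at h3
    rw [h3]
    rfl
  have hlim : Tendsto (fun n : ℕ => B / n + Real.exp (-(c / 8 * (n * V)))) atTop (𝓝 (0 + 0)) := by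
    refine Tendsto.add (tendsto_const_div_atTop_nhds_zero_nat B) ?_
    refine Real.tendsto_exp_neg_atTop_nhds_zero.comp ?_
    refine Tendsto.const_mul_atTop (by positivity) ?_
    exact tendsto_natCast_atTop_atTop.atTop_mul_const hV
  rw [add_zero] at hlim
  filter_upwards [hcell (ε / 2) (half_pos hε), hlim.eventually_le_const (half_pos hε),
    eventually_ge_atTop 1, hh.tendsto_zero.eventually_le_const one_pos] with n hn1 hn2 hn3 hn4
  have hcount := (hconc (Icc lo hi) le_rfl measurableSet_Icc hfin V hV le_rfl n hn3).1 rfl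
  calc _ ≤ P.real ({ω | ∃ i ∈ Finset.Icc (1 : ℤ) n, M.X i ω ∈ Icc lo hi ∧
        kernelSum K (h n) n (fun i => M.X i ω) i <
          κ * cellCount (Icc lo hi) (ρ * h n) n (fun i => M.X i ω) i} ∪
        ({ω | M.count (Icc lo hi) n ω ≤ c / 8 * (n * V)} ∪
        {ω | ∃ i : ℤ, M.X i ω ∉ (P.map (M.X 0)).support})) := by
        refine measureReal_mono fun ω hω => ?_
        by_contra hnot
        simp only [mem_union, not_or, mem_ofPred_eq, not_exists, not_and, not_lt, not_le,
          not_not] at hnot hω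
        obtain ⟨h1, h2, h3⟩ := hnot
        refine hω (goodDesign_of_cellCount hK hKmax hKle hlohi (hh.pos n) hn4 hρ hκ hm
          (fun i _ => h3 i) ?_ h1)
        rw [← count_eq_sum_Icc]
        linarith
    _ ≤ ε / 2 + (ε / 2 + 0) := by
        refine (measureReal_union_le _ _).trans (add_le_add hn1 ?_)
        refine (measureReal_union_le _ _).trans (add_le_add (hcount.trans hn2) hsupp.le)
    _ = ε := by ring

end PLModel
end DesignProbability

/-! ### Linear forms with random coefficients -/

section RandomCoefficients

variable {Ω 𝒳 : Type*} [MeasurableSpace Ω] [MeasurableSpace 𝒳] {P : Measure Ω}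
  [IsProbabilityMeasure P] {W : ℤ → Ω → ℝ} {Γ : ℝ≥0∞}

omit [IsProbabilityMeasure P] in
theorem BoundedLinearForms.lintegral_sq_le (h : BoundedLinearForms P W Γ) (t : ℤ) :
    ∫⁻ ω, ENNReal.ofReal (W t ω ^ 2) ∂P ≤ Γ := by
  simpa using h {t} fun _ => 1

/-- The bound for linear forms persists if the coefficients are random but independent of the
process: condition on them. -/
theorem BoundedLinearForms.random_coefficients (h : BoundedLinearForms P W Γ)
    (hW : ∀ t, Measurable (W t)) {X : Ω → 𝒳} (hX : Measurable X)
    (hind : IndepFun X (fun ω t => W t ω) P) {c : ℤ → 𝒳 → ℝ} (hc : ∀ t, Measurable (c t))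
    (I : Finset ℤ) :
    ∫⁻ ω, ENNReal.ofReal ((∑ t ∈ I, c t (X ω) * W t ω) ^ 2) ∂P ≤
      Γ * ∫⁻ ω, ENNReal.ofReal (∑ t ∈ I, c t (X ω) ^ 2) ∂P := by
  have hWm : Measurable fun ω t => W t ω := measurable_pi_lambda _ hW
  have hF : Measurable fun z : 𝒳 × (ℤ → ℝ) =>
      ENNReal.ofReal ((∑ t ∈ I, c t z.1 * z.2 t) ^ 2) := by
    refine ((Finset.measurable_fun_sum _ fun t _ => ?_).pow_const 2).ennreal_ofReal
    exact ((hc t).comp measurable_fst).mul ((measurable_pi_apply t).comp measurable_snd)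
  have hC : Measurable fun x : 𝒳 => ENNReal.ofReal (∑ t ∈ I, c t x ^ 2) :=
    (Finset.measurable_fun_sum _ fun t _ => (hc t).pow_const 2).ennreal_ofReal
  have : IsProbabilityMeasure (P.map fun ω t => W t ω) :=
    Measure.isProbabilityMeasure_map hWm.aemeasurable
  calc _ = ∫⁻ z, ENNReal.ofReal ((∑ t ∈ I, c t z.1 * z.2 t) ^ 2)
        ∂(P.map fun ω => (X ω, fun t => W t ω)) := (lintegral_map hF (hX.prodMk hWm)).symm
    _ = ∫⁻ x, (∫⁻ y, ENNReal.ofReal ((∑ t ∈ I, c t x * y t) ^ 2) ∂(P.map fun ω t => W t ω))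
        ∂(P.map X) := by
        rw [(indepFun_iff_map_prod_eq_prod_map_map hX.aemeasurable hWm.aemeasurable).1 hind,
          lintegral_prod _ hF.aemeasurable]
    _ ≤ ∫⁻ x, Γ * ENNReal.ofReal (∑ t ∈ I, c t x ^ 2) ∂(P.map X) := by
        refine lintegral_mono fun x => ?_
        have hx : Measurable fun y : ℤ → ℝ => ENNReal.ofReal ((∑ t ∈ I, c t x * y t) ^ 2) :=
          ((Finset.measurable_fun_sum _ fun t _ => by fun_prop).pow_const 2).ennreal_ofReal
        refine (lintegral_map hx hWm).trans_le ?_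
        exact h I fun t => c t x
    _ = _ := by rw [lintegral_const_mul _ hC, lintegral_map hC hX]

end RandomCoefficients

/-! ### The noise and the errors as short memory processes -/

namespace PLModel

variable {Ω : Type*} [MeasurableSpace Ω] {P : Measure Ω} [IsProbabilityMeasure P] {d d' l : ℕ}
  {M : PLModel Ω d d' l}

omit [IsProbabilityMeasure P] in
theorem Standing.measurable_u (hM : M.Standing P) (t : ℤ) : Measurable (M.u t) :=
  hM.measurable_f.comp (measurable_past hM.iid_e.measurable t)

omit [IsProbabilityMeasure P] in
theorem Standing.measurable_ε (hM : M.Standing P) (t : ℤ) : Measurable (M.ε t) :=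
  Measurable.tsum fun k => (hM.iid_η.measurable (t - k)).const_mul (M.a k)

theorem Standing.measurable_X_process (hM : M.Standing P) : Measurable fun ω t => M.X t ω :=
  measurable_pi_lambda _ hM.measurable_X

omit [IsProbabilityMeasure P] in
theorem Standing.measurable_u_process (hM : M.Standing P) : Measurable fun ω t => M.u t ω :=
  measurable_pi_lambda _ hM.measurable_u

omit [IsProbabilityMeasure P] in
theorem Standing.indepFun_X_u (hM : M.Standing P) :
    IndepFun (fun ω t => M.X t ω) (fun ω t => M.u t ω) P := by
  have hψ : Measurable fun (e : ℤ → Fin l → ℝ) (t : ℤ) => M.f fun k => e (t - k) :=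
    measurable_pi_lambda _ fun t => hM.measurable_f.comp (by fun_prop)
  exact (hM.indep_e.comp hψ measurable_fst).symm

omit [IsProbabilityMeasure P] in
/-- The errors are independent of the covariates and the noise jointly, as `u` is a function of
`(X, Z)`. -/
theorem Standing.indepFun_X_u_ε (hM : M.Standing P) :
    IndepFun (fun ω => ((fun t => M.X t ω, fun t => M.u t ω) :
      (ℤ → Fin d → ℝ) × (ℤ → Fin l → ℝ))) (fun ω t => M.ε t ω) P := by
  have hψ : Measurable fun (η : ℤ → ℝ) (t : ℤ) => ∑' k : ℕ, M.a k * η (t - k) :=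
    measurable_pi_lambda _ fun t => Measurable.tsum fun k => by fun_prop
  have hχ : Measurable fun z : (ℤ → Fin d → ℝ) × (ℤ → Fin l → ℝ) =>
      (z.1, fun t => z.2 t - M.hfun (z.1 t)) := by
    refine measurable_fst.prodMk (measurable_pi_lambda _ fun t => ?_)
    exact ((measurable_pi_apply t).comp measurable_snd).sub
      (hM.measurable_hfun.comp ((measurable_pi_apply t).comp measurable_fst))
  have h1 := (hM.indep_η.comp hψ hχ).symm
  have h2 : ((fun z : (ℤ → Fin d → ℝ) × (ℤ → Fin l → ℝ) =>
      (z.1, fun t => z.2 t - M.hfun (z.1 t))) ∘ fun ω => (fun i => M.X i ω, fun i => M.Z i ω)) =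
      fun ω => (fun t => M.X t ω, fun t => M.u t ω) := by
    funext ω
    simp [Z]
  rw [h2] at h1
  exact h1

theorem exists_boundedLinearForms_ε (hM : M.Standing P) {q ζ : ℝ} (h_moment : M.ErrorMoment P q)
    (h_error : M.ErrorDependence ζ) : ∃ Γ : ℝ≥0, BoundedLinearForms P M.ε Γ := by
  have hL : ∀ i, MemLp (M.η i) 2 P := fun i => (h_moment.memLp i).mono_exponent <| by
    rw [← ENNReal.ofReal_ofNat]
    exact ENNReal.ofReal_le_ofReal (by linarith [h_moment.four_le])
  have h := boundedLinearForms_linear_process h_error.summable hM.iid_η hL h_moment.mean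
    h_moment.variance
  rw [← ENNReal.ofReal_tsum_of_nonneg (fun _ => abs_nonneg _) h_error.summable] at h
  exact ⟨(∑' k, |M.a k|).toNNReal ^ 2, by exact_mod_cast h⟩

section Noise

variable {T : Set (Fin d → ℝ)} {δ p : ℝ}

theorem RandomDesign.memLp_of_le_four (hR : M.RandomDesign P T δ p) {r : ℝ≥0∞} (hr : r ≤ 4) (i : ℤ)
    (j : Fin l) : MemLp (fun ω => M.u i ω j) r P :=
  (hR.memLp i j).mono_exponent <| hr.trans <| by
    rw [← ENNReal.ofReal_ofNat]
    exact ENNReal.ofReal_le_ofReal hR.four_le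

omit [IsProbabilityMeasure P] in
theorem Standing.measurable_coupledPast (hM : M.Standing P) (k : ℕ) :
    Measurable fun z : Ω × Ω => coupledPast M.e 0 k z := by
  have h := (measurable_update_swap (E := Fin l → ℝ) k).comp
    (((measurable_past hM.iid_e.measurable 0).comp measurable_fst).prodMk
      ((measurable_past hM.iid_e.measurable 0).comp measurable_snd))
  exact h

omit [IsProbabilityMeasure P] in
theorem Standing.measurable_coupling (hM : M.Standing P) (k : ℕ) (j : Fin l) :
    Measurable fun z : Ω × Ω => M.f (past M.e 0 z.1) j - M.f (coupledPast M.e 0 k z) j :=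
  ((measurable_pi_apply j).comp ((hM.measurable_u 0).comp measurable_fst)).sub
    ((measurable_pi_apply j).comp (hM.measurable_f.comp (hM.measurable_coupledPast k)))

/-- The physical dependence measures of `u` are summable in `L^4`. -/
theorem RandomDesign.exists_dependence (hM : M.Standing P) (hR : M.RandomDesign P T δ p) :
    ∃ θ : ℕ → ℝ≥0∞, ∑' k, θ k ≠ ∞ ∧ ∀ k (j : Fin l), eLpNorm
      (fun z : Ω × Ω => M.f (past M.e 0 z.1) j - M.f (coupledPast M.e 0 k z) j) 4
      (P.prod P) ≤ θ k := by
  refine ⟨_, (hR.dependence 0).ne, fun k j => ?_⟩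
  refine (eLpNorm_le_eLpNorm_of_exponent_le (q := ENNReal.ofReal p) ?_
    (hM.measurable_coupling k j).aestronglyMeasurable).trans (eLpNorm_mono fun z => ?_)
  · rw [← ENNReal.ofReal_ofNat]
    exact ENNReal.ofReal_le_ofReal hR.four_le
  · rw [norm_norm]
    exact norm_le_pi_norm (M.f (past M.e 0 z.1) - M.f (coupledPast M.e 0 k z)) j

theorem exists_boundedLinearForms_u (hM : M.Standing P) (hR : M.RandomDesign P T δ p) :
    ∃ Γ : ℝ≥0, ∀ j, BoundedLinearForms P (fun t ω => M.u t ω j) Γ := by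
  obtain ⟨θ, hθ, hle⟩ := hR.exists_dependence hM
  refine ⟨((∑' k, θ k) ^ 2).toNNReal, fun j => ?_⟩
  rw [ENNReal.coe_toNNReal (ENNReal.pow_ne_top hθ)]
  have h := hM.iid_e.boundedLinearForms (φ := fun y => M.f y j)
    ((measurable_pi_apply j).comp hM.measurable_f) (hR.memLp_of_le_four (by norm_num) 0 j) (δ := θ)
    fun k => (eLpNorm_le_eLpNorm_of_exponent_le (q := 4) (by norm_num)
      (hM.measurable_coupling k j).aestronglyMeasurable).trans (hle k j)
  have h0 : ∫ ω, M.f (past M.e 0 ω) j ∂P = 0 := hR.mean 0 j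
  simp only [h0, sub_zero] at h
  exact h

omit [IsProbabilityMeasure P] in
theorem holderTriple_four_four_two : ENNReal.HolderTriple 4 4 2 := by
  have h := ENNReal.HolderTriple.of 4 4
  have h2 : ((4 : ℝ≥0∞)⁻¹ + 4⁻¹)⁻¹ = 2 := by
    rw [← two_mul, ENNReal.mul_inv (by simp) (by simp), inv_inv]
    have : (4 : ℝ≥0∞) = 2 * 2 := by norm_num
    rw [this, ← mul_assoc, ENNReal.inv_mul_cancel (by simp) (by simp), one_mul]
  rwa [h2] at h

/-- The products `u_j u_j'`, centered, are short memory processes as well: by Hölder's inequality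
their physical dependence measures in `L^2` are bounded by those of `u` in `L^4`. -/
theorem exists_boundedLinearForms_u_mul_u (hM : M.Standing P) (hR : M.RandomDesign P T δ p) :
    ∃ Γ : ℝ≥0, ∀ j j',
      BoundedLinearForms P (fun t ω => M.u t ω j * M.u t ω j' - M.covU P j j') Γ := by
  obtain ⟨θ, hθ, hle⟩ := hR.exists_dependence hM
  have hH := holderTriple_four_four_two
  set A : ℝ≥0∞ := ∑ j, eLpNorm (fun ω => M.u 0 ω j) 4 P
  have hA : A ≠ ∞ := ENNReal.sum_ne_top.2 fun j _ => (hR.memLp_of_le_four le_rfl 0 j).2.ne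
  have hAle : ∀ j, eLpNorm (fun z : Ω × Ω => M.u 0 z.1 j) 4 (P.prod P) ≤ A := fun j => by
    have h1 : eLpNorm (fun z : Ω × Ω => M.u 0 z.1 j) 4 (P.prod P) =
        eLpNorm (fun ω => M.u 0 ω j) 4 P :=
      eLpNorm_comp_measurePreserving (g := fun ω => M.u 0 ω j) (f := Prod.fst)
        (hR.memLp_of_le_four le_rfl 0 j).1 measurePreserving_fst
    rw [h1]
    exact Finset.single_le_sum (f := fun j => eLpNorm (fun ω => M.u 0 ω j) 4 P)
      (fun _ _ => zero_le) (Finset.mem_univ j)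
  set Θ := ∑' k, θ k
  set B : ℝ≥0∞ := A + (A + Θ)
  have hB : Θ * B ≠ ∞ := ENNReal.mul_ne_top hθ (by simp [B, hA, hθ])
  refine ⟨((Θ * B) ^ 2).toNNReal, fun j j' => ?_⟩
  rw [ENNReal.coe_toNNReal (ENNReal.pow_ne_top hB), ← ENNReal.tsum_mul_right]
  refine hM.iid_e.boundedLinearForms (φ := fun y => M.f y j * M.f y j')
    (((measurable_pi_apply j).comp hM.measurable_f).mul
      ((measurable_pi_apply j').comp hM.measurable_f))
    ((hR.memLp_of_le_four le_rfl 0 j').mul (hR.memLp_of_le_four le_rfl 0 j)) (δ := fun k => θ k * B)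
    fun k => ?_
  have ha : ∀ j, AEStronglyMeasurable (fun z : Ω × Ω => M.u 0 z.1 j) (P.prod P) := fun j =>
    ((measurable_pi_apply j).comp ((hM.measurable_u 0).comp measurable_fst)).aestronglyMeasurable
  have hd : ∀ j, AEStronglyMeasurable
      (fun z : Ω × Ω => M.f (past M.e 0 z.1) j - M.f (coupledPast M.e 0 k z) j) (P.prod P) :=
    fun j => (hM.measurable_coupling k j).aestronglyMeasurable
  set D : Fin l → Ω × Ω → ℝ := fun j z => M.f (past M.e 0 z.1) j - M.f (coupledPast M.e 0 k z) j
  set U : Fin l → Ω × Ω → ℝ := fun j z => M.u 0 z.1 j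
  have hθΘ : θ k ≤ Θ := ENNReal.le_tsum k
  have hU' : eLpNorm (U j' - D j') 4 (P.prod P) ≤ A + Θ :=
    (eLpNorm_sub_le (ha j') (hd j') (by norm_num)).trans
      (add_le_add (hAle j') ((hle k j').trans hθΘ))
  have heq : (fun z : Ω × Ω => M.f (past M.e 0 z.1) j * M.f (past M.e 0 z.1) j' -
      M.f (coupledPast M.e 0 k z) j * M.f (coupledPast M.e 0 k z) j') =
      U j • D j' + D j • (U j' - D j') := by
    funext z
    simp only [smul_eq_mul, Pi.add_apply, Pi.mul_apply, Pi.sub_apply, U, D, u]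
    ring
  rw [heq]
  calc _ ≤ eLpNorm (U j • D j') 2 (P.prod P) + eLpNorm (D j • (U j' - D j')) 2 (P.prod P) :=
        eLpNorm_add_le ((ha j).smul (hd j')) ((hd j).smul ((ha j').sub (hd j'))) (by norm_num)
    _ ≤ A * θ k + θ k * (A + Θ) := by
        refine add_le_add ((eLpNorm_smul_le_mul_eLpNorm (p := 4) (q := 4) (hd j') (ha j)).trans ?_)
          ((eLpNorm_smul_le_mul_eLpNorm (p := 4) (q := 4) ((ha j').sub (hd j')) (hd j)).trans ?_)
        · gcongr
          · exact hAle j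
          · exact hle k j'
        · gcongr
          exact hle k j
    _ = θ k * B := by ring

end Noise

end PLModel

/-! ### Residuals of kernel regression -/

theorem sub_sq_le_two_mul_add (a b : ℝ) : (a - b) ^ 2 ≤ 2 * (a ^ 2 + b ^ 2) := by
  nlinarith [sq_nonneg (a + b)]

section Residual

variable {d : ℕ} {K : (Fin d → ℝ) → ℝ} {h : ℝ} {n : ℕ} {x : ℤ → Fin d → ℝ}
  {T S : Set (Fin d → ℝ)} {C₁ C₂ c : ℝ}

/-- The residual at `i` of the kernel regression of the sequence `a` on the covariates. -/
def kernelResidual (K : (Fin d → ℝ) → ℝ) (h : ℝ) (n : ℕ) (x : ℤ → Fin d → ℝ) (a : ℤ → ℝ) (i : ℤ) : ℝ :=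
  a i - ∑ t ∈ Finset.Icc (1 : ℤ) n, kernelWeight K h n x i t * a t

/-- The adjoint of `a ↦ inside T x * kernelResidual K h n x a` with respect to the inner product
`∑ i ∈ Icc 1 n, a i * b i`. -/
def residualAdjoint (K : (Fin d → ℝ) → ℝ) (h : ℝ) (T : Set (Fin d → ℝ)) (n : ℕ)
    (x : ℤ → Fin d → ℝ) (p : ℤ → ℝ) (t : ℤ) : ℝ :=
  inside T x t * p t - ∑ i ∈ Finset.Icc (1 : ℤ) n, inside T x i * p i * kernelWeight K h n x i t

/-- `residualAdjoint` is the adjoint of the residual operator restricted to the covariates in `T`. -/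
theorem sum_inside_mul_kernelResidual (p a : ℤ → ℝ) :
    ∑ i ∈ Finset.Icc (1 : ℤ) n, inside T x i * (p i * kernelResidual K h n x a i) =
      ∑ t ∈ Finset.Icc (1 : ℤ) n, residualAdjoint K h T n x p t * a t := by
  simp only [kernelResidual, residualAdjoint, sub_mul, mul_sub, Finset.sum_sub_distrib, Finset.sum_mul,
    Finset.mul_sum]
  congr 1
  · exact Finset.sum_congr rfl fun _ _ => by ring
  · rw [Finset.sum_comm]
    exact Finset.sum_congr rfl fun _ _ => Finset.sum_congr rfl fun _ _ => by ring

theorem kernelResidual_add (a b : ℤ → ℝ) (i : ℤ) :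
    kernelResidual K h n x (fun t => a t + b t) i = kernelResidual K h n x a i + kernelResidual K h n x b i := by
  simp only [kernelResidual, mul_add, Finset.sum_add_distrib]
  ring

theorem kernelResidual_sum {l : ℕ} (a : Fin l → ℤ → ℝ) (r : Fin l → ℝ) (i : ℤ) :
    kernelResidual K h n x (fun t => ∑ j, a j t * r j) i = ∑ j, kernelResidual K h n x (a j) i * r j := by
  simp only [kernelResidual, sub_mul, Finset.sum_sub_distrib, Finset.mul_sum, Finset.sum_mul]
  congr 1
  rw [Finset.sum_comm]
  exact Finset.sum_congr rfl fun _ _ => Finset.sum_congr rfl fun _ _ => by ring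

/-- The residual at `i` depends only on the entries at `i` and at the covariates within distance
`h` of `x i`. -/
theorem kernelResidual_congr (hK : IsKernel K) (hh : 0 < h) {a b : ℤ → ℝ} {i : ℤ} (hi : a i = b i)
    (hab : ∀ t ∈ Finset.Icc (1 : ℤ) n, ‖x i - x t‖ ≤ h → a t = b t) :
    kernelResidual K h n x a i = kernelResidual K h n x b i := by
  simp only [kernelResidual]
  rw [hi]
  congr 1
  refine Finset.sum_congr rfl fun t ht => ?_
  by_cases hw : kernelWeight K h n x i t = 0
  · simp [hw]
  · rw [hab t ht (norm_sub_le_of_kernelWeight_ne_zero hK hh hw)]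

/-- The residual is a weighted mean of differences over neighbours within distance `h`; the weights
sum to one because the denominator is positive. -/
theorem abs_kernelResidual_le (hK : IsKernel K) (hh : 0 < h) {a : ℤ → ℝ} {b : ℝ} {i : ℤ}
    (hpos : 0 < kernelSum K h n x i)
    (hab : ∀ t ∈ Finset.Icc (1 : ℤ) n, ‖x i - x t‖ ≤ h → |a i - a t| ≤ b) :
    |kernelResidual K h n x a i| ≤ b := by
  have h1 : kernelResidual K h n x a i =
      ∑ t ∈ Finset.Icc (1 : ℤ) n, kernelWeight K h n x i t * (a i - a t) := by
    simp only [kernelResidual, mul_sub, Finset.sum_sub_distrib]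
    rw [← Finset.sum_mul, sum_kernelWeight_eq i hpos, one_mul]
  calc |kernelResidual K h n x a i|
      ≤ ∑ t ∈ Finset.Icc (1 : ℤ) n, |kernelWeight K h n x i t * (a i - a t)| := by
        rw [h1]
        exact Finset.abs_sum_le_sum_abs _ _
    _ ≤ ∑ t ∈ Finset.Icc (1 : ℤ) n, kernelWeight K h n x i t * b := by
        refine Finset.sum_le_sum fun t ht => ?_
        rw [abs_mul, abs_of_nonneg (kernelWeight_nonneg hK i t)]
        by_cases hw : kernelWeight K h n x i t = 0
        · simp [hw]
        · exact mul_le_mul_of_nonneg_left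
            (hab t ht (norm_sub_le_of_kernelWeight_ne_zero hK hh hw)) (kernelWeight_nonneg hK i t)
    _ = b := by rw [← Finset.sum_mul, sum_kernelWeight_eq i hpos, one_mul]

/-- Jensen's inequality for the kernel weights. -/
theorem sq_sum_kernelWeight_mul_le (hK : IsKernel K) (a : ℤ → ℝ) (i : ℤ) :
    (∑ t ∈ Finset.Icc (1 : ℤ) n, kernelWeight K h n x i t * a t) ^ 2 ≤
      ∑ t ∈ Finset.Icc (1 : ℤ) n, kernelWeight K h n x i t * a t ^ 2 := by
  have hw := fun t => kernelWeight_nonneg (h := h) (n := n) (x := x) hK i t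
  refine (Finset.sum_sq_le_sum_mul_sum_of_sq_le_mul _ (fun t _ => hw t)
    (fun t _ => mul_nonneg (hw t) (sq_nonneg (a t))) fun t _ => by apply le_of_eq; ring).trans ?_
  exact mul_le_of_le_one_left (Finset.sum_nonneg fun t _ => mul_nonneg (hw t) (sq_nonneg _))
    (sum_kernelWeight_le hK i)

/-- On a good design, taking residuals is bounded in the Euclidean norm. -/
theorem GoodDesign.sum_kernelResidual_sq_le (hx : GoodDesign K T S C₁ C₂ c h n x) (hK : IsKernel K)
    (a : ℤ → ℝ) :
    ∑ i ∈ Finset.Icc (1 : ℤ) n, inside T x i * kernelResidual K h n x a i ^ 2 ≤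
      2 * (1 + C₁) * ∑ t ∈ Finset.Icc (1 : ℤ) n, a t ^ 2 := by
  have h1 : ∀ i, inside T x i * kernelResidual K h n x a i ^ 2 ≤ 2 * (a i ^ 2 +
      ∑ t ∈ Finset.Icc (1 : ℤ) n, inside T x i * kernelWeight K h n x i t * a t ^ 2) := fun i => by
    have h2 := sq_sum_kernelWeight_mul_le (h := h) (n := n) (x := x) hK a i
    have h3 : kernelResidual K h n x a i ^ 2 ≤ 2 * (a i ^ 2 +
        ∑ t ∈ Finset.Icc (1 : ℤ) n, kernelWeight K h n x i t * a t ^ 2) := by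
      rw [kernelResidual]
      refine (sub_sq_le_two_mul_add _ _).trans ?_
      gcongr
    calc _ ≤ inside T x i * (2 * (a i ^ 2 +
          ∑ t ∈ Finset.Icc (1 : ℤ) n, kernelWeight K h n x i t * a t ^ 2)) :=
          mul_le_mul_of_nonneg_left h3 (inside_nonneg T i)
      _ = 2 * (inside T x i * a i ^ 2 +
          ∑ t ∈ Finset.Icc (1 : ℤ) n, inside T x i * kernelWeight K h n x i t * a t ^ 2) := by
          simp only [mul_assoc, ← Finset.mul_sum]
          ring
      _ ≤ _ := by
          gcongr
          exact mul_le_of_le_one_left (sq_nonneg _) (inside_le_one T i)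
  refine (Finset.sum_le_sum fun i _ => h1 i).trans ?_
  rw [← Finset.mul_sum, Finset.sum_add_distrib, Finset.sum_comm, mul_assoc]
  simp only [← Finset.sum_mul]
  rw [add_mul, one_mul, Finset.mul_sum _ _ C₁]
  gcongr with t ht
  exact hx.column_le t ht

/-- The adjoint of the residual operator is bounded in the Euclidean norm as well: its row sums are
the column sums of the weights. -/
theorem GoodDesign.sum_residualAdjoint_sq_le (hx : GoodDesign K T S C₁ C₂ c h n x)
    (hK : IsKernel K) (p : ℤ → ℝ) :
    ∑ t ∈ Finset.Icc (1 : ℤ) n, residualAdjoint K h T n x p t ^ 2 ≤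
      2 * (1 + C₁) * ∑ i ∈ Finset.Icc (1 : ℤ) n, inside T x i * p i ^ 2 := by
  set I := Finset.Icc (1 : ℤ) n
  have hτ := fun i => inside_nonneg (x := x) T i
  have hw := fun i t => kernelWeight_nonneg (h := h) (n := n) (x := x) hK i t
  have hτ2 : ∀ i, inside T x i ^ 2 = inside T x i := fun i => by
    by_cases hi : x i ∈ T
    · simp [inside_of_mem hi]
    · simp [inside_of_notMem hi]
  have h1 : ∀ t ∈ I, residualAdjoint K h T n x p t ^ 2 ≤ 2 * (inside T x t * p t ^ 2 +
      C₁ * ∑ i ∈ I, inside T x i * p i ^ 2 * kernelWeight K h n x i t) := fun t ht => by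
    rw [residualAdjoint]
    refine (sub_sq_le_two_mul_add _ _).trans ?_
    rw [mul_pow, hτ2]
    gcongr
    refine (Finset.sum_sq_le_sum_mul_sum_of_sq_le_mul _
      (f := fun i => inside T x i * kernelWeight K h n x i t)
      (g := fun i => inside T x i * p i ^ 2 * kernelWeight K h n x i t)
      (fun i _ => mul_nonneg (hτ i) (hw i t))
      (fun i _ => mul_nonneg (mul_nonneg (hτ i) (sq_nonneg _)) (hw i t))
      fun i _ => by apply le_of_eq; ring).trans ?_
    exact mul_le_mul_of_nonneg_right (hx.column_le t ht)
      (Finset.sum_nonneg fun i _ => mul_nonneg (mul_nonneg (hτ i) (sq_nonneg _)) (hw i t))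
  have hC₁ : 0 ≤ C₁ ∨ I = ∅ := by
    rcases I.eq_empty_or_nonempty with hI | ⟨t, ht⟩
    · exact Or.inr hI
    · exact Or.inl ((Finset.sum_nonneg fun i _ => mul_nonneg (hτ i) (hw i t)).trans
        (hx.column_le t ht))
  rcases hC₁ with hC₁ | hI
  swap
  · simp [hI]
  refine (Finset.sum_le_sum h1).trans ?_
  rw [← Finset.mul_sum, Finset.sum_add_distrib, ← Finset.mul_sum, Finset.sum_comm, mul_assoc]
  simp only [← Finset.mul_sum]
  rw [add_mul, one_mul]
  refine mul_le_mul_of_nonneg_left (add_le_add le_rfl (mul_le_mul_of_nonneg_left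
    (Finset.sum_le_sum fun i _ => ?_) hC₁)) zero_le_two
  exact mul_le_of_le_one_right (mul_nonneg (hτ i) (sq_nonneg _)) (sum_kernelWeight_le hK i)

end Residual

/-! ### Quadratic forms and linear systems -/

section QuadraticForm

open Matrix

variable {l : ℕ}

/-- A symmetric matrix whose eigenvalues are at least `c` has a quadratic form bounded below. -/
theorem le_dotProduct_mulVec_of_eigenvalues {A : Matrix (Fin l) (Fin l) ℝ} (hA : A.IsHermitian)
    {c : ℝ} (hc : ∀ r : ℝ, Module.End.HasEigenvalue (Matrix.toLin' A) r → c ≤ r) (r : Fin l → ℝ) :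
    c * (r ⬝ᵥ r) ≤ r ⬝ᵥ A *ᵥ r := by
  have hB : (A - c • (1 : Matrix (Fin l) (Fin l) ℝ)).IsHermitian := by
    refine hA.sub ?_
    rw [Matrix.IsHermitian, conjTranspose_smul, conjTranspose_one]
    simp
  have hpos : (A - c • (1 : Matrix (Fin l) (Fin l) ℝ)).PosSemidef := by
    rw [hB.posSemidef_iff_eigenvalues_nonneg]
    intro j
    have h1 := hB.mulVec_eigenvectorBasis j
    set v : Fin l → ℝ := WithLp.ofLp (hB.eigenvectorBasis j)
    have hv : v ≠ 0 := fun h0 => hB.eigenvectorBasis.orthonormal.ne_zero j (by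
      ext k
      exact congrFun h0 k)
    rw [sub_mulVec, smul_mulVec, one_mulVec, sub_eq_iff_eq_add, ← add_smul] at h1
    have h2 := hc (hB.eigenvalues j + c) (Module.End.hasEigenvalue_of_hasEigenvector
      (x := v) ⟨Module.End.mem_eigenspace_iff.2 (by rw [Matrix.toLin'_apply]; exact h1), hv⟩)
    simpa using h2
  have h3 := hpos.dotProduct_mulVec_nonneg r
  rw [star_trivial, sub_mulVec, smul_mulVec, one_mulVec, dotProduct_sub, dotProduct_smul,
    smul_eq_mul] at h3
  linarith

/-- If the quadratic form of `A` is at least `κ` times the squared Euclidean norm, the error of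
the solution of `A z = b` as an approximation of `β` is controlled by `b - A β`. -/
theorem norm_inv_mulVec_sub_le {A : Matrix (Fin l) (Fin l) ℝ} {κ : ℝ} (hκ : 0 < κ)
    (hA : ∀ r : Fin l → ℝ, κ * (r ⬝ᵥ r) ≤ r ⬝ᵥ A *ᵥ r) (b β : Fin l → ℝ) :
    ‖A⁻¹ *ᵥ b - β‖ ≤ (∑ j, |(b - A *ᵥ β) j|) / κ := by
  have hunit : IsUnit A := by
    rw [← mulVec_injective_iff_isUnit]
    intro r r' hrr'
    have h0 : A *ᵥ (r - r') = 0 := by rw [mulVec_sub, sub_eq_zero]; exact hrr'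
    have h1 := hA (r - r')
    rw [h0, dotProduct_zero] at h1
    have h2 : 0 ≤ (r - r') ⬝ᵥ (r - r') := Finset.sum_nonneg fun _ _ => mul_self_nonneg _
    have h3 : (r - r') ⬝ᵥ (r - r') = 0 := by nlinarith
    exact sub_eq_zero.1 (dotProduct_self_eq_zero.1 h3)
  have hdet := (isUnit_iff_isUnit_det A).1 hunit
  set r := A⁻¹ *ᵥ b - β
  have hAr : A *ᵥ r = b - A *ᵥ β := by
    rw [mulVec_sub, mulVec_mulVec, mul_nonsing_inv _ hdet, one_mulVec]
  have h1 := hA r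
  rw [hAr] at h1
  have h2 : ‖r‖ ^ 2 ≤ r ⬝ᵥ r := by
    rcases isEmpty_or_nonempty (Fin l) with hl | hl
    · have : r = 0 := Subsingleton.elim _ _
      simp [this]
    · obtain ⟨j, hj⟩ := Finite.exists_max fun j => ‖r j‖
      have h3 : ‖r‖ ≤ ‖r j‖ := (pi_norm_le_iff_of_nonneg (norm_nonneg _)).2 hj
      calc ‖r‖ ^ 2 ≤ ‖r j‖ ^ 2 := by gcongr
        _ = r j * r j := by rw [Real.norm_eq_abs, sq_abs, sq]
        _ ≤ _ := Finset.single_le_sum (f := fun j => r j * r j) (fun _ _ => mul_self_nonneg _)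
            (Finset.mem_univ j)
  have h4 : r ⬝ᵥ (b - A *ᵥ β) ≤ ‖r‖ * ∑ j, |(b - A *ᵥ β) j| := by
    rw [dotProduct, Finset.mul_sum]
    refine Finset.sum_le_sum fun j _ => (le_abs_self _).trans ?_
    rw [abs_mul]
    gcongr
    exact norm_le_pi_norm r j
  rw [le_div_iff₀ hκ]
  rcases (norm_nonneg r).eq_or_lt with h0 | h0
  · rw [← h0, zero_mul]
    exact Finset.sum_nonneg fun _ _ => abs_nonneg _
  · nlinarith

end QuadraticForm

/-! ### Second moments of bilinear expressions in residuals -/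

section SecondMoments

variable {Ω 𝒳 : Type*} [MeasurableSpace Ω] [MeasurableSpace 𝒳] {P : Measure Ω}
  [IsProbabilityMeasure P] {W : ℤ → Ω → ℝ} {Γ : ℝ≥0∞} {d : ℕ} {K : (Fin d → ℝ) → ℝ} {h : ℝ} {n : ℕ}
  {T S : Set (Fin d → ℝ)} {C₁ C₂ c : ℝ} {D : Set (ℤ → Fin d → ℝ)}

theorem indicator_one_sq {α : Type*} (D : Set α) (x : α) :
    D.indicator (fun _ => (1 : ℝ)) x ^ 2 = D.indicator (fun _ => (1 : ℝ)) x := by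
  by_cases hx : x ∈ D
  · simp [hx]
  · simp [hx]

theorem indicator_one_nonneg {α : Type*} (D : Set α) (x : α) :
    0 ≤ D.indicator (fun _ => (1 : ℝ)) x :=
  indicator_nonneg (fun _ _ => zero_le_one) x

theorem measurable_kernelResidual (hK : IsKernel K) {V : 𝒳 → ℤ → Fin d → ℝ} (hV : Measurable V)
    {a : 𝒳 → ℤ → ℝ} (ha : ∀ t, Measurable fun v => a v t) (i : ℤ) :
    Measurable fun v => kernelResidual K h n (V v) (a v) i :=
  (ha i).sub (Finset.measurable_fun_sum _ fun t _ =>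
    ((measurable_kernelWeight hK i t).comp hV).mul (ha t))

theorem measurable_residualAdjoint (hK : IsKernel K) (hT : MeasurableSet T)
    {V : 𝒳 → ℤ → Fin d → ℝ} (hV : Measurable V)
    {p : 𝒳 → ℤ → ℝ} (hp : ∀ t, Measurable fun v => p v t) (t : ℤ) :
    Measurable fun v => residualAdjoint K h T n (V v) (p v) t :=
  (((measurable_inside hT t).comp hV).mul (hp t)).sub (Finset.measurable_fun_sum _ fun i _ =>
    (((measurable_inside hT i).comp hV).mul (hp i)).mul ((measurable_kernelWeight hK i t).comp hV))

/-- The inner product of `p` with the residuals of a process independent of `p` and of the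
covariates: moving the residual operator to `p` turns it into a linear form of the process. -/
theorem BoundedLinearForms.lintegral_sum_mul_kernelResidual_sq_le (hL : BoundedLinearForms P W Γ)
    (hW : ∀ t, Measurable (W t)) {V : Ω → 𝒳} (hV : Measurable V)
    (hind : IndepFun V (fun ω t => W t ω) P) {x : 𝒳 → ℤ → Fin d → ℝ} (hx : Measurable x)
    {p b : 𝒳 → ℤ → ℝ} (hp : ∀ t, Measurable fun v => p v t) (hb : ∀ t, Measurable fun v => b v t)
    {B : ℝ} (hB : ∀ v t, b v t ^ 2 ≤ B) (hC₁ : 0 ≤ C₁) (hK : IsKernel K) (hT : MeasurableSet T)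
    (hD : MeasurableSet D) (hgood : ∀ y ∈ D, GoodDesign K T S C₁ C₂ c h n y) :
    ∫⁻ ω, ENNReal.ofReal ((D.indicator (fun _ => (1 : ℝ)) (x (V ω)) *
        ∑ i ∈ Finset.Icc (1 : ℤ) n, inside T (x (V ω)) i *
          (p (V ω) i * kernelResidual K h n (x (V ω)) (fun t => b (V ω) t * W t ω) i)) ^ 2) ∂P ≤
      Γ * (ENNReal.ofReal (B * (2 * (1 + C₁))) *
        ∫⁻ ω, ENNReal.ofReal (D.indicator (fun _ => (1 : ℝ)) (x (V ω)) *
          ∑ i ∈ Finset.Icc (1 : ℤ) n, inside T (x (V ω)) i * p (V ω) i ^ 2) ∂P) := by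
  set γ : 𝒳 → ℝ := fun v => D.indicator (fun _ => (1 : ℝ)) (x v)
  have hγ : Measurable γ := (measurable_const.indicator hD).comp hx
  set A : 𝒳 → ℤ → ℝ := fun v => residualAdjoint K h T n (x v) (p v)
  have h1 := hL.random_coefficients hW hV hind (c := fun t v => γ v * (A v t * b v t))
    (fun t => hγ.mul ((measurable_residualAdjoint hK hT hx hp t).mul (hb t)))
    (Finset.Icc (1 : ℤ) n)
  have h2 : ∀ ω, γ (V ω) * ∑ i ∈ Finset.Icc (1 : ℤ) n, inside T (x (V ω)) i *
      (p (V ω) i * kernelResidual K h n (x (V ω)) (fun t => b (V ω) t * W t ω) i) =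
      ∑ t ∈ Finset.Icc (1 : ℤ) n, γ (V ω) * (A (V ω) t * b (V ω) t) * W t ω := fun ω => by
    rw [sum_inside_mul_kernelResidual, Finset.mul_sum]
    exact Finset.sum_congr rfl fun t _ => by simp only [A]; ring
  have h3 : ∀ v, ∑ t ∈ Finset.Icc (1 : ℤ) n, (γ v * (A v t * b v t)) ^ 2 ≤
      B * (2 * (1 + C₁)) * (γ v * ∑ i ∈ Finset.Icc (1 : ℤ) n, inside T (x v) i * p v i ^ 2) :=
    fun v => by
    have hB0 : 0 ≤ B := (sq_nonneg _).trans (hB v 0)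
    by_cases hv : x v ∈ D
    · have hγ1 : γ v = 1 := indicator_of_mem hv _
      calc _ ≤ ∑ t ∈ Finset.Icc (1 : ℤ) n, B * A v t ^ 2 := by
            refine Finset.sum_le_sum fun t _ => ?_
            rw [hγ1, one_mul, mul_pow, mul_comm]
            gcongr
            exact hB v t
        _ ≤ B * (2 * (1 + C₁) * ∑ i ∈ Finset.Icc (1 : ℤ) n, inside T (x v) i * p v i ^ 2) := by
            rw [← Finset.mul_sum]
            gcongr
            exact (hgood _ hv).sum_residualAdjoint_sq_le hK _
        _ = _ := by rw [hγ1]; ring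
    · have hγ0 : γ v = 0 := indicator_of_notMem hv _
      simp [hγ0]
  refine (lintegral_congr fun ω => by rw [← h2 ω]).trans_le (h1.trans ?_)
  gcongr
  rw [← lintegral_const_mul' _ _ ENNReal.ofReal_ne_top]
  refine lintegral_mono fun ω => ?_
  by_cases hv : x (V ω) ∈ D
  · have hB0 : 0 ≤ B * (2 * (1 + C₁)) :=
      mul_nonneg ((sq_nonneg _).trans (hB (V ω) 0)) (by linarith)
    rw [← ENNReal.ofReal_mul hB0]
    exact ENNReal.ofReal_le_ofReal (h3 (V ω))
  · have hγ0 : γ (V ω) = 0 := indicator_of_notMem hv _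
    simp [hγ0]

/-- The kernel smoother applied to a centered process independent of the covariates: the
Frobenius norm of the weights determines its size. -/
theorem BoundedLinearForms.lintegral_sum_smoothed_sq_le (hL : BoundedLinearForms P W Γ)
    (hW : ∀ t, Measurable (W t)) {X : Ω → ℤ → Fin d → ℝ} (hX : Measurable X)
    (hind : IndepFun X (fun ω t => W t ω) P) (hC₂ : 0 ≤ C₂) (hh : 0 < h) (hK : IsKernel K) (hT : MeasurableSet T)
    (hD : MeasurableSet D) (hgood : ∀ y ∈ D, GoodDesign K T S C₁ C₂ c h n y) :
    ∫⁻ ω, ENNReal.ofReal (D.indicator (fun _ => (1 : ℝ)) (X ω) *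
        ∑ i ∈ Finset.Icc (1 : ℤ) n, inside T (X ω) i *
          (∑ t ∈ Finset.Icc (1 : ℤ) n, kernelWeight K h n (X ω) i t * W t ω) ^ 2) ∂P ≤
      Γ * ENNReal.ofReal (C₂ / h ^ d) := by
  set I := Finset.Icc (1 : ℤ) n
  set γ : (ℤ → Fin d → ℝ) → ℝ := D.indicator fun _ => (1 : ℝ)
  have hγ : Measurable γ := measurable_const.indicator hD
  have hγ0 : ∀ x, 0 ≤ γ x := indicator_one_nonneg D
  have hγ2 : ∀ x, γ x ^ 2 = γ x := indicator_one_sq D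
  have hτ2 : ∀ x i, inside T x i ^ 2 = inside T x i := fun x i => indicator_one_sq T (x i)
  have hτ0 : ∀ x i, 0 ≤ inside T x i := fun x i => inside_nonneg T i
  set k : ℤ → ℤ → (ℤ → Fin d → ℝ) → ℝ := fun i t x => γ x * inside T x i * kernelWeight K h n x i t
  have hk : ∀ i t, Measurable (k i t) := fun i t =>
    (hγ.mul (measurable_inside hT i)).mul (measurable_kernelWeight hK i t)
  have h1 : ∀ ω, γ (X ω) * ∑ i ∈ I, inside T (X ω) i *
      (∑ t ∈ I, kernelWeight K h n (X ω) i t * W t ω) ^ 2 =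
      ∑ i ∈ I, (∑ t ∈ I, k i t (X ω) * W t ω) ^ 2 := fun ω => by
    rw [Finset.mul_sum]
    refine Finset.sum_congr rfl fun i _ => ?_
    simp only [k, mul_assoc (γ (X ω) * inside T (X ω) i), ← Finset.mul_sum]
    rw [mul_pow, mul_pow, hγ2, hτ2, mul_assoc]
  have h2 : ∀ x, ∑ i ∈ I, ∑ t ∈ I, k i t x ^ 2 ≤ C₂ / h ^ d * γ x := fun x => by
    by_cases hx : x ∈ D
    · have hγ1 : γ x = 1 := indicator_of_mem hx _
      simp only [k, hγ1, one_mul, mul_one, mul_pow, hτ2, ← Finset.mul_sum]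
      exact (hgood x hx).frobenius_le
    · have hγ1 : γ x = 0 := indicator_of_notMem hx _
      simp [k, hγ1]
  have hkm : ∀ i, Measurable fun ω => (∑ t ∈ I, k i t (X ω) * W t ω) ^ 2 := fun i =>
    (Finset.measurable_fun_sum _ fun t _ => ((hk i t).comp hX).mul (hW t)).pow_const 2
  have hkm' : ∀ i, Measurable fun ω => ∑ t ∈ I, k i t (X ω) ^ 2 := fun i =>
    Finset.measurable_fun_sum _ fun t _ => ((hk i t).comp hX).pow_const 2
  calc _ = ∑ i ∈ I, ∫⁻ ω, ENNReal.ofReal ((∑ t ∈ I, k i t (X ω) * W t ω) ^ 2) ∂P := by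
        rw [← lintegral_finsetSum _ fun i _ => (hkm i).ennreal_ofReal]
        refine lintegral_congr fun ω => ?_
        rw [h1, ENNReal.ofReal_sum_of_nonneg fun i _ => sq_nonneg _]
    _ ≤ ∑ i ∈ I, Γ * ∫⁻ ω, ENNReal.ofReal (∑ t ∈ I, k i t (X ω) ^ 2) ∂P :=
        Finset.sum_le_sum fun i _ => hL.random_coefficients hW hX hind (hk i) I
    _ = Γ * ∫⁻ ω, ENNReal.ofReal (∑ i ∈ I, ∑ t ∈ I, k i t (X ω) ^ 2) ∂P := by
        rw [← Finset.mul_sum, ← lintegral_finsetSum _ fun i _ => (hkm' i).ennreal_ofReal]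
        congr 1
        refine lintegral_congr fun ω => ?_
        rw [ENNReal.ofReal_sum_of_nonneg fun i _ => Finset.sum_nonneg fun t _ => sq_nonneg _]
    _ ≤ Γ * ∫⁻ _, ENNReal.ofReal (C₂ / h ^ d) ∂P := by
        gcongr with ω
        by_cases hx : X ω ∈ D
        · exact (h2 (X ω)).trans_eq (by rw [show γ (X ω) = 1 from indicator_of_mem hx _, mul_one])
        · refine (h2 (X ω)).trans ?_
          rw [show γ (X ω) = 0 from indicator_of_notMem hx _, mul_zero]
          positivity
    _ = _ := by simp

end SecondMoments

/-! ### The random forms in the estimation error -/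

namespace PLModel

variable {Ω : Type*} [MeasurableSpace Ω] {P : Measure Ω} {d d' l : ℕ}
  {M : PLModel Ω d d' l} {T : Set (Fin d → ℝ)} {δ : ℝ}

section SmoothRegion

theorem measurableSet_smoothRegion (hT : IsClosed T) : MeasurableSet (M.smoothRegion P T δ) :=
  (hT.union (Metric.isClosed_cthickening.inter Measure.isClosed_support)).measurableSet

theorem mem_smoothRegion_of_norm_sub_le {y z : Fin d → ℝ} {h : ℝ} (hy : y ∈ T) (hhδ : h ≤ δ)
    (hyz : ‖y - z‖ ≤ h) (hz : z ∈ (P.map (M.X 0)).support) : z ∈ M.smoothRegion P T δ :=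
  Or.inr ⟨Metric.mem_cthickening_of_dist_le _ y _ _ hy (by
    rw [dist_comm, dist_eq_norm]; exact hyz.trans hhδ), hz⟩

/-- A function that is Lipschitz continuous on the smooth region and bounded on the compact set
`T` is bounded on the smooth region. -/
theorem exists_sq_indicator_smoothRegion_le (hT : IsCompact T) (hδ : 0 ≤ δ)
    {φ : (Fin d → ℝ) → ℝ} {L : ℝ≥0} (hφ : LipschitzOnWith L φ (M.smoothRegion P T δ)) {B : ℝ}
    (hB : ∀ y ∈ T, |φ y| ≤ B) :
    ∃ B' : ℝ, ∀ x, (M.smoothRegion P T δ).indicator φ x ^ 2 ≤ B' := by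
  refine ⟨(B + L * δ) ^ 2, fun x => ?_⟩
  by_cases hx : x ∈ M.smoothRegion P T δ
  · rw [indicator_of_mem hx, ← sq_abs]
    obtain ⟨y, hy, hxy⟩ : ∃ y ∈ T, dist x y ≤ δ := by
      rcases hx with hx | hx
      · exact ⟨x, hx, by simpa using hδ⟩
      · have h1 := hx.1
        rw [hT.cthickening_eq_biUnion_closedBall hδ, mem_iUnion₂] at h1
        obtain ⟨y, hy, h2⟩ := h1
        exact ⟨y, hy, h2⟩
    have h3 : |φ x - φ y| ≤ L * δ := by
      rw [← Real.dist_eq]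
      exact (hφ.dist_le_mul x hx y (Or.inl hy)).trans (by gcongr)
    have h4 : |φ x| ≤ B + L * δ := by
      have h5 : |φ x| ≤ |φ y| + |φ x - φ y| := by
        have := abs_add_le (φ y) (φ x - φ y)
        rwa [add_sub_cancel] at this
      linarith [hB y hy]
    gcongr
  · rw [indicator_of_notMem hx, zero_pow two_ne_zero]
    positivity

end SmoothRegion

variable {K : (Fin d → ℝ) → ℝ} {h : ℝ} {n : ℕ} {C₁ C₂ c : ℝ}

/-- The smoothing bias of a Lipschitz function is of the order of the bandwidth. -/
theorem abs_kernelResidual_le_of_lipschitzOnWith (hK : IsKernel K) (hh : 0 < h) (hhδ : h ≤ δ)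
    {x : ℤ → Fin d → ℝ}
    (hx : GoodDesign K T (P.map (M.X 0)).support C₁ C₂ c h n x) {φ : (Fin d → ℝ) → ℝ} {L : ℝ≥0}
    (hφ : LipschitzOnWith L φ (M.smoothRegion P T δ)) {i : ℤ} (hi : i ∈ Finset.Icc (1 : ℤ) n)
    (hiT : x i ∈ T) : |kernelResidual K h n x (fun t => φ (x t)) i| ≤ L * h := by
  refine abs_kernelResidual_le hK hh (hx.kernelSum_pos i hi hiT) fun t ht hit => ?_
  have h1 := mem_smoothRegion_of_norm_sub_le (M := M) hiT hhδ hit (hx.mem_support t ht)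
  rw [← Real.dist_eq]
  refine (hφ.dist_le_mul _ (Or.inl hiT) _ h1).trans ?_
  rw [dist_eq_norm]
  gcongr

/-- The inner product, over the covariates in `T`, of the smoothing bias of the trend with the
residuals of the noise of the random design. -/
def trendForm (M : PLModel Ω d d' l) (K : (Fin d → ℝ) → ℝ) (h : ℝ) (T : Set (Fin d → ℝ)) (n : ℕ)
    (j : Fin l) (ω : Ω) : ℝ :=
  ∑ i ∈ Finset.Icc (1 : ℤ) n, inside T (M.X · ω) i *
    (kernelResidual K h n (M.X · ω) (fun t => M.μ (M.X t ω)) i *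
      kernelResidual K h n (M.X · ω) (fun t => M.u t ω j) i)

/-- The inner product, over the covariates in `T`, of the residuals of `Z` with those of the errors.
The volatility is set to zero outside the smooth region `U`, where it need not be bounded. -/
def errorForm (M : PLModel Ω d d' l) (U : Set (Fin d → ℝ)) (K : (Fin d → ℝ) → ℝ) (h : ℝ)
    (T : Set (Fin d → ℝ)) (n : ℕ) (j : Fin l) (ω : Ω) : ℝ :=
  ∑ i ∈ Finset.Icc (1 : ℤ) n, inside T (M.X · ω) i *
    (kernelResidual K h n (M.X · ω) (fun t => M.Z t ω j) i *
      kernelResidual K h n (M.X · ω) (fun t => U.indicator M.σ (M.X t ω) * M.ε t ω) i)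

/-- The centered second moments of the noise of the random design, summed over the covariates in
`T`. -/
def covarianceForm (M : PLModel Ω d d' l) (P : Measure Ω) (T : Set (Fin d → ℝ)) (n : ℕ)
    (j j' : Fin l) (ω : Ω) : ℝ :=
  ∑ i ∈ Finset.Icc (1 : ℤ) n, inside T (M.X · ω) i *
    (M.u i ω j * M.u i ω j' - M.covU P j j')

/-- The sum of squares, over the covariates in `T`, of the kernel smoother of the noise of the
random design. -/
def smoothedNoise (M : PLModel Ω d d' l) (K : (Fin d → ℝ) → ℝ) (h : ℝ) (T : Set (Fin d → ℝ)) (n : ℕ)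
    (j : Fin l) (ω : Ω) : ℝ :=
  ∑ i ∈ Finset.Icc (1 : ℤ) n, inside T (M.X · ω) i *
    (∑ t ∈ Finset.Icc (1 : ℤ) n, kernelWeight K h n (M.X · ω) i t * M.u t ω j) ^ 2

variable [IsProbabilityMeasure P]

theorem lintegral_sum_inside_mul_le {D : Set (ℤ → Fin d → ℝ)} {B : ℝ}
    {q : Ω → ℤ → ℝ} (hB : ∀ ω, (M.X · ω) ∈ D → ∀ i ∈ Finset.Icc (1 : ℤ) n, M.X i ω ∈ T → q ω i ≤ B)
    (hB0 : 0 ≤ B) :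
    ∫⁻ ω, ENNReal.ofReal (D.indicator (fun _ => (1 : ℝ)) (M.X · ω) *
      ∑ i ∈ Finset.Icc (1 : ℤ) n, inside T (M.X · ω) i * q ω i) ∂P ≤ ENNReal.ofReal (B * n) := by
  calc _ ≤ ∫⁻ _, ENNReal.ofReal (B * n) ∂P := by
        refine lintegral_mono fun ω => ENNReal.ofReal_le_ofReal ?_
        by_cases hω : (M.X · ω) ∈ D
        · rw [indicator_of_mem hω, one_mul]
          calc _ ≤ ∑ i ∈ Finset.Icc (1 : ℤ) n, B := by
                refine Finset.sum_le_sum fun i hi => ?_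
                by_cases hiT : M.X i ω ∈ T
                · rw [inside_of_mem (x := (M.X · ω)) hiT, one_mul]
                  exact hB ω hω i hi hiT
                · rw [inside_of_notMem (x := (M.X · ω)) hiT, zero_mul]
                  exact hB0
            _ = B * n := by rw [Finset.sum_const, card_Icc_one, nsmul_eq_mul, mul_comm]
        · rw [indicator_of_notMem hω, zero_mul]
          positivity
    _ = _ := by simp

variable {D : Set (ℤ → Fin d → ℝ)} {Γ : ℝ≥0}

/-- The part of the estimation error that pairs the bias of the trend with the noise of the random
design. -/
theorem lintegral_trend_bias_mul_noise_le (hM : M.Standing P) (hK : IsKernel K)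
    (hT : MeasurableSet T) (hC₁ : 0 ≤ C₁) (hD : MeasurableSet D)
    (hgood : ∀ y ∈ D, GoodDesign K T (P.map (M.X 0)).support C₁ C₂ c h n y)
    (hh : 0 < h) (hh1 : h ≤ 1) (hhδ : h ≤ δ) {L : ℝ≥0}
    (hμ : LipschitzOnWith L M.μ (M.smoothRegion P T δ)) {j : Fin l}
    (hL : BoundedLinearForms P (fun t ω => M.u t ω j) Γ) :
    ∫⁻ ω, ENNReal.ofReal ((D.indicator (fun _ => (1 : ℝ)) (M.X · ω) *
      M.trendForm K h T n j ω) ^ 2) ∂P ≤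
      ENNReal.ofReal (Γ * (2 * (1 + C₁) * L ^ 2) * n) := by
  have hX := hM.measurable_X_process
  have hind : IndepFun (fun ω t => M.X t ω) (fun ω t => M.u t ω j) P :=
    hM.indepFun_X_u.comp (φ := id) (ψ := fun (u : ℤ → Fin l → ℝ) t => u t j) measurable_id
      (by fun_prop)
  have h1 := hL.lintegral_sum_mul_kernelResidual_sq_le
    (fun t => (measurable_pi_apply j).comp (hM.measurable_u t)) hX hind (x := id) measurable_id
    (p := fun x i => kernelResidual K h n x (fun t => M.μ (x t)) i) (b := fun _ _ => 1)
    (measurable_kernelResidual hK measurable_id fun t => hM.measurable_μ.comp (measurable_pi_apply t))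
    (fun _ => measurable_const) (B := 1) (fun _ _ => by norm_num) hC₁ hK hT hD hgood
  simp only [id, one_mul] at h1
  refine h1.trans ?_
  have h2 := lintegral_sum_inside_mul_le (P := P) (M := M) (T := T) (D := D) (n := n)
    (q := fun ω i => kernelResidual K h n (M.X · ω) (fun t => M.μ (M.X t ω)) i ^ 2)
    (B := (L : ℝ) ^ 2) (fun ω hω i hi hiT => by
      have h3 := abs_kernelResidual_le_of_lipschitzOnWith hK hh hhδ (x := (M.X · ω)) (hgood _ hω) hμ
        hi hiT
      rw [← sq_abs]
      have : (L : ℝ) * h ≤ L := mul_le_of_le_one_right L.2 hh1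
      exact pow_le_pow_left₀ (abs_nonneg _) (h3.trans this) 2) (sq_nonneg _)
  calc _ ≤ (Γ : ℝ≥0∞) * (ENNReal.ofReal (2 * (1 + C₁)) * ENNReal.ofReal ((L : ℝ) ^ 2 * n)) := by
        gcongr
    _ = _ := by
        rw [← ENNReal.ofReal_coe_nnreal, ← ENNReal.ofReal_mul (by positivity),
          ← ENNReal.ofReal_mul Γ.coe_nonneg]
        congr 1
        ring

/-- The residuals of `Z` have a sum of squares of order `n` in mean. Only boundedness of the
conditional mean and of the second moments of `u` is used, not smoothness. -/
theorem lintegral_kernelResidual_Z_sq_le (hM : M.Standing P) (hK : IsKernel K) (hC₁ : 0 ≤ C₁)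
    (hgood : ∀ y ∈ D, GoodDesign K T (P.map (M.X 0)).support C₁ C₂ c h n y)
    {H : ℝ} (hH : ∀ x, ‖M.hfun x‖ ≤ H) {j : Fin l}
    (hL : BoundedLinearForms P (fun t ω => M.u t ω j) Γ) :
    ∫⁻ ω, ENNReal.ofReal (D.indicator (fun _ => (1 : ℝ)) (M.X · ω) *
      ∑ i ∈ Finset.Icc (1 : ℤ) n, inside T (M.X · ω) i *
        kernelResidual K h n (M.X · ω) (fun t => M.Z t ω j) i ^ 2) ∂P ≤
      ENNReal.ofReal (2 * (1 + C₁) * (2 * (H ^ 2 + Γ)) * n) := by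
  have hum : ∀ t, Measurable fun ω => M.u t ω j := fun t =>
    (measurable_pi_apply j).comp (hM.measurable_u t)
  calc _ ≤ ∫⁻ ω, ENNReal.ofReal (2 * (1 + C₁)) *
        ∑ t ∈ Finset.Icc (1 : ℤ) n, (ENNReal.ofReal (2 * H ^ 2) +
          2 * ENNReal.ofReal (M.u t ω j ^ 2)) ∂P := by
        refine lintegral_mono fun ω => ?_
        have h1 : ∀ t, ENNReal.ofReal (2 * H ^ 2) + 2 * ENNReal.ofReal (M.u t ω j ^ 2) =
            ENNReal.ofReal (2 * H ^ 2 + 2 * M.u t ω j ^ 2) := fun t => by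
          rw [ENNReal.ofReal_add (by positivity) (by positivity), ENNReal.ofReal_mul (p := 2)
            (q := M.u t ω j ^ 2) (by norm_num), ENNReal.ofReal_ofNat]
        simp only [h1]
        rw [← ENNReal.ofReal_sum_of_nonneg fun t _ => by positivity,
          ← ENNReal.ofReal_mul (by positivity)]
        refine ENNReal.ofReal_le_ofReal ?_
        by_cases hω : (M.X · ω) ∈ D
        · rw [indicator_of_mem hω, one_mul]
          refine ((hgood _ hω).sum_kernelResidual_sq_le hK _).trans ?_
          gcongr with t ht
          have h2 : |M.hfun (M.X t ω) j| ≤ H := (norm_le_pi_norm _ j).trans (hH _)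
          have h3 : M.hfun (M.X t ω) j ^ 2 ≤ H ^ 2 := by
            rw [← sq_abs]
            gcongr
          have h4 : M.Z t ω j = M.hfun (M.X t ω) j + M.u t ω j := rfl
          rw [h4]
          nlinarith [sq_nonneg (M.hfun (M.X t ω) j - M.u t ω j)]
        · rw [indicator_of_notMem hω, zero_mul]
          exact mul_nonneg (by positivity) (Finset.sum_nonneg fun t _ => by positivity)
    _ = ENNReal.ofReal (2 * (1 + C₁)) * ∑ t ∈ Finset.Icc (1 : ℤ) n, (ENNReal.ofReal (2 * H ^ 2) +
          2 * ∫⁻ ω, ENNReal.ofReal (M.u t ω j ^ 2) ∂P) := by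
        rw [lintegral_const_mul' _ _ ENNReal.ofReal_ne_top, lintegral_finsetSum]
        · congr 1
          refine Finset.sum_congr rfl fun t _ => ?_
          rw [lintegral_add_left measurable_const, lintegral_const_mul' _ _ (by simp)]
          simp
        · exact fun t _ => (((hum t).pow_const 2).ennreal_ofReal.const_mul 2).const_add _
    _ ≤ ENNReal.ofReal (2 * (1 + C₁)) * ∑ t ∈ Finset.Icc (1 : ℤ) n, (ENNReal.ofReal (2 * H ^ 2) +
          2 * Γ) := by
        gcongr with t ht
        exact hL.lintegral_sq_le t
    _ = _ := by
        have h5 : ENNReal.ofReal (2 * H ^ 2) + 2 * (Γ : ℝ≥0∞) =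
            ENNReal.ofReal (2 * (H ^ 2 + Γ)) := by
          rw [mul_add, ENNReal.ofReal_add (by positivity) (by positivity),
            ENNReal.ofReal_mul (p := 2) (q := (Γ : ℝ)) (by norm_num), ENNReal.ofReal_ofNat,
            ENNReal.ofReal_coe_nnreal]
        rw [h5, Finset.sum_const, card_Icc_one, ← ENNReal.ofReal_nsmul, nsmul_eq_mul,
          ← ENNReal.ofReal_mul (by positivity)]
        congr 1
        ring

/-- The part of the estimation error that pairs the residuals of `Z` with the errors. -/
theorem lintegral_residual_Z_mul_error_le (hM : M.Standing P) (hK : IsKernel K)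
    (hT : IsClosed T) (hC₁ : 0 ≤ C₁) (hD : MeasurableSet D)
    (hgood : ∀ y ∈ D, GoodDesign K T (P.map (M.X 0)).support C₁ C₂ c h n y)
    {H : ℝ} (hH : ∀ x, ‖M.hfun x‖ ≤ H) {j : Fin l}
    (hL : BoundedLinearForms P (fun t ω => M.u t ω j) Γ) {Γ' : ℝ≥0}
    (hε : BoundedLinearForms P M.ε Γ') {B : ℝ}
    (hB : ∀ x, (M.smoothRegion P T δ).indicator M.σ x ^ 2 ≤ B) :
    ∫⁻ ω, ENNReal.ofReal ((D.indicator (fun _ => (1 : ℝ)) (M.X · ω) *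
      M.errorForm (M.smoothRegion P T δ) K h T n j ω) ^ 2) ∂P ≤
      ENNReal.ofReal (Γ' * (B * (2 * (1 + C₁)) * (2 * (1 + C₁) * (2 * (H ^ 2 + Γ)))) * n) := by
  have hB0 : 0 ≤ B := (sq_nonneg _).trans (hB 0)
  have hx : Measurable fun v : (ℤ → Fin d → ℝ) × (ℤ → Fin l → ℝ) => v.1 := measurable_fst
  have hσ : Measurable ((M.smoothRegion P T δ).indicator M.σ) :=
    hM.measurable_σ.indicator (measurableSet_smoothRegion hT)
  have hXt : ∀ t, Measurable fun v : (ℤ → Fin d → ℝ) × (ℤ → Fin l → ℝ) => v.1 t := by fun_prop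
  have h1 := hε.lintegral_sum_mul_kernelResidual_sq_le hM.measurable_ε
    (hM.measurable_X_process.prodMk hM.measurable_u_process) hM.indepFun_X_u_ε hx
    (p := fun v i => kernelResidual K h n v.1 (fun t => M.hfun (v.1 t) j + v.2 t j) i)
    (b := fun v t => (M.smoothRegion P T δ).indicator M.σ (v.1 t))
    (measurable_kernelResidual hK hx fun t =>
      ((measurable_pi_apply j).comp (hM.measurable_hfun.comp (hXt t))).add (by fun_prop))
    (fun t => hσ.comp (hXt t)) (fun v t => hB _) hC₁ hK hT.measurableSet hD hgood
  refine h1.trans ?_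
  have h2 := lintegral_kernelResidual_Z_sq_le (P := P) hM hK hC₁ hgood hH hL
  calc _ ≤ (Γ' : ℝ≥0∞) * (ENNReal.ofReal (B * (2 * (1 + C₁))) *
        ENNReal.ofReal (2 * (1 + C₁) * (2 * (H ^ 2 + Γ)) * n)) := by
        gcongr
        exact h2
    _ = _ := by
        rw [← ENNReal.ofReal_coe_nnreal, ← ENNReal.ofReal_mul (by positivity),
          ← ENNReal.ofReal_mul Γ'.coe_nonneg]
        congr 1
        ring

/-- The part of the empirical second moments of the noise that fluctuates. -/
theorem lintegral_centered_products_le (hM : M.Standing P) (hT : MeasurableSet T)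
    (hD : MeasurableSet D) {j j' : Fin l}
    (hL : BoundedLinearForms P (fun t ω => M.u t ω j * M.u t ω j' - M.covU P j j') Γ) :
    ∫⁻ ω, ENNReal.ofReal ((D.indicator (fun _ => (1 : ℝ)) (M.X · ω) *
      M.covarianceForm P T n j j' ω) ^ 2) ∂P ≤ ENNReal.ofReal (Γ * n) := by
  have hψ : Measurable fun (u : ℤ → Fin l → ℝ) t => u t j * u t j' - M.covU P j j' := by fun_prop
  have hind : IndepFun (fun ω t => M.X t ω)
      (fun ω t => M.u t ω j * M.u t ω j' - M.covU P j j') P :=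
    hM.indepFun_X_u.comp measurable_id hψ
  have hum : ∀ t, Measurable fun ω => M.u t ω j * M.u t ω j' - M.covU P j j' := fun t =>
    (((measurable_pi_apply j).comp (hM.measurable_u t)).mul
      ((measurable_pi_apply j').comp (hM.measurable_u t))).sub_const _
  have h1 := hL.random_coefficients hum hM.measurable_X_process hind
    (c := fun t x => D.indicator (fun _ => (1 : ℝ)) x * inside T x t)
    (fun t => (measurable_const.indicator hD).mul (measurable_inside hT t))
    (Finset.Icc (1 : ℤ) n)
  simp only [mul_assoc, ← Finset.mul_sum] at h1
  refine h1.trans ?_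
  calc _ ≤ (Γ : ℝ≥0∞) * ∫⁻ _, ENNReal.ofReal n ∂P := by
        gcongr with ω
        calc _ ≤ ∑ t ∈ Finset.Icc (1 : ℤ) n, (1 : ℝ) := by
              refine Finset.sum_le_sum fun t _ => ?_
              have h2 : D.indicator (fun _ => (1 : ℝ)) (M.X · ω) ≤ 1 :=
                indicator_le_self' (fun _ _ => zero_le_one) _
              exact pow_le_one₀ (mul_nonneg (indicator_one_nonneg D _) (inside_nonneg T t))
                (mul_le_one₀ h2 (inside_nonneg T t) (inside_le_one T t))
          _ = n := by rw [Finset.sum_const, card_Icc_one]; simp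
    _ = _ := by
        rw [lintegral_const, measure_univ, mul_one, ← ENNReal.ofReal_coe_nnreal,
          ← ENNReal.ofReal_mul Γ.coe_nonneg]

/-- The smoothed noise has a sum of squares of order `h ^ (-d)` in mean, which is of smaller order
than `n`. -/
theorem lintegral_smoothedNoise_le (hM : M.Standing P) (hK : IsKernel K) (hT : MeasurableSet T)
    (hC₂ : 0 ≤ C₂) (hh : 0 < h) (hD : MeasurableSet D)
    (hgood : ∀ y ∈ D, GoodDesign K T (P.map (M.X 0)).support C₁ C₂ c h n y) {j : Fin l}
    (hL : BoundedLinearForms P (fun t ω => M.u t ω j) Γ) :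
    ∫⁻ ω, ENNReal.ofReal (D.indicator (fun _ => (1 : ℝ)) (M.X · ω) *
      M.smoothedNoise K h T n j ω) ∂P ≤ ENNReal.ofReal (Γ * (C₂ / h ^ d)) := by
  rw [ENNReal.ofReal_mul Γ.coe_nonneg, ENNReal.ofReal_coe_nnreal]
  exact hL.lintegral_sum_smoothed_sq_le
    (fun t => (measurable_pi_apply j).comp (hM.measurable_u t)) hM.measurable_X_process
    (hM.indepFun_X_u.comp (φ := id) (ψ := fun (u : ℤ → Fin l → ℝ) t => u t j) measurable_id
      (by fun_prop)) hC₂ hh hK hT hD hgood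

end PLModel

/-! ### The estimation error on a good design -/

section QuadraticForm

open Matrix

variable {l : ℕ}

theorem abs_mul_apply_le_dotProduct_self (r : Fin l → ℝ) (j j' : Fin l) :
    |r j * r j'| ≤ r ⬝ᵥ r := by
  have h1 : ∀ j, r j ^ 2 ≤ r ⬝ᵥ r := fun j => by
    rw [sq]
    exact Finset.single_le_sum (f := fun j => r j * r j) (fun _ _ => mul_self_nonneg _)
      (Finset.mem_univ j)
  rw [abs_le]
  constructor <;> nlinarith [h1 j, h1 j', sq_nonneg (r j + r j'), sq_nonneg (r j - r j')]

/-- A weighted empirical second moment matrix that is entrywise close to a multiple of a matrix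
bounded below is itself bounded below. -/
theorem le_sum_mul_sq_of_close {I : Finset ℤ} {τ : ℤ → ℝ} {u : ℤ → Fin l → ℝ}
    {A : Matrix (Fin l) (Fin l) ℝ} {lam N E : ℝ} (hlam : 0 ≤ lam)
    (hA : ∀ r : Fin l → ℝ, lam * (r ⬝ᵥ r) ≤ r ⬝ᵥ A *ᵥ r) (hN : N ≤ ∑ i ∈ I, τ i) (hN0 : 0 ≤ N)
    (hE : ∀ j j', |∑ i ∈ I, τ i * (u i j * u i j' - A j j')| ≤ E) (r : Fin l → ℝ) :
    (N * lam - l ^ 2 * E) * (r ⬝ᵥ r) ≤ ∑ i ∈ I, τ i * (∑ j, u i j * r j) ^ 2 := by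
  have hr : 0 ≤ r ⬝ᵥ r := Finset.sum_nonneg fun _ _ => mul_self_nonneg _
  have h1 : ∑ i ∈ I, τ i * (∑ j, u i j * r j) ^ 2 =
      (∑ i ∈ I, τ i) * (r ⬝ᵥ A *ᵥ r) +
        ∑ j, ∑ j', r j * r j' * ∑ i ∈ I, τ i * (u i j * u i j' - A j j') := by
    have h2 : ∀ i, τ i * (∑ j, u i j * r j) ^ 2 = τ i * (r ⬝ᵥ A *ᵥ r) +
        ∑ j, ∑ j', r j * r j' * (τ i * (u i j * u i j' - A j j')) := fun i => by
      rw [sq, Finset.sum_mul_sum]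
      simp only [dotProduct, mulVec, Finset.mul_sum, ← Finset.sum_add_distrib]
      exact Finset.sum_congr rfl fun j _ => Finset.sum_congr rfl fun j' _ => by ring
    simp only [h2, Finset.sum_add_distrib, Finset.sum_mul, Finset.mul_sum]
    congr 1
    rw [Finset.sum_comm]
    exact Finset.sum_congr rfl fun j _ => Finset.sum_comm
  have h3 : |∑ j, ∑ j', r j * r j' * ∑ i ∈ I, τ i * (u i j * u i j' - A j j')| ≤
      l ^ 2 * E * (r ⬝ᵥ r) := by
    calc _ ≤ ∑ j, ∑ j', |r j * r j' * ∑ i ∈ I, τ i * (u i j * u i j' - A j j')| :=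
          (Finset.abs_sum_le_sum_abs _ _).trans
            (Finset.sum_le_sum fun _ _ => Finset.abs_sum_le_sum_abs _ _)
      _ ≤ ∑ _j : Fin l, ∑ _j' : Fin l, (r ⬝ᵥ r) * E := by
          refine Finset.sum_le_sum fun j _ => Finset.sum_le_sum fun j' _ => ?_
          rw [abs_mul]
          exact mul_le_mul (abs_mul_apply_le_dotProduct_self r j j') (hE j j') (abs_nonneg _) hr
      _ = _ := by simp; ring
  have h4 : N * (lam * (r ⬝ᵥ r)) ≤ (∑ i ∈ I, τ i) * (r ⬝ᵥ A *ᵥ r) :=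
    mul_le_mul hN (hA r) (mul_nonneg hlam hr) (hN0.trans hN)
  rw [h1]
  linarith [neg_abs_le (∑ j, ∑ j', r j * r j' * ∑ i ∈ I, τ i * (u i j * u i j' - A j j'))]

end QuadraticForm

namespace PLModel

open Matrix

variable {Ω : Type*} {d d' l : ℕ} {M : PLModel Ω d d' l} {K : (Fin d → ℝ) → ℝ} {h : ℝ} {n : ℕ}
  {T S : Set (Fin d → ℝ)} {C₁ C₂ c : ℝ} {ω : Ω}

/-- The factor `h ^ (-d)` of the kernel cancels in the weights. -/
theorem weight_eq_kernelWeight (hh : h ≠ 0) (i t : ℤ) :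
    M.weight K h n (M.X i ω) t ω = kernelWeight K h n (M.X · ω) i t := by
  rw [weight, kernelWeight, kernelSum, ← Finset.sum_div]
  exact div_div_div_cancel_right₀ (pow_ne_zero d hh) _ _

theorem Z_sub_Ztilde (hh : h ≠ 0) (i : ℤ) (j : Fin l) :
    (M.Z i ω - M.Ztilde K h n i ω) j = kernelResidual K h n (M.X · ω) (fun t => M.Z t ω j) i := by
  simp [Ztilde, kernelResidual, weight_eq_kernelWeight hh, Finset.sum_apply]

/-- The residual of `Y` by linearity; the kernel residual of `Zᵀβ` is exactly the residual of `Z`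
paired with `β`, which is why no error from the linear part remains. -/
theorem Y_sub_Ytilde (hh : h ≠ 0) (i : ℤ) :
    M.Y i ω - M.Ytilde K h n i ω =
      ∑ j, kernelResidual K h n (M.X · ω) (fun t => M.Z t ω j) i * M.β j +
      (kernelResidual K h n (M.X · ω) (fun t => M.μ (M.X t ω)) i +
        kernelResidual K h n (M.X · ω) (fun t => M.σ (M.X t ω) * M.ε t ω) i) := by
  rw [← kernelResidual_sum, ← kernelResidual_add, ← kernelResidual_add]
  simp [Ytilde, kernelResidual, weight_eq_kernelWeight hh, Y, dotProduct, add_assoc]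

/-- The estimation error of Robinson's estimator is the least squares regression of the residuals
of `μ(X) + σ(X) ε` on the residuals of `Z`. -/
theorem norm_betaHat_sub_le_of_quadraticForm (hh : h ≠ 0) {κ : ℝ} (hκ : 0 < κ)
    (hA : ∀ r : Fin l → ℝ, κ * (r ⬝ᵥ r) ≤ ∑ i ∈ Finset.Icc (1 : ℤ) n, inside T (M.X · ω) i *
      (∑ j, kernelResidual K h n (M.X · ω) (fun t => M.Z t ω j) i * r j) ^ 2) :
    ‖M.betaHat K h T n ω - M.β‖ ≤ (∑ j, |∑ i ∈ Finset.Icc (1 : ℤ) n, inside T (M.X · ω) i *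
      ((kernelResidual K h n (M.X · ω) (fun t => M.μ (M.X t ω)) i +
        kernelResidual K h n (M.X · ω) (fun t => M.σ (M.X t ω) * M.ε t ω) i) *
        kernelResidual K h n (M.X · ω) (fun t => M.Z t ω j) i)|) / κ := by
  classical
  set I := Finset.Icc (1 : ℤ) n
  set τ : ℤ → ℝ := inside T (M.X · ω)
  set ρ : ℤ → Fin l → ℝ := fun i j => kernelResidual K h n (M.X · ω) (fun t => M.Z t ω j) i
  set e : ℤ → ℝ := fun i => kernelResidual K h n (M.X · ω) (fun t => M.μ (M.X t ω)) i +
    kernelResidual K h n (M.X · ω) (fun t => M.σ (M.X t ω) * M.ε t ω) i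
  set A : Matrix (Fin l) (Fin l) ℝ := Matrix.of fun j j' => ∑ i ∈ I, τ i * (ρ i j * ρ i j')
  set b : Fin l → ℝ := fun j => ∑ i ∈ I, τ i * ((∑ j', ρ i j' * M.β j' + e i) * ρ i j)
  have hZ : ∀ i, M.Z i ω - M.Ztilde K h n i ω = ρ i := fun i => funext fun j => Z_sub_Ztilde hh i j
  have hY : ∀ i, M.Y i ω - M.Ytilde K h n i ω = ∑ j', ρ i j' * M.β j' + e i :=
    fun i => Y_sub_Ytilde hh i
  have hite : ∀ i (z : ℝ), (if M.X i ω ∈ T then z else 0) = τ i * z := fun i z => by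
    split_ifs with hi
    · rw [show τ i = 1 from inside_of_mem (x := (M.X · ω)) hi, one_mul]
    · rw [show τ i = 0 from inside_of_notMem (x := (M.X · ω)) hi, zero_mul]
  have hAeq : (∑ i ∈ I, if M.X i ω ∈ T then vecMulVec (ρ i) (ρ i) else 0) = A := by
    ext j j'
    rw [Matrix.sum_apply]
    refine Finset.sum_congr rfl fun i _ => ?_
    rw [← hite]
    split_ifs <;> rfl
  have hbeq : (∑ i ∈ I, if M.X i ω ∈ T then (∑ j', ρ i j' * M.β j' + e i) • ρ i else 0) = b := by
    ext j
    rw [Finset.sum_apply]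
    refine Finset.sum_congr rfl fun i _ => ?_
    rw [← hite]
    split_ifs <;> rfl
  have hbeta : M.betaHat K h T n ω = A⁻¹ *ᵥ b := by
    rw [← hAeq, ← hbeq, betaHat]
    simp only [hZ, hY]
    congr!
  have hmul : ∀ (r : Fin l → ℝ) j, (A *ᵥ r) j = ∑ i ∈ I, τ i * ((∑ j', ρ i j' * r j') * ρ i j) :=
    fun r j => by
      simp only [mulVec, dotProduct, A, Matrix.of_apply, Finset.sum_mul, Finset.mul_sum]
      rw [Finset.sum_comm]
      exact Finset.sum_congr rfl fun i _ => Finset.sum_congr rfl fun j' _ => by ring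
  have hquad : ∀ r : Fin l → ℝ, r ⬝ᵥ A *ᵥ r = ∑ i ∈ I, τ i * (∑ j, ρ i j * r j) ^ 2 := fun r => by
    simp only [dotProduct, hmul, Finset.mul_sum (Finset.univ) _ _, sq, Finset.mul_sum I]
    rw [Finset.sum_comm]
    refine Finset.sum_congr rfl fun i _ => ?_
    exact Finset.sum_congr rfl fun j _ => by ring
  rw [hbeta]
  refine (norm_inv_mulVec_sub_le hκ (fun r => (hA r).trans_eq (hquad r).symm) b M.β).trans_eq ?_
  congr 1
  refine Finset.sum_congr rfl fun j _ => ?_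
  rw [Pi.sub_apply, hmul]
  rw [← Finset.sum_sub_distrib]
  congr 1
  exact Finset.sum_congr rfl fun i _ => by ring

variable [MeasurableSpace Ω] {P : Measure Ω} {δ : ℝ}

/-- On a good design, the error of Robinson's estimator is controlled by the bandwidth and by the
sizes of the random forms in the noise. -/
theorem norm_betaHat_sub_le (hK : IsKernel K) (hh : 0 < h) (hhδ : h ≤ δ)
    (hX : GoodDesign K T (P.map (M.X 0)).support C₁ C₂ c h n (M.X · ω)) (hc : 0 ≤ c) {L : ℝ≥0}
    (hμ : LipschitzOnWith L M.μ (M.smoothRegion P T δ))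
    (hH : LipschitzOnWith L M.hfun (M.smoothRegion P T δ)) {lam E R κ : ℝ} (hlam : 0 ≤ lam)
    (hcov : ∀ r : Fin l → ℝ, lam * (r ⬝ᵥ r) ≤ r ⬝ᵥ M.covU P *ᵥ r)
    (h₁ : ∀ j, |M.trendForm K h T n j ω| ≤ E)
    (h₂ : ∀ j, |M.errorForm (M.smoothRegion P T δ) K h T n j ω| ≤ E)
    (h₃ : ∀ j j', |M.covarianceForm P T n j j' ω| ≤ E)
    (h₄ : ∀ j, M.smoothedNoise K h T n j ω ≤ R)
    (hκ : 0 < κ)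
    (hκle : κ ≤ (c * n * lam - l ^ 2 * E) / 2 - 2 * l * ((L * h) ^ 2 * n + R)) :
    ‖M.betaHat K h T n ω - M.β‖ ≤ l * ((L * h) ^ 2 * n + 2 * E) / κ := by
  simp only [trendForm, errorForm, covarianceForm, smoothedNoise] at h₁ h₂ h₃ h₄
  set I := Finset.Icc (1 : ℤ) n
  set x : ℤ → Fin d → ℝ := (M.X · ω)
  have hτ : ∀ i, 0 ≤ inside T x i := fun i => inside_nonneg T i
  have hHj : ∀ j, LipschitzOnWith L (fun z => M.hfun z j) (M.smoothRegion P T δ) := fun j z hz z' hz' =>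
    (edist_le_pi_edist (M.hfun z) (M.hfun z') j).trans (hH hz hz')
  have hbias : ∀ {φ : (Fin d → ℝ) → ℝ}, LipschitzOnWith L φ (M.smoothRegion P T δ) → ∀ i ∈ I,
      x i ∈ T → |kernelResidual K h n x (fun t => φ (x t)) i| ≤ L * h := fun hφ i hi hiT =>
    abs_kernelResidual_le_of_lipschitzOnWith hK hh hhδ hX hφ hi hiT
  -- a sum over covariates in `T` of terms bounded by `B`
  have hsum : ∀ (q : ℤ → ℝ) (B : ℝ), 0 ≤ B → (∀ i ∈ I, x i ∈ T → q i ≤ B) →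
      ∑ i ∈ I, inside T x i * q i ≤ B * n := fun q B hB0 hq => by
    calc _ ≤ ∑ i ∈ I, B := by
          refine Finset.sum_le_sum fun i hi => ?_
          by_cases hiT : x i ∈ T
          · rw [inside_of_mem hiT, one_mul]
            exact hq i hi hiT
          · rw [inside_of_notMem hiT, zero_mul]
            exact hB0
      _ = B * n := by rw [Finset.sum_const, card_Icc_one, nsmul_eq_mul, mul_comm]
  have hZ : ∀ j i, kernelResidual K h n x (fun t => M.Z t ω j) i =
      kernelResidual K h n x (fun t => M.hfun (x t) j) i +
        kernelResidual K h n x (fun t => M.u t ω j) i := fun j i => kernelResidual_add _ _ i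
  refine (norm_betaHat_sub_le_of_quadraticForm hh.ne' hκ fun r => ?_).trans ?_
  · have hr : 0 ≤ r ⬝ᵥ r := Finset.sum_nonneg fun _ _ => mul_self_nonneg _
    set V : ℤ → Fin l → ℝ := fun i j => kernelResidual K h n x (fun t => M.hfun (x t) j) i -
      ∑ t ∈ I, kernelWeight K h n x i t * M.u t ω j
    -- the residual of `Z` is `u + V`, and `(p + q) ^ 2 ≥ p ^ 2 / 2 - q ^ 2`
    have h5 : ∀ i, (∑ j, M.u i ω j * r j) ^ 2 / 2 - (∑ j, V i j ^ 2) * (r ⬝ᵥ r) ≤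
        (∑ j, kernelResidual K h n x (fun t => M.Z t ω j) i * r j) ^ 2 := fun i => by
      have h6 : ∑ j, kernelResidual K h n x (fun t => M.Z t ω j) i * r j =
          ∑ j, M.u i ω j * r j + ∑ j, V i j * r j := by
        rw [← Finset.sum_add_distrib]
        refine Finset.sum_congr rfl fun j _ => ?_
        rw [hZ]
        simp only [V, kernelResidual]
        ring
      have h7 : (∑ j, V i j * r j) ^ 2 ≤ (∑ j, V i j ^ 2) * (r ⬝ᵥ r) := by
        have := Finset.sum_mul_sq_le_sq_mul_sq Finset.univ (V i) r
        simpa only [dotProduct, ← sq] using this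
      rw [h6]
      nlinarith [sq_nonneg (∑ j, M.u i ω j * r j + 2 * ∑ j, V i j * r j)]
    have h8 : ∑ i ∈ I, inside T x i * ∑ j, V i j ^ 2 ≤ 2 * l * ((L * h) ^ 2 * n + R) := by
      have h9 : ∀ j, ∑ i ∈ I, inside T x i * V i j ^ 2 ≤ 2 * ((L * h) ^ 2 * n + R) := fun j => by
        calc _ ≤ ∑ i ∈ I, inside T x i *
              (2 * (kernelResidual K h n x (fun t => M.hfun (x t) j) i ^ 2 +
                (∑ t ∈ I, kernelWeight K h n x i t * M.u t ω j) ^ 2)) :=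
              Finset.sum_le_sum fun i _ =>
                mul_le_mul_of_nonneg_left (sub_sq_le_two_mul_add _ _) (hτ i)
          _ = 2 * (∑ i ∈ I, inside T x i *
                kernelResidual K h n x (fun t => M.hfun (x t) j) i ^ 2 +
              ∑ i ∈ I, inside T x i *
                (∑ t ∈ I, kernelWeight K h n x i t * M.u t ω j) ^ 2) := by
              rw [← Finset.sum_add_distrib, Finset.mul_sum]
              exact Finset.sum_congr rfl fun i _ => by ring
          _ ≤ _ := by
              gcongr
              · refine hsum _ _ (sq_nonneg _) fun i hi hiT => ?_
                rw [← sq_abs]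
                exact pow_le_pow_left₀ (abs_nonneg _) (hbias (hHj j) i hi hiT) 2
              · exact h₄ j
      simp only [Finset.mul_sum Finset.univ]
      rw [Finset.sum_comm]
      refine (Finset.sum_le_card_nsmul _ _ _ fun j _ => h9 j).trans_eq ?_
      rw [Finset.card_univ, Fintype.card_fin, nsmul_eq_mul]
      ring
    have h10 := le_sum_mul_sq_of_close hlam hcov hX.le_count (by positivity) h₃ r
    calc κ * (r ⬝ᵥ r) ≤ ((c * n * lam - l ^ 2 * E) / 2 - 2 * l * ((L * h) ^ 2 * n + R)) *
          (r ⬝ᵥ r) := by gcongr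
      _ ≤ (∑ i ∈ I, inside T x i * (∑ j, M.u i ω j * r j) ^ 2) / 2 -
          (∑ i ∈ I, inside T x i * ∑ j, V i j ^ 2) * (r ⬝ᵥ r) := by
          have h11 := mul_le_mul_of_nonneg_right h8 hr
          rw [sub_mul]
          linarith
      _ = ∑ i ∈ I, inside T x i *
          ((∑ j, M.u i ω j * r j) ^ 2 / 2 - (∑ j, V i j ^ 2) * (r ⬝ᵥ r)) := by
          rw [Finset.sum_div, Finset.sum_mul, ← Finset.sum_sub_distrib]
          exact Finset.sum_congr rfl fun i _ => by ring
      _ ≤ _ := Finset.sum_le_sum fun i _ => mul_le_mul_of_nonneg_left (h5 i) (hτ i)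
  · refine div_le_div_of_nonneg_right ?_ hκ.le
    -- bias times bias, bias times noise, and the form in the errors
    have h12 : ∀ j, |∑ i ∈ I, inside T x i *
        ((kernelResidual K h n x (fun t => M.μ (M.X t ω)) i +
          kernelResidual K h n x (fun t => M.σ (M.X t ω) * M.ε t ω) i) *
          kernelResidual K h n x (fun t => M.Z t ω j) i)| ≤ (L * h) ^ 2 * n + 2 * E := fun j => by
      set m : ℤ → ℝ := kernelResidual K h n x fun t => M.μ (M.X t ω)
      set s' : ℤ → ℝ := kernelResidual K h n x
        fun t => (M.smoothRegion P T δ).indicator M.σ (M.X t ω) * M.ε t ω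
      have h13 : ∀ i ∈ I, inside T x i *
          ((m i + kernelResidual K h n x (fun t => M.σ (M.X t ω) * M.ε t ω) i) *
            kernelResidual K h n x (fun t => M.Z t ω j) i) =
          inside T x i * (m i * kernelResidual K h n x (fun t => M.hfun (x t) j) i) +
          (inside T x i * (m i * kernelResidual K h n x (fun t => M.u t ω j) i) +
          inside T x i * (kernelResidual K h n x (fun t => M.Z t ω j) i * s' i)) :=
        fun i hi => by
        by_cases hiT : x i ∈ T
        · have h14 : kernelResidual K h n x (fun t => M.σ (M.X t ω) * M.ε t ω) i = s' i := by
            have h15 : ∀ t, x t ∈ M.smoothRegion P T δ → M.σ (M.X t ω) * M.ε t ω =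
                (M.smoothRegion P T δ).indicator M.σ (M.X t ω) * M.ε t ω := fun t ht => by
              rw [indicator_of_mem (show M.X t ω ∈ _ from ht)]
            exact kernelResidual_congr hK hh (h15 i (Or.inl hiT)) fun t ht hit =>
              h15 t (mem_smoothRegion_of_norm_sub_le hiT hhδ hit (hX.mem_support t ht))
          rw [h14, inside_of_mem hiT]
          simp only [hZ]
          ring
        · simp [inside_of_notMem hiT]
      rw [Finset.sum_congr rfl h13, Finset.sum_add_distrib, Finset.sum_add_distrib]
      have h16 : |∑ i ∈ I, inside T x i *
          (m i * kernelResidual K h n x (fun t => M.hfun (x t) j) i)| ≤ (L * h) ^ 2 * n := by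
        refine (Finset.abs_sum_le_sum_abs _ _).trans ?_
        simp only [abs_mul, abs_of_nonneg (hτ _)]
        refine hsum _ _ (sq_nonneg _) fun i hi hiT => ?_
        rw [sq]
        exact mul_le_mul (hbias hμ i hi hiT) (hbias (hHj j) i hi hiT) (abs_nonneg _)
          (by positivity)
      refine (abs_add_le _ _).trans ?_
      have h17 := abs_add_le (∑ i ∈ I, inside T x i * (m i *
        kernelResidual K h n x (fun t => M.u t ω j) i)) (∑ i ∈ I, inside T x i *
          (kernelResidual K h n x (fun t => M.Z t ω j) i * s' i))
      linarith [h₁ j, h₂ j]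
    refine (Finset.sum_le_card_nsmul _ _ _ fun j _ => h12 j).trans_eq ?_
    rw [Finset.card_univ, Fintype.card_fin, nsmul_eq_mul]

/-- The bound for the error if the random forms are of the order of `√n`. -/
theorem norm_betaHat_sub_mul_sqrt_le (hK : IsKernel K) (hh : 0 < h) (hhδ : h ≤ δ)
    (hX : GoodDesign K T (P.map (M.X 0)).support C₁ C₂ c h n (M.X · ω)) (hc : 0 < c) {L : ℝ≥0}
    (hμ : LipschitzOnWith L M.μ (M.smoothRegion P T δ))
    (hH : LipschitzOnWith L M.hfun (M.smoothRegion P T δ)) {lam a : ℝ} (hlam : 0 < lam)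
    (hcov : ∀ r : Fin l → ℝ, lam * (r ⬝ᵥ r) ≤ r ⬝ᵥ M.covU P *ᵥ r) (hn : 1 ≤ n)
    (hband : h ^ 4 * n ≤ 1) (hlarge : 4 * l ^ 2 * a / (c * lam) ≤ √n)
    (hsmall : 2 * l * (L * h) ^ 2 ≤ c * lam / 16)
    (h₁ : ∀ j, |M.trendForm K h T n j ω| ≤ a * √n)
    (h₂ : ∀ j, |M.errorForm (M.smoothRegion P T δ) K h T n j ω| ≤ a * √n)
    (h₃ : ∀ j j', |M.covarianceForm P T n j j' ω| ≤ a * √n)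
    (h₄ : ∀ j, M.smoothedNoise K h T n j ω ≤ c * lam / (32 * l) * n) :
    ‖M.betaHat K h T n ω - M.β‖ * √n ≤ 8 * l * (L ^ 2 + 2 * a) / (c * lam) := by
  have hn0 : (0 : ℝ) < n := by exact_mod_cast hn
  have hs0 : 0 < √(n : ℝ) := Real.sqrt_pos.2 hn0
  have hsq : √(n : ℝ) * √n = n := Real.mul_self_sqrt hn0.le
  -- of the main part `c * lam * n / 2`, the fluctuations take at most a quarter, the bias and the
  -- smoothed noise an eighth each
  have hκ : c * lam * n / 8 ≤ (c * n * lam - l ^ 2 * (a * √n)) / 2 -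
      2 * l * ((L * h) ^ 2 * n + c * lam / (32 * l) * n) := by
    have e1 : l ^ 2 * (a * √n) ≤ c * lam * n / 4 := by
      rw [div_le_iff₀ (by positivity)] at hlarge
      have e0 := mul_le_mul_of_nonneg_right hlarge hs0.le
      have e0' : √(n : ℝ) * (c * lam) * √n = c * lam * (√n * √n) := by ring
      rw [e0', hsq] at e0
      linarith
    have e2 : 2 * l * ((L * h) ^ 2 * n) ≤ c * lam / 16 * n := by
      rw [← mul_assoc]
      gcongr
    have e3 : 2 * l * (c * lam / (32 * l) * n) ≤ c * lam * n / 16 := by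
      rcases Nat.eq_zero_or_pos l with hl | hl
      · rw [hl, Nat.cast_zero]
        simp only [mul_zero, zero_mul]
        positivity
      · have hl0 : (0 : ℝ) < l := by exact_mod_cast hl
        apply le_of_eq
        field_simp
        norm_num
    have e4 : 0 ≤ c * lam * n := by positivity
    rw [mul_add (2 * (l : ℝ))]
    linarith
  have hmain := norm_betaHat_sub_le hK hh hhδ hX hc.le hμ hH hlam.le hcov h₁ h₂ h₃ h₄
    (by positivity) hκ
  have hbias : (L * h) ^ 2 * n ≤ L ^ 2 * √n := by
    have e5 : h ^ 2 * √n ≤ 1 := by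
      rw [← sq_le_one_iff₀ (by positivity), mul_pow, Real.sq_sqrt hn0.le, ← pow_mul]
      exact hband
    calc (L * h) ^ 2 * n = L ^ 2 * (h ^ 2 * √n) * √n := by
          rw [mul_pow]
          nth_rw 1 [← hsq]
          ring
      _ ≤ L ^ 2 * 1 * √n := by gcongr
      _ = _ := by rw [mul_one]
  calc _ ≤ l * ((L * h) ^ 2 * n + 2 * (a * √n)) / (c * lam * n / 8) * √n := by gcongr
    _ ≤ l * (L ^ 2 * √n + 2 * (a * √n)) / (c * lam * n / 8) * √n := by gcongr
    _ = 8 * l * (L ^ 2 + 2 * a) / (c * lam) * (√n * √n / n) := by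
        field_simp
    _ = 8 * l * (L ^ 2 + 2 * a) / (c * lam) := by rw [hsq, div_self hn0.ne', mul_one]

end PLModel

/-! ### Markov's inequality and the rate -/

section Markov

variable {Ω ι : Type*} [MeasurableSpace Ω] [Fintype ι] {P : Measure Ω} [IsProbabilityMeasure P]

theorem measureReal_exists_ge_le {F : ι → Ω → ℝ} (hF : ∀ i, Measurable (F i)) {B e : ℝ}
    (hB : 0 ≤ B) (he : 0 < e) (h : ∀ i, ∫⁻ ω, ENNReal.ofReal (F i ω) ∂P ≤ ENNReal.ofReal B) :
    P.real {ω | ∃ i, e ≤ F i ω} ≤ Fintype.card ι * (B / e) := by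
  have hsub : {ω | ∃ i, e ≤ F i ω} = ⋃ i ∈ (Finset.univ : Finset ι), {ω | e ≤ F i ω} := by
    ext ω
    simp
  rw [hsub]
  refine (measureReal_biUnion_finset_le _ _).trans ?_
  rw [← nsmul_eq_mul, Fintype.card]
  exact Finset.sum_le_card_nsmul _ _ _ fun i _ =>
    PLModel.measureReal_le_of_lintegral_le (hF i) he hB (h i) fun ω hω => hω

/-- Finitely many variables with second moments of order `n` are simultaneously of order `√n`. -/
theorem measureReal_exists_abs_gt_le {F : ι → Ω → ℝ} (hF : ∀ i, Measurable (F i)) {B : ℝ} {n : ℕ}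
    (hn : 1 ≤ n) {lam : ℝ} (hB : 0 ≤ B) (hlam : 0 < lam)
    (h : ∀ i, ∫⁻ ω, ENNReal.ofReal (F i ω ^ 2) ∂P ≤ ENNReal.ofReal (B * n)) :
    P.real {ω | ∃ i, lam * √n < |F i ω|} ≤ Fintype.card ι * B / lam ^ 2 := by
  have hn0 : (0 : ℝ) < n := by exact_mod_cast hn
  have h1 := measureReal_exists_ge_le (fun i => (hF i).pow_const 2) (by positivity)
    (e := (lam * √n) ^ 2) (by positivity) h
  refine (measureReal_mono ?_ (measure_ne_top _ _)).trans (h1.trans_eq ?_)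
  · rintro ω ⟨i, hi⟩
    exact ⟨i, by rw [← sq_abs (F i ω)]; gcongr⟩
  · rw [mul_pow, Real.sq_sqrt hn0.le]
    field_simp

end Markov

namespace PLModel

variable {Ω : Type*} [MeasurableSpace Ω] {P : Measure Ω} [IsProbabilityMeasure P] {d d' l : ℕ}
  {M : PLModel Ω d d' l} {T : Set (Fin d → ℝ)} {K : (Fin d → ℝ) → ℝ} {h : ℝ} {n : ℕ}
  {D : Set (ℤ → Fin d → ℝ)}

theorem measurable_indicator_mul_sum_inside (hM : M.Standing P) (hT : MeasurableSet T)
    (hD : MeasurableSet D) {q : Ω → ℤ → ℝ} (hq : ∀ i, Measurable fun ω => q ω i) :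
    Measurable fun ω => D.indicator (fun _ => (1 : ℝ)) (M.X · ω) *
      ∑ i ∈ Finset.Icc (1 : ℤ) n, inside T (M.X · ω) i * q ω i :=
  ((measurable_const.indicator hD).comp hM.measurable_X_process).mul
    (Finset.measurable_fun_sum _ fun i _ =>
      ((measurable_inside hT i).comp hM.measurable_X_process).mul (hq i))

theorem measurable_indicator_mul_trendForm (hM : M.Standing P) (hK : IsKernel K)
    (hT : MeasurableSet T) (hD : MeasurableSet D) (j : Fin l) :
    Measurable fun ω => D.indicator (fun _ => (1 : ℝ)) (M.X · ω) * M.trendForm K h T n j ω :=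
  measurable_indicator_mul_sum_inside hM hT hD fun i =>
    (measurable_kernelResidual hK hM.measurable_X_process
      (fun t => hM.measurable_μ.comp (hM.measurable_X t)) i).mul
    (measurable_kernelResidual hK hM.measurable_X_process
      (fun t => (measurable_pi_apply j).comp (hM.measurable_u t)) i)

theorem measurable_indicator_mul_errorForm (hM : M.Standing P) (hK : IsKernel K)
    (hT : MeasurableSet T) {U : Set (Fin d → ℝ)} (hU : MeasurableSet U) (hD : MeasurableSet D)
    (j : Fin l) :
    Measurable fun ω => D.indicator (fun _ => (1 : ℝ)) (M.X · ω) * M.errorForm U K h T n j ω :=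
  measurable_indicator_mul_sum_inside hM hT hD fun i =>
    (measurable_kernelResidual hK hM.measurable_X_process
      (fun t => ((measurable_pi_apply j).comp (hM.measurable_hfun.comp (hM.measurable_X t))).add
        ((measurable_pi_apply j).comp (hM.measurable_u t))) i).mul
    (measurable_kernelResidual hK hM.measurable_X_process
      (fun t => ((hM.measurable_σ.indicator hU).comp (hM.measurable_X t)).mul
        (hM.measurable_ε t)) i)

theorem measurable_indicator_mul_covarianceForm (hM : M.Standing P) (hT : MeasurableSet T)
    (hD : MeasurableSet D) (j j' : Fin l) :
    Measurable fun ω => D.indicator (fun _ => (1 : ℝ)) (M.X · ω) * M.covarianceForm P T n j j' ω :=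
  measurable_indicator_mul_sum_inside hM hT hD fun i =>
    (((measurable_pi_apply j).comp (hM.measurable_u i)).mul
      ((measurable_pi_apply j').comp (hM.measurable_u i))).sub_const _

theorem measurable_indicator_mul_smoothedNoise (hM : M.Standing P) (hK : IsKernel K)
    (hT : MeasurableSet T) (hD : MeasurableSet D) (j : Fin l) :
    Measurable fun ω => D.indicator (fun _ => (1 : ℝ)) (M.X · ω) * M.smoothedNoise K h T n j ω :=
  measurable_indicator_mul_sum_inside hM hT hD fun i =>
    (Finset.measurable_fun_sum (Finset.Icc (1 : ℤ) n) fun t _ =>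
      ((measurable_kernelWeight hK i t).comp hM.measurable_X_process).mul
        ((measurable_pi_apply j).comp (hM.measurable_u t))).pow_const 2

end PLModel

end

theorem proposition1 {Ω : Type*} [MeasurableSpace Ω] (P : Measure Ω) [IsProbabilityMeasure P]
    {d d' l : ℕ} (hd : 1 ≤ d) (hd' : 1 ≤ d') (hl : 1 ≤ l)
    (M : PLModel Ω d d' l) (hM : M.Standing P)
    (lo hi : Fin d → ℝ) (hlohi : ∀ j, lo j < hi j)
    (δ : ℝ) (hδ : 0 < δ) (h_trend : M.TrendVolatility P (Icc lo hi) δ)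
    (K : (Fin d → ℝ) → ℝ) (hK : IsKernel K) (h : ℕ → ℝ) (hh : IsBandwidth d h)
    (q : ℝ) (h_moment : M.ErrorMoment P q)
    (ζ : ℝ) (h_error : M.ErrorDependence ζ)
    (g : (Fin d → ℝ) → ℝ) (hg : M.IsDensity P g)
    (G : (Fin d → ℝ) → (ℕ → (Fin d' → ℝ)) → ℝ) (hG : M.IsCondDensity P G)
    (s ξ : ℝ) (h_cov : M.CovariateDependence P G (Icc lo hi) s ξ)
    (h_density : DensityRegular g lo hi)
    (p : ℝ) (h_design : M.RandomDesign P (Icc lo hi) δ p)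
    (h_defined : 0 < K 0 ∨ Tendsto (fun n : ℕ => Real.log n / (h n ^ d * n)) atTop (𝓝 0))
    (h_band : Tendsto (fun n : ℕ => h n ^ 4 * n) atTop (𝓝 0)) :
    IsBigOP P (fun n ω => ‖M.betaHat K (h n) (Icc lo hi) n ω - M.β‖)
      (fun n => 1 / Real.sqrt n) := by
  set T : Set (Fin d → ℝ) := Icc lo hi
  have hTc : IsClosed T := isClosed_Icc
  have hTm : MeasurableSet T := measurableSet_Icc
  obtain ⟨C₁, C₂, c, hC₁, hC₂, hc, hgood⟩ :=
    PLModel.exists_goodDesign hM hG hg hlohi h_cov h_density hK hh h_defined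
  obtain ⟨Γ, hΓ⟩ := PLModel.exists_boundedLinearForms_u hM h_design
  obtain ⟨Γ₂, hΓ₂⟩ := PLModel.exists_boundedLinearForms_u_mul_u hM h_design
  obtain ⟨Γ', hΓ'⟩ := PLModel.exists_boundedLinearForms_ε hM h_moment h_error
  obtain ⟨Lμ, hLμ⟩ := h_trend.lipschitz_μ
  obtain ⟨LH, hLH⟩ := h_design.lipschitz
  obtain ⟨Lσ, hLσ⟩ := h_trend.lipschitz_σ
  obtain ⟨σ₀, σ₁, hσ₀, hσ⟩ := h_trend.bounds_σ
  obtain ⟨B, hB⟩ := PLModel.exists_sq_indicator_smoothRegion_le (M := M) (P := P) isCompact_Icc hδ.le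
    hLσ (B := σ₁) fun y hy => by
      rw [abs_of_pos (hσ₀.trans_le (hσ y hy).1)]
      exact (hσ y hy).2
  have hB0 : 0 ≤ B := (sq_nonneg _).trans (hB 0)
  obtain ⟨H, hH⟩ := h_design.bounded
  obtain ⟨lam, hlam, heig⟩ := h_design.eigenvalue
  set L : ℝ≥0 := max Lμ LH
  have hμ : LipschitzOnWith L M.μ (M.smoothRegion P T δ) := hLμ.weaken (le_max_left _ _)
  have hHL : LipschitzOnWith L M.hfun (M.smoothRegion P T δ) := hLH.weaken (le_max_right _ _)
  have hcov : ∀ r : Fin l → ℝ, lam * (r ⬝ᵥ r) ≤ r ⬝ᵥ (M.covU P).mulVec r := by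
    refine le_dotProduct_mulVec_of_eigenvalues ?_ heig
    ext j j'
    simp [PLModel.covU, Matrix.conjTranspose_apply, mul_comm]
  have hl0 : (0 : ℝ) < l := by exact_mod_cast hl
  -- the constants in the second moments of the random forms
  set B₁ : ℝ := Γ * (2 * (1 + C₁) * L ^ 2)
  set B₂ : ℝ := Γ' * (B * (2 * (1 + C₁)) * (2 * (1 + C₁) * (2 * (H ^ 2 + Γ))))
  have hB₁ : 0 ≤ B₁ := by positivity
  have hB₂ : 0 ≤ B₂ := by positivity
  set ρ : ℝ := c * lam / (32 * l)
  have hρ : 0 < ρ := by positivity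
  intro ε hε
  set B₀ : ℝ := l * B₁ + l * B₂ + l * l * Γ₂
  have hB₀ : 0 ≤ B₀ := by positivity
  -- the threshold `a * √n` for the random forms
  set a : ℝ := 1 + 4 * B₀ / ε
  have ha1 : 1 ≤ a := le_add_of_nonneg_right (by positivity)
  have ha0 : 0 < a := one_pos.trans_le ha1
  have haε : B₀ / a ^ 2 ≤ ε / 4 := by
    rw [div_le_iff₀ (by positivity)]
    have h1 : 4 * B₀ / ε ≤ a ^ 2 := by
      have : a ≤ a ^ 2 := by nlinarith
      linarith
    rw [div_le_iff₀ hε] at h1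
    linarith
  refine ⟨8 * l * (L ^ 2 + 2 * a) / (c * lam) + 1, by positivity, ?_⟩
  have hsmall : Tendsto (fun n => 2 * l * (L * h n) ^ 2) atTop (𝓝 (2 * l * ((L : ℝ) * 0) ^ 2)) :=
    ((hh.tendsto_zero.const_mul (L : ℝ)).pow 2).const_mul _
  rw [mul_zero, zero_pow two_ne_zero, mul_zero] at hsmall
  have hsqrt : Tendsto (fun n : ℕ => √(n : ℝ)) atTop atTop :=
    Real.tendsto_sqrt_atTop.comp tendsto_natCast_atTop_atTop
  filter_upwards [hgood (ε / 8) (by positivity), hh.tendsto_zero.eventually_le_const one_pos,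
    hh.tendsto_zero.eventually_le_const hδ, h_band.eventually_le_const one_pos,
    eventually_ge_atTop 1, hsqrt.eventually_ge_atTop (4 * l ^ 2 * a / (c * lam)),
    hsmall.eventually_le_const (show 0 < c * lam / 16 by positivity),
    (PLModel.tendsto_inverse_bandwidth hh (l * (Γ * C₂) / ρ)).eventually_le_const
      (show 0 < ε / 8 by positivity)]
    with n hn1 hn2 hn3 hn4 hn5 hn6 hn7 hn8
  have hhn := hh.pos n
  have hn0 : (0 : ℝ) < n := by exact_mod_cast hn5
  set D : Set (ℤ → Fin d → ℝ) :=
    {x | GoodDesign K T (P.map (M.X 0)).support C₁ C₂ c (h n) n x}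
  have hDm : MeasurableSet D :=
    measurableSet_goodDesign hK hTm Measure.isClosed_support.measurableSet C₁ C₂ c
  have hD : ∀ y ∈ D, GoodDesign K T (P.map (M.X 0)).support C₁ C₂ c (h n) n y := fun y hy => hy
  set γ : Ω → ℝ := fun ω => D.indicator (fun _ => (1 : ℝ)) (M.X · ω)
  have p₁ := measureReal_exists_abs_gt_le (F := fun j ω => γ ω * M.trendForm K (h n) T n j ω)
    (PLModel.measurable_indicator_mul_trendForm hM hK hTm hDm) hn5 hB₁ ha0 fun j =>
      PLModel.lintegral_trend_bias_mul_noise_le hM hK hTm hC₁ hDm hD hhn hn2 hn3 hμ (hΓ j)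
  have p₂ := measureReal_exists_abs_gt_le
    (F := fun j ω => γ ω * M.errorForm (M.smoothRegion P T δ) K (h n) T n j ω)
    (PLModel.measurable_indicator_mul_errorForm hM hK hTm
      (PLModel.measurableSet_smoothRegion hTc) hDm) hn5 hB₂ ha0
    fun j => PLModel.lintegral_residual_Z_mul_error_le hM hK hTc hC₁ hDm hD hH (hΓ j) hΓ' hB
  have p₃ := measureReal_exists_abs_gt_le
    (F := fun (j : Fin l × Fin l) ω => γ ω * M.covarianceForm P T n j.1 j.2 ω)
    (fun j => PLModel.measurable_indicator_mul_covarianceForm hM hTm hDm j.1 j.2)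
    hn5 Γ₂.coe_nonneg ha0
    fun j => PLModel.lintegral_centered_products_le hM hTm hDm (hΓ₂ j.1 j.2)
  have p₄ := measureReal_exists_ge_le (F := fun j ω => γ ω * M.smoothedNoise K (h n) T n j ω)
    (PLModel.measurable_indicator_mul_smoothedNoise hM hK hTm hDm)
    (B := Γ * (C₂ / h n ^ d)) (by positivity) (e := ρ * n) (by positivity)
    fun j => PLModel.lintegral_smoothedNoise_le hM hK hTm hC₂ hhn hDm hD (hΓ j)
  simp only [Fintype.card_fin, Fintype.card_prod, Nat.cast_mul] at p₁ p₂ p₃ p₄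
  set Good : Set Ω := {ω | |‖M.betaHat K (h n) T n ω - M.β‖ / (1 / √n)| ≤
    8 * l * (L ^ 2 + 2 * a) / (c * lam) + 1}
  have hcover : (univ : Set Ω) ⊆ Good ∪ ({ω | ¬ (M.X · ω) ∈ D} ∪
      ({ω | ∃ j, a * √n < |γ ω * M.trendForm K (h n) T n j ω|} ∪
      ({ω | ∃ j, a * √n < |γ ω * M.errorForm (M.smoothRegion P T δ) K (h n) T n j ω|} ∪
      ({ω | ∃ j : Fin l × Fin l, a * √n < |γ ω * M.covarianceForm P T n j.1 j.2 ω|} ∪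
      {ω | ∃ j, ρ * n ≤ γ ω * M.smoothedNoise K (h n) T n j ω})))) := by
    intro ω _
    by_contra hnot
    simp only [mem_union, not_or, mem_ofPred_eq, not_exists, not_lt, not_le, not_not] at hnot
    obtain ⟨hG', hω, h₁, h₂, h₃, h₄⟩ := hnot
    have hγ : γ ω = 1 := indicator_of_mem hω _
    simp only [hγ, one_mul] at h₁ h₂ h₃ h₄
    have hmain := PLModel.norm_betaHat_sub_mul_sqrt_le hK hhn hn3 (hD _ hω) hc hμ hHL hlam hcov
      hn5 hn4 hn6 hn7 h₁ h₂ (fun j j' => h₃ (j, j')) fun j => (h₄ j).le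
    refine hG' ?_
    rw [mem_ofPred_eq, abs_of_nonneg (by positivity), div_div_eq_mul_div, div_one]
    exact hmain.trans (le_add_of_nonneg_right zero_le_one)
  have hone : (1 : ℝ) ≤ P.real Good + (ε / 8 + (l * B₁ / a ^ 2 + (l * B₂ / a ^ 2 +
      (l * l * Γ₂ / a ^ 2 + l * (Γ * (C₂ / h n ^ d) / (ρ * n)))))) := by
    rw [← probReal_univ (μ := P)]
    refine (measureReal_mono hcover (measure_ne_top _ _)).trans ?_
    refine (measureReal_union_le _ _).trans (add_le_add le_rfl ?_)
    refine (measureReal_union_le _ _).trans (add_le_add hn1 ?_)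
    refine (measureReal_union_le _ _).trans (add_le_add p₁ ?_)
    refine (measureReal_union_le _ _).trans (add_le_add p₂ ?_)
    exact (measureReal_union_le _ _).trans (add_le_add p₃ p₄)
  have e6 : l * B₁ / a ^ 2 + (l * B₂ / a ^ 2 + l * l * Γ₂ / a ^ 2) = B₀ / a ^ 2 := by
    simp only [B₀]
    ring
  have e7 : l * (Γ * (C₂ / h n ^ d) / (ρ * n)) = l * (Γ * C₂) / ρ / (h n ^ d * n) := by
    field_simp
  rw [e7] at hone
  linarith
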